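/- Let $F$ be a field of characteristic $0$. A \emph{triality} $\gamma$ of dimension $n$ over $F$ consists of a finite-dimensional vector space $V$ with a non-degenerate symmetric bilinear form $g$, an orthogonal decomposition $V=V_1\oplus V_2\oplus V_3$ into subspaces of dimension $n$, and a symmetric trilinear form $\tau$ on $V$ with $\tau(V_s,V_t,V_r)=0$ unless $s,t,r$ are distinct, such that the commutative product on $V$ defined by $g(xy,z)=\tau(x,y,z)$ satisfies, for all distinct $s,t,r$, $$x(xy)=g(x,x)\,y\qquad (y\in V_t,\ x\in V_s\oplus V_r).$$ Its \emph{triality algebra} $\mathfrak t(\gamma)$ is the Lie algebra of all linear maps $p:V\to V$ that preserve each $V_s$, are skew for $g$, and satisfy $\tau(px,y,z)+\tau(x,py,z)+\tau(x,y,pz)=0$. For $x,y\in V$ let $R(x,y)\in\operatorname{End}(V)$ be $$R(x,y)z=4\big(g(x,z)\,y-g(y,z)\,x\big)+y(xz)-x(yz).$$ Let $\gamma,\gamma'$ be trialities over $F$ of dimensions $n,n'\in\{1,2,4,8\}$; the data of $\gamma'$ are written with a prime. Let $\mathfrak g(\gamma,\gamma')$ be the Lie algebra with underlying space $$\mathfrak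 g(\gamma,\gamma')=\mathfrak t(\gamma)\oplus\mathfrak t(\gamma')\oplus W_1\oplus W_2\oplus W_3,\qquad W_i=V_i\otimes V'_{i+1}\quad(\text{indices mod }3),$$ and the following bracket: $\mathfrak t(\gamma)$ and $\mathfrak t(\gamma')$ are commuting subalgebras; they act on $W_i$ by $[p,x\otimes x']=px\otimes x'$ and $[p',x\otimes x']=x\otimes p'x'$; and $$[x\otimes x',y\otimes y']=g'(x',y')\,R(x,y)+g(x,y)\,R'(x',y')\qquad (x\otimes x',\ y\otimes y'\in W_i),$$ $$[x\otimes x',y\otimes y']=xy\otimes x'y'\in W_{i+2}\qquad (x\otimes x'\in W_i,\ y\otimes y'\in W_{i+1}).$$ \textbf{Theorem.} Let $B$ be the Killing form of $\mathfrak g(\gamma,\gamma')$. \begin{enumerate} \item $B$ is non-degenerate. \item If $(n,n')\neq(2,2)$, then $\mathfrak g(\gamma,\gamma')$ is simple. \item If $(n,n')=(2,2)$, then $\mathfrak g(\gamma,\gamma')$ is of type $A_2\oplus A_2$: for every algebraically closed field $K$ containing $F$ there is an isomorphism of Lie algebras $K\otimes_F\mathfrak g(\gamma,\gamma')\cong\mathfrak{sl}_3(K)\oplus\mathfrak{sl}_3(K)$,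 under which the Killing form of $K\otimes_F\mathfrak g(\gamma,\gamma')$ is the orthogonal sum of the Killing forms of the two copies of $\mathfrak{sl}_3(K)$. \item The restriction of $B$ to each of the summands $\mathfrak t(\gamma)$, $\mathfrak t(\gamma')$, $W_1$, $W_2$, $W_3$ is non-degenerate. \item There is a single non-zero $\lambda\in F$ such that, for each $i$, $B(x\otimes x',y\otimes y')=\lambda\,g(x,y)\,g'(x',y')$ for all $x\otimes x',\,y\otimes y'\in W_i$. \end{enumerate} -/

import Mathlib

open scoped TensorProduct

attribute [local instance] LieRing.ofAssociativeRing

noncomputable section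

universe u v w

set_option linter.unusedSectionVars false

/-- A vector space `V` with a metric `g`, three subspaces `V₀, V₁, V₂` and a symmetric trilinear
form `τ`: all the data of a triality, without the Clifford condition. -/
structure Pretriality (F : Type u) (V : Type v) [Field F] [AddCommGroup V] [Module F V] where
  /-- the metric -/
  g : LinearMap.BilinForm F V
  g_symm : ∀ x y, g x y = g y x
  g_nondeg : g.Nondegenerate
  /-- the three subspaces -/
  comp : Fin 3 → Submodule F V
  comp_inf : ∀ s t, s ≠ t → comp s ⊓ comp t = ⊥
  comp_sup : ⨆ s, comp s = ⊤
  comp_orth : ∀ s t, s ≠ t → ∀ x ∈ comp s, ∀ y ∈ comp t, g x y = 0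
  dim_eq : ∀ s t, (Module.finrank F (comp s) : F) = (Module.finrank F (comp t) : F)
  /-- the trilinear form -/
  τ : V →ₗ[F] V →ₗ[F] V →ₗ[F] F
  τ_symm₁₂ : ∀ x y z, τ x y z = τ y x z
  τ_symm₂₃ : ∀ x y z, τ x y z = τ x z y
  τ_vanish : ∀ s t r, ¬ (s ≠ t ∧ t ≠ r ∧ s ≠ r) →
    ∀ x ∈ comp s, ∀ y ∈ comp t, ∀ z ∈ comp r, τ x y z = 0

namespace Pretriality

variable {F : Type u} {V : Type v} [Field F] [AddCommGroup V] [Module F V] [FiniteDimensional F V]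

/-- The commutative product on `V`, determined by `τ x y z = g (x y) z`. -/
def mul (γ : Pretriality F V) : V →ₗ[F] V →ₗ[F] V :=
  γ.τ.compr₂ (γ.g.toDual γ.g_nondeg).symm.toLinearMap

lemma g_mul (γ : Pretriality F V) (x y z : V) : γ.g (γ.mul x y) z = γ.τ x y z := by
  simp [mul, LinearMap.BilinForm.apply_toDual_symm_apply]

end Pretriality

/-- A triality: the data above, of Clifford algebra type. -/
structure Triality (F : Type u) (V : Type v) [Field F] [AddCommGroup V] [Module F V]
    [FiniteDimensional F V] extends Pretriality F V where
  clifford : ∀ s t r, s ≠ t → t ≠ r → s ≠ r → ∀ y ∈ comp t, ∀ x ∈ comp s ⊔ comp r,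
    toPretriality.mul x (toPretriality.mul x y) = g x x • y

namespace Triality

variable {F : Type u} {V : Type v} [Field F] [AddCommGroup V] [Module F V] [FiniteDimensional F V]

/-- The triality has dimension `n`: each of the three subspaces does. -/
def HasDim (γ : Triality F V) (n : ℕ) : Prop :=
  ∀ s, Module.finrank F (γ.comp s) = n

lemma g_ext (γ : Triality F V) {x y : V} (h : ∀ z, γ.g x z = γ.g y z) : x = y := by
  have := γ.g_nondeg.1 (x - y) (fun z => by simp [h z])
  exact sub_eq_zero.1 this

lemma mul_comm' (γ : Triality F V) (x y : V) : γ.mul x y = γ.mul y x :=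
  γ.g_ext fun z => by rw [γ.g_mul, γ.g_mul, γ.τ_symm₁₂]

/-- Two elements of `V` with the same pairing against each subspace are equal. -/
lemma g_ext_comp (γ : Triality F V) {x y : V}
    (h : ∀ s, ∀ z ∈ γ.comp s, γ.g x z = γ.g y z) : x = y := by
  refine γ.g_ext fun z => ?_
  have hz : z ∈ ⨆ s, γ.comp s := by rw [γ.comp_sup]; trivial
  induction hz using Submodule.iSup_induction' with
  | mem s x hx => exact h s x hx
  | zero => simp
  | add a b _ _ ha hb => simp [ha, hb]

lemma comp_indep (γ : Triality F V) : iSupIndep γ.comp := by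
  intro s
  rw [Submodule.disjoint_def]
  intro x hx hx'
  refine γ.g_ext_comp fun t z hz => ?_
  rw [map_zero, LinearMap.zero_apply]
  by_cases hst : s = t
  · subst hst
    have : (⨆ j, ⨆ (_ : j ≠ s), γ.comp j) ≤ LinearMap.ker (γ.g.flip z) := by
      refine iSup₂_le fun j hj y hy => ?_
      exact γ.comp_orth j s hj y hy z hz
    exact this hx'
  · exact γ.comp_orth s t hst x hx z hz

lemma comp_internal (γ : Triality F V) : DirectSum.IsInternal γ.comp :=
  DirectSum.isInternal_submodule_of_iSupIndep_of_iSup_eq_top γ.comp_indep γ.comp_sup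

/-- The projection of `V` onto the subspace `V_s`, along the other two. -/
def proj (γ : Triality F V) (s : Fin 3) : V →ₗ[F] V :=
  (γ.comp s).subtype ∘ₗ DirectSum.component F (Fin 3) (fun i => γ.comp i) s ∘ₗ
    (LinearEquiv.ofBijective (DirectSum.coeLinearMap γ.comp) γ.comp_internal).symm.toLinearMap

lemma proj_of_mem (γ : Triality F V) {s t : Fin 3} {x : V} (hx : x ∈ γ.comp t) :
    γ.proj s x = if t = s then x else 0 := by
  change ((((LinearEquiv.ofBijective (DirectSum.coeLinearMap γ.comp) γ.comp_internal).symm x) s :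
    γ.comp s) : V) = _
  split_ifs with h
  · subst h
    rw [γ.comp_internal.ofBijective_coeLinearMap_of_mem hx]
  · rw [γ.comp_internal.ofBijective_coeLinearMap_of_mem_ne h hx]
    rfl

lemma mul_mem (γ : Triality F V) {s t r : Fin 3} (htr : t ≠ r) (hsr : s ≠ r)
    {x y : V} (hx : x ∈ γ.comp s) (hy : y ∈ γ.comp t) : γ.mul x y ∈ γ.comp r := by
  have hz : γ.mul x y ∈ ⨆ s, γ.comp s := by rw [γ.comp_sup]; trivial
  have key : ∀ z : V, (z = ∑ i, γ.proj i z) ∧ ∀ i, γ.proj i z ∈ γ.comp i := by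
    intro z
    have hz : z ∈ ⨆ s, γ.comp s := by rw [γ.comp_sup]; trivial
    induction hz using Submodule.iSup_induction' with
    | mem s x hx =>
      refine ⟨by simp [γ.proj_of_mem hx], fun i => ?_⟩
      rw [γ.proj_of_mem hx]
      split_ifs with h
      · exact h ▸ hx
      · exact zero_mem _
    | zero => simp
    | add a b _ _ ha hb =>
      refine ⟨?_, fun i => by rw [map_add]; exact add_mem (ha.2 i) (hb.2 i)⟩
      simp only [map_add, Finset.sum_add_distrib]
      rw [← ha.1, ← hb.1]
  have h2 : γ.mul x y = γ.proj r (γ.mul x y) := by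
    refine γ.g_ext_comp fun i z hz => ?_
    by_cases hi : i = r
    · subst hi
      conv_lhs => rw [(key (γ.mul x y)).1]
      rw [map_sum, LinearMap.sum_apply, Finset.sum_eq_single i]
      · intro j _ hj
        exact γ.comp_orth j i hj _ ((key _).2 j) z hz
      · simp
    · rw [γ.comp_orth r i (Ne.symm hi) _ ((key _).2 r) z hz, γ.g_mul]
      exact γ.τ_vanish s t i (by omega) x hx y hy z hz
  rw [h2]
  exact (key _).2 r

lemma mul_self_comp (γ : Triality F V) {s : Fin 3} {x y : V} (hx : x ∈ γ.comp s)
    (hy : y ∈ γ.comp s) : γ.mul x y = 0 := by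
  refine γ.g_ext_comp fun i z hz => ?_
  rw [γ.g_mul, γ.τ_vanish s s i (by simp) x hx y hy z hz]
  simp

/-- The polarised Clifford identity. -/
lemma clifford₂ (γ : Triality F V) {s t : Fin 3} (hst : s ≠ t) {x z y : V}
    (hx : x ∈ γ.comp s) (hz : z ∈ γ.comp s) (hy : y ∈ γ.comp t) :
    γ.mul x (γ.mul z y) + γ.mul z (γ.mul x y) = (2 * γ.g x z) • y := by
  obtain ⟨r, htr, hsr⟩ : ∃ r : Fin 3, t ≠ r ∧ s ≠ r := by
    clear hx hz hy
    revert s t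
    decide
  have h : ∀ x ∈ γ.comp s, γ.mul x (γ.mul x y) = γ.g x x • y := fun x hx =>
    γ.clifford s t r hst htr hsr y hy x (Submodule.mem_sup_left hx)
  have h1 := h _ (add_mem hx hz)
  have h2 := h _ hx
  have h3 := h _ hz
  simp only [map_add, LinearMap.add_apply, h2, h3, add_smul, γ.g_symm z x] at h1
  linear_combination (norm := module) h1

/-- The triality algebra: skew endomorphisms of `V` which preserve the three subspaces and
annihilate the triality form. -/
def algebra (γ : Triality F V) : LieSubalgebra F (Module.End F V) where
  carrier := {p | (∀ s, ∀ x ∈ γ.comp s, p x ∈ γ.comp s) ∧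
    (∀ x y, γ.g (p x) y + γ.g x (p y) = 0) ∧
    ∀ x y z, γ.τ (p x) y z + γ.τ x (p y) z + γ.τ x y (p z) = 0}
  add_mem' := by
    rintro p q ⟨hp1, hp2, hp3⟩ ⟨hq1, hq2, hq3⟩
    refine ⟨fun s x hx => add_mem (hp1 s x hx) (hq1 s x hx), fun x y => ?_, fun x y z => ?_⟩
    · simp only [LinearMap.add_apply, map_add]
      linear_combination hp2 x y + hq2 x y
    · simp only [LinearMap.add_apply, map_add]
      linear_combination hp3 x y z + hq3 x y z
  zero_mem' := by
    refine ⟨fun s x _ => by simp, fun x y => by simp, fun x y z => by simp⟩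
  smul_mem' := by
    rintro c p ⟨hp1, hp2, hp3⟩
    refine ⟨fun s x hx => Submodule.smul_mem _ c (hp1 s x hx), fun x y => ?_, fun x y z => ?_⟩
    · simp only [LinearMap.smul_apply, map_smul, smul_eq_mul]
      linear_combination c * hp2 x y
    · simp only [LinearMap.smul_apply, map_smul, smul_eq_mul]
      linear_combination c * hp3 x y z
  lie_mem' := by
    rintro p q ⟨hp1, hp2, hp3⟩ ⟨hq1, hq2, hq3⟩
    refine ⟨fun s x hx => ?_, fun x y => ?_, fun x y z => ?_⟩
    · exact sub_mem (hp1 s _ (hq1 s x hx)) (hq1 s _ (hp1 s x hx))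
    · simp only [Ring.lie_def, LinearMap.sub_apply, Module.End.mul_apply, map_sub]
      linear_combination hp2 (q x) y - hq2 (p x) y + hq2 x (p y) * (-1) + hp2 x (q y)
    · simp only [Ring.lie_def, LinearMap.sub_apply, Module.End.mul_apply, map_sub]
      linear_combination hp3 (q x) y z + hp3 x (q y) z + hp3 x y (q z)
        - hq3 (p x) y z - hq3 x (p y) z - hq3 x y (p z)

/-- The orthogonal generator `R(x, y)`, as an endomorphism of `V`. For `x, y ∈ V_s` it is `-8`
times the following operator: on `V_s` the skew-symmetrizer `z ↦ ½ (g(y,z) x - g(x,z) y)`, on the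
other two subspaces the box `z ↦ ⅛ (x(yz) - y(xz))` (the first formula vanishes off `V_s` and
the second on `V_s`). -/
def rot (γ : Triality F V) : V →ₗ[F] V →ₗ[F] Module.End F V :=
  LinearMap.mk₂ F
    (fun x y => (4 : F) • ((γ.g x).smulRight y - (γ.g y).smulRight x)
      + (γ.mul y * γ.mul x - γ.mul x * γ.mul y))
    (by intro a b c; ext z; simp [mul_add]; module)
    (by intro a b c; ext z; simp; module)
    (by intro a b c; ext z; simp; module)
    (by intro a b c; ext z; simp; module)

lemma rot_apply (γ : Triality F V) (x y z : V) :
    γ.rot x y z = (4 : F) • (γ.g x z • y - γ.g y z • x)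
      + (γ.mul y (γ.mul x z) - γ.mul x (γ.mul y z)) := by
  simp [rot]

/-- The product `V_s × V_t → V_r` with the sign of the cyclic order: `xy` for `t = s + 1`,
`-xy` for `s = t + 1`. -/
def cross (γ : Triality F V) : V →ₗ[F] V →ₗ[F] V :=
  ∑ s : Fin 3, ((γ.mul.compl₁₂ (γ.proj s) (γ.proj (s + 1)))
    - (γ.mul.compl₁₂ (γ.proj (s + 1)) (γ.proj s)))


lemma proj_mem (γ : Triality F V) (s : Fin 3) (x : V) : γ.proj s x ∈ γ.comp s :=
  Submodule.coe_mem _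

lemma cross_apply (γ : Triality F V) (x y : V) : γ.cross x y =
    ∑ s : Fin 3, (γ.mul (γ.proj s x) (γ.proj (s + 1) y) - γ.mul (γ.proj (s + 1) x) (γ.proj s y)) := by
  simp [cross, LinearMap.sum_apply]

lemma cross_of_mem (γ : Triality F V) {i j : Fin 3} {x y : V} (hx : x ∈ γ.comp i)
    (hy : y ∈ γ.comp j) : γ.cross x y =
      if j = i + 1 then γ.mul x y else if i = j + 1 then - γ.mul x y else 0 := by
  rw [cross_apply]
  simp only [γ.proj_of_mem hx, γ.proj_of_mem hy, Fin.sum_univ_three]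
  fin_cases i <;> fin_cases j <;> simp

lemma cross_self (γ : Triality F V) (x : V) : γ.cross x x = 0 := by
  rw [cross_apply]
  exact Finset.sum_eq_zero fun s _ => by rw [γ.mul_comm', sub_self]

lemma cross_symm (γ : Triality F V) (x y : V) : γ.cross x y = - γ.cross y x := by
  rw [cross_apply, cross_apply, ← Finset.sum_neg_distrib]
  exact Finset.sum_congr rfl fun s _ => by
    rw [γ.mul_comm' (γ.proj s x), γ.mul_comm' (γ.proj (s + 1) x)]; abel

lemma rot_self (γ : Triality F V) (x : V) : γ.rot x x = 0 := by
  ext z; simp [rot_apply]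

lemma rot_symm (γ : Triality F V) (x y : V) : γ.rot x y = - γ.rot y x := by
  ext z; simp only [rot_apply, LinearMap.neg_apply]; module

lemma algebra_mul (γ : Triality F V) {p : Module.End F V} (hp : p ∈ γ.algebra) (x y : V) :
    p (γ.mul x y) = γ.mul (p x) y + γ.mul x (p y) := by
  obtain ⟨-, h2, h3⟩ := hp
  refine γ.g_ext fun z => ?_
  have e1 := h2 (γ.mul x y) z
  have e2 := h3 x y z
  rw [γ.g_mul] at e1
  rw [map_add, LinearMap.add_apply, γ.g_mul, γ.g_mul]
  linear_combination e1 - e2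

lemma algebra_proj (γ : Triality F V) {p : Module.End F V} (hp : p ∈ γ.algebra) (s : Fin 3)
    (x : V) : γ.proj s (p x) = p (γ.proj s x) := by
  have hx : x ∈ ⨆ s, γ.comp s := by rw [γ.comp_sup]; trivial
  induction hx using Submodule.iSup_induction' with
  | mem t x hx =>
    rw [γ.proj_of_mem hx, γ.proj_of_mem (hp.1 t x hx)]
    split_ifs <;> simp
  | zero => simp
  | add a b _ _ ha hb => simp [ha, hb]

lemma algebra_cross (γ : Triality F V) {p : Module.End F V} (hp : p ∈ γ.algebra) (x y : V) :
    p (γ.cross x y) = γ.cross (p x) y + γ.cross x (p y) := by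
  simp only [cross_apply, map_sum, map_sub, γ.algebra_mul hp, γ.algebra_proj hp]
  rw [← Finset.sum_add_distrib]
  exact Finset.sum_congr rfl fun s _ => by abel

lemma algebra_rot (γ : Triality F V) {p : Module.End F V} (hp : p ∈ γ.algebra) (x y : V) :
    ⁅p, γ.rot x y⁆ = γ.rot (p x) y + γ.rot x (p y) := by
  ext z
  have e1 := hp.2.1 x z
  have e2 := hp.2.1 y z
  have e1' : γ.g x (p z) = - γ.g (p x) z := by linear_combination e1
  have e2' : γ.g y (p z) = - γ.g (p y) z := by linear_combination e2
  simp only [Ring.lie_def, LinearMap.sub_apply, Module.End.mul_apply, LinearMap.add_apply,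
    rot_apply, map_add, map_sub, map_smul, γ.algebra_mul hp, e1', e2']
  module

lemma rot_mem_comp (γ : Triality F V) {s : Fin 3} {x y : V} (hx : x ∈ γ.comp s)
    (hy : y ∈ γ.comp s) (t : Fin 3) (z : V) (hz : z ∈ γ.comp t) : γ.rot x y z ∈ γ.comp t := by
  rw [rot_apply]
  by_cases h : s = t
  · subst h
    rw [γ.mul_self_comp hx hz, γ.mul_self_comp hy hz]
    simp only [map_zero, sub_zero, add_zero]
    exact Submodule.smul_mem _ _ (sub_mem (Submodule.smul_mem _ _ hy) (Submodule.smul_mem _ _ hx))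
  · obtain ⟨r, htr, hsr⟩ : ∃ r : Fin 3, t ≠ r ∧ s ≠ r := by
      clear hx hz hy
      revert s t
      decide
    rw [γ.comp_orth s t h x hx z hz, γ.comp_orth s t h y hy z hz]
    simp only [zero_smul, sub_zero, smul_zero, zero_add]
    exact sub_mem (γ.mul_mem (Ne.symm htr) h hy (γ.mul_mem htr hsr hx hz))
      (γ.mul_mem (Ne.symm htr) h hx (γ.mul_mem htr hsr hy hz))

lemma g_mul_mul (γ : Triality F V) (x y z : V) : γ.g (γ.mul x y) z = γ.g y (γ.mul x z) := by
  rw [γ.g_mul, γ.g_symm y, γ.g_mul, γ.τ_symm₂₃]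

lemma rot_skew (γ : Triality F V) (x y z t : V) :
    γ.g (γ.rot x y z) t + γ.g z (γ.rot x y t) = 0 := by
  simp only [rot_apply, map_add, map_sub, map_smul, LinearMap.add_apply, LinearMap.sub_apply,
    LinearMap.smul_apply, smul_eq_mul, γ.g_mul_mul]
  rw [γ.g_symm z x, γ.g_symm z y, ← γ.g_mul_mul x z, ← γ.g_mul_mul y z]
  ring

lemma rot_deriv_aux (γ : Triality F V) {s t r : Fin 3} (hst : s ≠ t) (hsr : s ≠ r)
    {x y a b c : V} (hx : x ∈ γ.comp s) (hy : y ∈ γ.comp s) (ha : a ∈ γ.comp s)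
    (hb : b ∈ γ.comp t) (hc : c ∈ γ.comp r) :
    γ.τ (γ.rot x y a) b c + γ.τ a (γ.rot x y b) c + γ.τ a b (γ.rot x y c) = 0 := by
  have t2 : ∀ u, γ.τ a u c = γ.g u (γ.mul a c) := fun u => by
    rw [γ.g_symm, γ.g_mul, γ.τ_symm₂₃]
  have t3 : ∀ u, γ.τ a b u = γ.g u (γ.mul a b) := fun u => by
    rw [γ.g_symm, γ.g_mul]
  have k1 := eq_sub_of_add_eq (γ.clifford₂ hsr hy ha hc)
  have k2 := eq_sub_of_add_eq (γ.clifford₂ hsr hx ha hc)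
  have k3 := eq_sub_of_add_eq (γ.clifford₂ hst hy ha hb)
  have k4 := eq_sub_of_add_eq (γ.clifford₂ hst hx ha hb)
  have l1 : γ.g b (γ.mul x (γ.mul a (γ.mul y c))) = γ.g c (γ.mul y (γ.mul a (γ.mul x b))) := by
    rw [← γ.g_mul_mul, ← γ.g_mul_mul, γ.g_symm, γ.g_mul_mul, ← γ.g_mul_mul]
  have l2 : γ.g b (γ.mul y (γ.mul a (γ.mul x c))) = γ.g c (γ.mul x (γ.mul a (γ.mul y b))) := by
    rw [← γ.g_mul_mul, ← γ.g_mul_mul, γ.g_symm, γ.g_mul_mul, ← γ.g_mul_mul]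
  rw [t2, t3]
  simp only [rot_apply, γ.mul_self_comp hx ha, γ.mul_self_comp hy ha,
    γ.comp_orth s t hst x hx b hb, γ.comp_orth s t hst y hy b hb,
    γ.comp_orth s r hsr x hx c hc, γ.comp_orth s r hsr y hy c hc,
    map_zero, zero_smul, sub_zero, add_zero, smul_zero, zero_add, map_sub, map_smul,
    LinearMap.sub_apply, LinearMap.smul_apply, smul_eq_mul, γ.g_mul_mul y, γ.g_mul_mul x,
    k1, k2, k3, k4]
  rw [l1, l2]
  have m1 : ∀ u v, γ.g u (γ.mul x v) = γ.τ x u v := fun u v => by rw [← γ.g_mul_mul, γ.g_mul]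
  have m2 : ∀ u v, γ.g u (γ.mul y v) = γ.τ y u v := fun u v => by rw [← γ.g_mul_mul, γ.g_mul]
  simp only [m1, m2, γ.τ_symm₂₃ x c b, γ.τ_symm₂₃ y c b]
  ring

/-- The orthogonal generators preserve the triality. -/
lemma rot_mem (γ : Triality F V) {s : Fin 3} {x y : V} (hx : x ∈ γ.comp s)
    (hy : y ∈ γ.comp s) : γ.rot x y ∈ γ.algebra := by
  refine ⟨fun t z hz => γ.rot_mem_comp hx hy t z hz, γ.rot_skew x y, fun a b c => ?_⟩
  have ind : ∀ z : V, z ∈ ⨆ s, γ.comp s := fun z => by rw [γ.comp_sup]; trivial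
  induction ind a using Submodule.iSup_induction' with
  | zero => simp
  | add a a' _ _ h h' =>
    simp only [map_add, LinearMap.add_apply] at h h' ⊢
    linear_combination h + h'
  | mem i a ha =>
  induction ind b using Submodule.iSup_induction' with
  | zero => simp
  | add b b' _ _ h h' =>
    simp only [map_add, LinearMap.add_apply] at h h' ⊢
    linear_combination h + h'
  | mem j b hb =>
  induction ind c using Submodule.iSup_induction' with
  | zero => simp
  | add c c' _ _ h h' =>
    simp only [map_add] at h h' ⊢
    linear_combination h + h'
  | mem k c hc =>
  by_cases hijk : i ≠ j ∧ j ≠ k ∧ i ≠ k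
  · obtain ⟨hij, hjk, hik⟩ := hijk
    have : s = i ∨ s = j ∨ s = k := by omega
    rcases this with rfl | rfl | rfl
    · exact γ.rot_deriv_aux hij hik hx hy ha hb hc
    · have := γ.rot_deriv_aux hij.symm hjk hx hy hb ha hc
      rw [γ.τ_symm₁₂ _ a, γ.τ_symm₁₂ b, γ.τ_symm₁₂ b] at this
      linear_combination this
    · have := γ.rot_deriv_aux hik.symm hjk.symm hx hy hc ha hb
      have e : ∀ u v w, γ.τ u v w = γ.τ v w u := fun u v w => by
        rw [γ.τ_symm₁₂, γ.τ_symm₂₃]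
      rw [e _ a b, e c, e c] at this
      linear_combination this
  · rw [γ.τ_vanish i j k hijk _ (γ.rot_mem_comp hx hy i a ha) b hb c hc,
      γ.τ_vanish i j k hijk a ha _ (γ.rot_mem_comp hx hy j b hb) c hc,
      γ.τ_vanish i j k hijk a ha b hb _ (γ.rot_mem_comp hx hy k c hc)]
    simp

/-- The cyclic identity for orthogonal generators. -/
lemma rot_cyclic (γ : Triality F V) {i j k : Fin 3} (hij : i ≠ j) (hjk : j ≠ k) (hik : i ≠ k)
    {x y z : V} (hx : x ∈ γ.comp i) (hy : y ∈ γ.comp j) (hz : z ∈ γ.comp k) :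
    γ.rot x (γ.mul y z) + γ.rot y (γ.mul z x) + γ.rot z (γ.mul x y) = 0 := by
  have key : ∀ {i j k : Fin 3}, i ≠ j → j ≠ k → i ≠ k → ∀ {x y z : V}, x ∈ γ.comp i →
      y ∈ γ.comp j → z ∈ γ.comp k → ∀ v ∈ γ.comp i,
      γ.rot x (γ.mul y z) v + γ.rot y (γ.mul z x) v + γ.rot z (γ.mul x y) v = 0 := by
    intro i j k hij hjk hik x y z hx hy hz v hv
    have hyz := γ.mul_mem hik.symm hij.symm hy hz
    have hzx := γ.mul_mem hij hjk.symm hz hx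
    have hxy := γ.mul_mem hjk hik hx hy
    have hyv := γ.mul_mem hik.symm hij.symm hy hz
    have hvy := γ.mul_mem hjk hik hv hy
    have hvz := γ.mul_mem hjk.symm hij hv hz
    have k1 := eq_sub_of_add_eq' (γ.clifford₂ hik hx hv hz)
    have k2 := eq_sub_of_add_eq' (γ.clifford₂ hij hx hv hy)
    have k3 := eq_sub_of_add_eq' (γ.clifford₂ hik.symm hz hvy hx)
    have k4 := eq_sub_of_add_eq' (γ.clifford₂ hij.symm hy hvz hx)
    have m1 : γ.g z (γ.mul v y) = γ.g (γ.mul y z) v := by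
      rw [γ.g_mul, γ.g_symm, γ.g_mul, γ.τ_symm₁₂, γ.τ_symm₂₃]
    have m2 : γ.g y (γ.mul v z) = γ.g (γ.mul y z) v := by
      rw [γ.mul_comm' v z, ← γ.g_mul_mul, γ.mul_comm' y z]
    have r1 : γ.rot x (γ.mul y z) v
        = (4 : F) • (γ.g x v • γ.mul y z - γ.g (γ.mul y z) v • x) := by
      rw [rot_apply, γ.mul_self_comp hx hv, γ.mul_self_comp hyz hv]
      simp
    have r2 : γ.rot y (γ.mul z x) v = ((2 * γ.g (γ.mul y z) v) • x - γ.mul z (γ.mul x (γ.mul v y)))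
        - ((2 * γ.g x v) • γ.mul y z - γ.mul y (γ.mul x (γ.mul v z))) := by
      rw [rot_apply, γ.comp_orth j i hij.symm y hy v hv, γ.comp_orth j i hij.symm _ hzx v hv,
        γ.mul_comm' (γ.mul z x) (γ.mul y v), γ.mul_comm' y v, k3, γ.mul_comm' (γ.mul z x) v,
        γ.mul_comm' z x, k1, m1, γ.mul_comm' (γ.mul v y) x]
      simp
    have r3 : γ.rot z (γ.mul x y) v = ((2 * γ.g (γ.mul y z) v) • x - γ.mul y (γ.mul x (γ.mul v z)))
        - ((2 * γ.g x v) • γ.mul y z - γ.mul z (γ.mul x (γ.mul v y))) := by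
      rw [rot_apply, γ.comp_orth k i hik.symm z hz v hv, γ.comp_orth k i hik.symm _ hxy v hv,
        γ.mul_comm' (γ.mul x y) (γ.mul z v), γ.mul_comm' z v, γ.mul_comm' x y, k4,
        γ.mul_comm' (γ.mul y x) v, γ.mul_comm' y x, k2, m2, γ.mul_comm' (γ.mul v z) x,
        γ.mul_comm' y z]
      simp
    rw [r1, r2, r3]
    module
  ext v
  simp only [LinearMap.add_apply, LinearMap.zero_apply]
  have hv : v ∈ ⨆ s, γ.comp s := by rw [γ.comp_sup]; trivial
  induction hv using Submodule.iSup_induction' with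
  | zero => simp
  | add a b _ _ ha hb =>
    simp only [map_add]
    linear_combination (norm := module) ha + hb
  | mem s v hv =>
    have : s = i ∨ s = j ∨ s = k := by omega
    rcases this with rfl | rfl | rfl
    · exact key hij hjk hik hx hy hz v hv
    · have := key hjk hik.symm hij.symm hy hz hx v hv
      linear_combination (norm := module) this
    · have := key hik.symm hij hjk.symm hz hx hy v hv
      linear_combination (norm := module) this

end Triality

/-! ### The Lie algebra of a pair of trialities -/

section Pair

variable {F : Type u} {V : Type v} {V' : Type w} [Field F]
  [AddCommGroup V] [Module F V] [FiniteDimensional F V]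
  [AddCommGroup V'] [Module F V'] [FiniteDimensional F V']

namespace Triality

/-- The tensor sector `W_i = V_i ⊗ V'_{i+1}`, as a subspace of `V ⊗ V'`. -/
def sector (γ : Triality F V) (γ' : Triality F V') (i : Fin 3) : Submodule F (V ⊗[F] V') :=
  LinearMap.range (TensorProduct.mapIncl (γ.comp i) (γ'.comp (i + 1)))

/-- The sum of the three tensor sectors. It is direct, because `V` is the direct sum of the
`V_i`. -/
def tensorSpace (γ : Triality F V) (γ' : Triality F V') : Submodule F (V ⊗[F] V') :=
  ⨆ i, sector γ γ' i

/-- `[x ⊗ x', y ⊗ y']`, upper orthogonal part: `g'(x', y') R(x, y)`. -/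
def brUp (γ : Triality F V) (γ' : Triality F V') :
    V ⊗[F] V' →ₗ[F] V ⊗[F] V' →ₗ[F] Module.End F V :=
  (TensorProduct.map₂ γ.rot γ'.g).compr₂ (TensorProduct.rid F (Module.End F V)).toLinearMap

/-- `[x ⊗ x', y ⊗ y']`, lower orthogonal part: `g(x, y) R'(x', y')`. -/
def brLow (γ : Triality F V) (γ' : Triality F V') :
    V ⊗[F] V' →ₗ[F] V ⊗[F] V' →ₗ[F] Module.End F V' :=
  (TensorProduct.map₂ γ.g γ'.rot).compr₂ (TensorProduct.lid F (Module.End F V')).toLinearMap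

/-- `[x ⊗ x', y ⊗ y']`, tensor part: `± xy ⊗ x'y'`, with the sign of the cyclic order. -/
def brTen (γ : Triality F V) (γ' : Triality F V') :
    V ⊗[F] V' →ₗ[F] V ⊗[F] V' →ₗ[F] V ⊗[F] V' :=
  TensorProduct.map₂ γ.cross γ'.mul

variable (γ : Triality F V) (γ' : Triality F V')

@[simp] lemma brUp_tmul (x y : V) (x' y' : V') :
    brUp γ γ' (x ⊗ₜ x') (y ⊗ₜ y') = γ'.g x' y' • γ.rot x y := by
  simp [brUp]

@[simp] lemma brLow_tmul (x y : V) (x' y' : V') :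
    brLow γ γ' (x ⊗ₜ x') (y ⊗ₜ y') = γ.g x y • γ'.rot x' y' := by
  simp [brLow]

@[simp] lemma brTen_tmul (x y : V) (x' y' : V') :
    brTen γ γ' (x ⊗ₜ x') (y ⊗ₜ y') = γ.cross x y ⊗ₜ γ'.mul x' y' := by
  simp [brTen]

lemma tmul_mem_sector {i : Fin 3} {x : V} {x' : V'} (hx : x ∈ γ.comp i)
    (hx' : x' ∈ γ'.comp (i + 1)) : x ⊗ₜ[F] x' ∈ sector γ γ' i :=
  ⟨⟨x, hx⟩ ⊗ₜ ⟨x', hx'⟩, by simp [TensorProduct.mapIncl]⟩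

lemma sector_le (i : Fin 3) : sector γ γ' i ≤ tensorSpace γ γ' := le_iSup _ i

lemma tensorSpace_induction {P : (w : V ⊗[F] V') → w ∈ tensorSpace γ γ' → Prop}
    (h0 : P 0 (zero_mem _))
    (hadd : ∀ a b ha hb, P a ha → P b hb → P (a + b) (add_mem ha hb))
    (h : ∀ i x (hx : x ∈ γ.comp i) x' (hx' : x' ∈ γ'.comp (i + 1)),
      P (x ⊗ₜ x') (sector_le γ γ' i (tmul_mem_sector γ γ' hx hx')))
    {w : V ⊗[F] V'} (hw : w ∈ tensorSpace γ γ') : P w hw := by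
  induction hw using Submodule.iSup_induction' with
  | zero => exact h0
  | add a b ha hb ha' hb' => exact hadd a b ha hb ha' hb'
  | mem i w hw =>
    obtain ⟨t, rfl⟩ := hw
    induction t using TensorProduct.induction_on with
    | zero => simpa using h0
    | tmul x x' => simpa [TensorProduct.mapIncl] using h i x x.2 x' x'.2
    | add a b ha hb =>
      simp only [map_add]
      exact hadd _ _ (sector_le γ γ' i ⟨a, rfl⟩) (sector_le γ γ' i ⟨b, rfl⟩) ha hb

lemma rTensor_mem {p : Module.End F V} (hp : p ∈ γ.algebra) {w : V ⊗[F] V'}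
    (hw : w ∈ tensorSpace γ γ') : p.rTensor V' w ∈ tensorSpace γ γ' := by
  induction hw using tensorSpace_induction with
  | h0 => simp
  | hadd a b _ _ ha hb => rw [map_add]; exact add_mem ha hb
  | h i x hx x' hx' =>
    rw [LinearMap.rTensor_tmul]
    exact sector_le γ γ' i (tmul_mem_sector γ γ' (hp.1 i x hx) hx')

lemma lTensor_mem {q : Module.End F V'} (hq : q ∈ γ'.algebra) {w : V ⊗[F] V'}
    (hw : w ∈ tensorSpace γ γ') : q.lTensor V w ∈ tensorSpace γ γ' := by
  induction hw using tensorSpace_induction with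
  | h0 => simp
  | hadd a b _ _ ha hb => rw [map_add]; exact add_mem ha hb
  | h i x hx x' hx' =>
    rw [LinearMap.lTensor_tmul]
    exact sector_le γ γ' i (tmul_mem_sector γ γ' hx (hq.1 _ x' hx'))

lemma brUp_mem {w w₂ : V ⊗[F] V'} (hw : w ∈ tensorSpace γ γ') (hw₂ : w₂ ∈ tensorSpace γ γ') :
    brUp γ γ' w w₂ ∈ γ.algebra := by
  induction hw using tensorSpace_induction with
  | h0 => simp
  | hadd a b _ _ ha hb => rw [map_add]; exact add_mem ha hb
  | h i x hx x' hx' =>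
  induction hw₂ using tensorSpace_induction with
  | h0 => simp
  | hadd a b _ _ ha hb => rw [map_add]; exact add_mem ha hb
  | h j y hy y' hy' =>
    rw [brUp_tmul]
    by_cases h : i = j
    · subst h
      exact γ.algebra.smul_mem _ (γ.rot_mem hx hy)
    · rw [γ'.comp_orth (i + 1) (j + 1) (by simpa using h) x' hx' y' hy', zero_smul]
      exact zero_mem _

lemma brLow_mem {w w₂ : V ⊗[F] V'} (hw : w ∈ tensorSpace γ γ') (hw₂ : w₂ ∈ tensorSpace γ γ') :
    brLow γ γ' w w₂ ∈ γ'.algebra := by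
  induction hw using tensorSpace_induction with
  | h0 => simp
  | hadd a b _ _ ha hb => rw [map_add]; exact add_mem ha hb
  | h i x hx x' hx' =>
  induction hw₂ using tensorSpace_induction with
  | h0 => simp
  | hadd a b _ _ ha hb => rw [map_add]; exact add_mem ha hb
  | h j y hy y' hy' =>
    rw [brLow_tmul]
    by_cases h : i = j
    · subst h
      exact γ'.algebra.smul_mem _ (γ'.rot_mem hx' hy')
    · rw [γ.comp_orth i j h x hx y hy, zero_smul]
      exact zero_mem _

lemma brTen_mem {w w₂ : V ⊗[F] V'} (hw : w ∈ tensorSpace γ γ') (hw₂ : w₂ ∈ tensorSpace γ γ') :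
    brTen γ γ' w w₂ ∈ tensorSpace γ γ' := by
  induction hw using tensorSpace_induction with
  | h0 => simp
  | hadd a b _ _ ha hb => rw [map_add]; exact add_mem ha hb
  | h i x hx x' hx' =>
  induction hw₂ using tensorSpace_induction with
  | h0 => simp
  | hadd a b _ _ ha hb => rw [map_add]; exact add_mem ha hb
  | h j y hy y' hy' =>
    rw [brTen_tmul, γ.cross_of_mem hx hy]
    by_cases h : i = j
    · subst h
      simp
    · obtain ⟨k, hjk, hik⟩ : ∃ k : Fin 3, j ≠ k ∧ i ≠ k := by
        clear hx hx' hy hy'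
        revert i j
        decide
      have h' := γ'.mul_mem (r := k + 1) (by simpa using hjk) (by simpa using hik) hx' hy'
      have h1 := γ.mul_mem hjk hik hx hy
      refine sector_le γ γ' k (tmul_mem_sector γ γ' ?_ h')
      split_ifs
      · exact h1
      · exact neg_mem h1
      · exact zero_mem _

lemma brUp_symm (a b : V ⊗[F] V') : brUp γ γ' a b = - brUp γ γ' b a := by
  induction a using TensorProduct.induction_on with
  | zero => simp
  | add a a' h h' => simp only [map_add, LinearMap.add_apply, h, h']; abel
  | tmul x x' =>
  induction b using TensorProduct.induction_on with
  | zero => simp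
  | add b b' h h' => simp only [map_add, LinearMap.add_apply, h, h']; abel
  | tmul y y' => rw [brUp_tmul, brUp_tmul, γ.rot_symm, γ'.g_symm, smul_neg]

lemma brLow_symm (a b : V ⊗[F] V') : brLow γ γ' a b = - brLow γ γ' b a := by
  induction a using TensorProduct.induction_on with
  | zero => simp
  | add a a' h h' => simp only [map_add, LinearMap.add_apply, h, h']; abel
  | tmul x x' =>
  induction b using TensorProduct.induction_on with
  | zero => simp
  | add b b' h h' => simp only [map_add, LinearMap.add_apply, h, h']; abel
  | tmul y y' => rw [brLow_tmul, brLow_tmul, γ'.rot_symm, γ.g_symm, smul_neg]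

lemma brTen_symm (a b : V ⊗[F] V') : brTen γ γ' a b = - brTen γ γ' b a := by
  induction a using TensorProduct.induction_on with
  | zero => simp
  | add a a' h h' => simp only [map_add, LinearMap.add_apply, h, h']; abel
  | tmul x x' =>
  induction b using TensorProduct.induction_on with
  | zero => simp
  | add b b' h h' => simp only [map_add, LinearMap.add_apply, h, h']; abel
  | tmul y y' =>
    rw [brTen_tmul, brTen_tmul, γ.cross_symm, γ'.mul_comm', TensorProduct.neg_tmul]

lemma brUp_self (a : V ⊗[F] V') : brUp γ γ' a a = 0 := by
  induction a using TensorProduct.induction_on with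
  | zero => simp
  | add a b h h' =>
    simp only [map_add, LinearMap.add_apply, h, h', brUp_symm γ γ' a b]; abel
  | tmul x x' => rw [brUp_tmul, γ.rot_self, smul_zero]

lemma brLow_self (a : V ⊗[F] V') : brLow γ γ' a a = 0 := by
  induction a using TensorProduct.induction_on with
  | zero => simp
  | add a b h h' =>
    simp only [map_add, LinearMap.add_apply, h, h', brLow_symm γ γ' a b]; abel
  | tmul x x' => rw [brLow_tmul, γ'.rot_self, smul_zero]

lemma brTen_self (a : V ⊗[F] V') : brTen γ γ' a a = 0 := by
  induction a using TensorProduct.induction_on with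
  | zero => simp
  | add a b h h' =>
    simp only [map_add, LinearMap.add_apply, h, h', brTen_symm γ γ' a b]; abel
  | tmul x x' => rw [brTen_tmul, γ.cross_self, TensorProduct.zero_tmul]

variable {γ γ'}

lemma lie_brUp {p : Module.End F V} (hp : p ∈ γ.algebra) (a b : V ⊗[F] V') :
    ⁅p, brUp γ γ' a b⁆ = brUp γ γ' (p.rTensor V' a) b + brUp γ γ' a (p.rTensor V' b) := by
  induction a using TensorProduct.induction_on with
  | zero => simp
  | add a a' h h' => simp only [map_add, LinearMap.add_apply, h, h', lie_add]; abel
  | tmul x x' =>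
  induction b using TensorProduct.induction_on with
  | zero => simp
  | add b b' h h' => simp only [map_add, h, h', lie_add]; abel
  | tmul y y' =>
    simp only [brUp_tmul, LinearMap.rTensor_tmul, lie_smul, γ.algebra_rot hp, smul_add]

lemma lie_brLow {q : Module.End F V'} (hq : q ∈ γ'.algebra) (a b : V ⊗[F] V') :
    ⁅q, brLow γ γ' a b⁆ = brLow γ γ' (q.lTensor V a) b + brLow γ γ' a (q.lTensor V b) := by
  induction a using TensorProduct.induction_on with
  | zero => simp
  | add a a' h h' => simp only [map_add, LinearMap.add_apply, h, h', lie_add]; abel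
  | tmul x x' =>
  induction b using TensorProduct.induction_on with
  | zero => simp
  | add b b' h h' => simp only [map_add, h, h', lie_add]; abel
  | tmul y y' =>
    simp only [brLow_tmul, LinearMap.lTensor_tmul, lie_smul, γ'.algebra_rot hq, smul_add]

lemma brUp_lTensor {q : Module.End F V'} (hq : q ∈ γ'.algebra) (a b : V ⊗[F] V') :
    brUp γ γ' (q.lTensor V a) b + brUp γ γ' a (q.lTensor V b) = 0 := by
  induction a using TensorProduct.induction_on with
  | zero => simp
  | add a a' h h' =>
    simp only [map_add, LinearMap.add_apply]
    linear_combination (norm := module) h + h'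
  | tmul x x' =>
  induction b using TensorProduct.induction_on with
  | zero => simp
  | add b b' h h' =>
    simp only [map_add]
    linear_combination (norm := module) h + h'
  | tmul y y' =>
    simp only [brUp_tmul, LinearMap.lTensor_tmul, ← add_smul, hq.2.1 x' y', zero_smul]

lemma brLow_rTensor {p : Module.End F V} (hp : p ∈ γ.algebra) (a b : V ⊗[F] V') :
    brLow γ γ' (p.rTensor V' a) b + brLow γ γ' a (p.rTensor V' b) = 0 := by
  induction a using TensorProduct.induction_on with
  | zero => simp
  | add a a' h h' =>
    simp only [map_add, LinearMap.add_apply]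
    linear_combination (norm := module) h + h'
  | tmul x x' =>
  induction b using TensorProduct.induction_on with
  | zero => simp
  | add b b' h h' =>
    simp only [map_add]
    linear_combination (norm := module) h + h'
  | tmul y y' =>
    simp only [brLow_tmul, LinearMap.rTensor_tmul, ← add_smul, hp.2.1 x y, zero_smul]

lemma rTensor_brTen {p : Module.End F V} (hp : p ∈ γ.algebra) (a b : V ⊗[F] V') :
    p.rTensor V' (brTen γ γ' a b)
      = brTen γ γ' (p.rTensor V' a) b + brTen γ γ' a (p.rTensor V' b) := by
  induction a using TensorProduct.induction_on with
  | zero => simp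
  | add a a' h h' => simp only [map_add, LinearMap.add_apply, h, h']; abel
  | tmul x x' =>
  induction b using TensorProduct.induction_on with
  | zero => simp
  | add b b' h h' => simp only [map_add, h, h']; abel
  | tmul y y' =>
    simp only [brTen_tmul, LinearMap.rTensor_tmul, γ.algebra_cross hp, TensorProduct.add_tmul]

lemma lTensor_brTen {q : Module.End F V'} (hq : q ∈ γ'.algebra) (a b : V ⊗[F] V') :
    q.lTensor V (brTen γ γ' a b)
      = brTen γ γ' (q.lTensor V a) b + brTen γ γ' a (q.lTensor V b) := by
  induction a using TensorProduct.induction_on with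
  | zero => simp
  | add a a' h h' => simp only [map_add, LinearMap.add_apply, h, h']; abel
  | tmul x x' =>
  induction b using TensorProduct.induction_on with
  | zero => simp
  | add b b' h h' => simp only [map_add, h, h']; abel
  | tmul y y' =>
    simp only [brTen_tmul, LinearMap.lTensor_tmul, γ'.algebra_mul hq, TensorProduct.tmul_add]

lemma exists_cross (γ : Triality F V) {i j k : Fin 3} (hij : i ≠ j)
    (hjk : j ≠ k) (hik : i ≠ k) {x y z : V} (hx : x ∈ γ.comp i) (hy : y ∈ γ.comp j)
    (hz : z ∈ γ.comp k) : ∃ ε : F, γ.cross y z = ε • γ.mul y z ∧ γ.cross z x = ε • γ.mul z x ∧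
      γ.cross x y = ε • γ.mul x y := by
  rw [γ.cross_of_mem hx hy, γ.cross_of_mem hy hz, γ.cross_of_mem hz hx]
  by_cases h1 : j = i + 1
  · have h2 : k = j + 1 := by omega
    have h3 : i = k + 1 := by omega
    rw [if_pos h1, if_pos h2, if_pos h3]
    exact ⟨1, by simp⟩
  · have h2 : ¬ k = j + 1 := by omega
    have h3 : ¬ i = k + 1 := by omega
    rw [if_neg h1, if_neg h2, if_neg h3, if_pos (by omega), if_pos (by omega), if_pos (by omega)]
    exact ⟨-1, by simp⟩

lemma g_mul_rotate (γ : Triality F V) (x y z : V) :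
    γ.g x (γ.mul y z) = γ.τ x y z ∧ γ.g y (γ.mul z x) = γ.τ x y z ∧
      γ.g z (γ.mul x y) = γ.τ x y z := by
  refine ⟨?_, ?_, ?_⟩
  · rw [γ.g_symm, γ.g_mul, γ.τ_symm₂₃, γ.τ_symm₁₂]
  · rw [γ.g_symm, γ.g_mul, γ.τ_symm₁₂, γ.τ_symm₂₃]
  · rw [γ.g_symm, γ.g_mul]

lemma brUp_cyclic {a b c : V ⊗[F] V'} (ha : a ∈ tensorSpace γ γ') (hb : b ∈ tensorSpace γ γ')
    (hc : c ∈ tensorSpace γ γ') : brUp γ γ' a (brTen γ γ' b c) + brUp γ γ' b (brTen γ γ' c a)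
      + brUp γ γ' c (brTen γ γ' a b) = 0 := by
  induction ha using tensorSpace_induction with
  | h0 => simp
  | hadd a a' _ _ h h' =>
    simp only [map_add, LinearMap.add_apply] at h h' ⊢
    linear_combination (norm := module) h + h'
  | h i x hx x' hx' =>
  induction hb using tensorSpace_induction with
  | h0 => simp
  | hadd a a' _ _ h h' =>
    simp only [map_add, LinearMap.add_apply] at h h' ⊢
    linear_combination (norm := module) h + h'
  | h j y hy y' hy' =>
  induction hc using tensorSpace_induction with
  | h0 => simp
  | hadd a a' _ _ h h' =>
    simp only [map_add, LinearMap.add_apply] at h h' ⊢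
    linear_combination (norm := module) h + h'
  | h k z hz z' hz' =>
    obtain ⟨e1, e2, e3⟩ := γ'.g_mul_rotate x' y' z'
    simp only [brTen_tmul, brUp_tmul, e1, e2, e3, ← smul_add]
    by_cases hijk : i ≠ j ∧ j ≠ k ∧ i ≠ k
    · obtain ⟨ε, h1, h2, h3⟩ := γ.exists_cross hijk.1 hijk.2.1 hijk.2.2 hx hy hz
      rw [h1, h2, h3, map_smul, map_smul, map_smul, ← smul_add, ← smul_add,
        γ.rot_cyclic hijk.1 hijk.2.1 hijk.2.2 hx hy hz, smul_zero, smul_zero]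
    · rw [γ'.τ_vanish (i + 1) (j + 1) (k + 1) (by simpa using hijk) x' hx' y' hy' z' hz', zero_smul]

lemma brLow_cyclic {a b c : V ⊗[F] V'} (ha : a ∈ tensorSpace γ γ') (hb : b ∈ tensorSpace γ γ')
    (hc : c ∈ tensorSpace γ γ') : brLow γ γ' a (brTen γ γ' b c) + brLow γ γ' b (brTen γ γ' c a)
      + brLow γ γ' c (brTen γ γ' a b) = 0 := by
  induction ha using tensorSpace_induction with
  | h0 => simp
  | hadd a a' _ _ h h' =>
    simp only [map_add, LinearMap.add_apply] at h h' ⊢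
    linear_combination (norm := module) h + h'
  | h i x hx x' hx' =>
  induction hb using tensorSpace_induction with
  | h0 => simp
  | hadd a a' _ _ h h' =>
    simp only [map_add, LinearMap.add_apply] at h h' ⊢
    linear_combination (norm := module) h + h'
  | h j y hy y' hy' =>
  induction hc using tensorSpace_induction with
  | h0 => simp
  | hadd a a' _ _ h h' =>
    simp only [map_add, LinearMap.add_apply] at h h' ⊢
    linear_combination (norm := module) h + h'
  | h k z hz z' hz' =>
    obtain ⟨e1, e2, e3⟩ := γ.g_mul_rotate x y z
    simp only [brTen_tmul, brLow_tmul]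
    by_cases hijk : i ≠ j ∧ j ≠ k ∧ i ≠ k
    · obtain ⟨ε, h1, h2, h3⟩ := γ.exists_cross hijk.1 hijk.2.1 hijk.2.2 hx hy hz
      rw [h1, h2, h3, map_smul, map_smul, map_smul, e1, e2, e3, ← smul_add, ← smul_add,
        γ'.rot_cyclic (i := i + 1) (j := j + 1) (k := k + 1) (by simpa using hijk.1)
          (by simpa using hijk.2.1) (by simpa using hijk.2.2) hx' hy' hz', smul_zero]
    · have h1 : ∀ u v w : V, ∀ l m n : Fin 3, ¬ (l ≠ m ∧ m ≠ n ∧ l ≠ n) → u ∈ γ.comp l →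
          v ∈ γ.comp m → w ∈ γ.comp n → γ.g u (γ.cross v w) = 0 := by
        intro u v w l m n hlmn hu hv hw
        have : γ.g u (γ.mul v w) = 0 := by
          rw [(γ.g_mul_rotate u v w).1]
          exact γ.τ_vanish l m n hlmn u hu v hv w hw
        rw [γ.cross_of_mem hv hw]
        split_ifs <;> simp [this]
      rw [h1 x y z i j k hijk hx hy hz, h1 y z x j k i (by omega) hy hz hx,
        h1 z x y k i j (by omega) hz hx hy]
      simp

/-- `[[a, b], c]` for tensor generators `a, b, c`, tensor part. -/
def brTri (γ : Triality F V) (γ' : Triality F V') (a b c : V ⊗[F] V') : V ⊗[F] V' :=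
  (brUp γ γ' a b).rTensor V' c + (brLow γ γ' a b).lTensor V c + brTen γ γ' (brTen γ γ' a b) c

lemma cross_cross (γ : Triality F V) {i j : Fin 3} (hij : i ≠ j) {x y z : V}
    (hx : x ∈ γ.comp i) (hy : y ∈ γ.comp i) (hz : z ∈ γ.comp j) :
    γ.cross (γ.cross y z) x = γ.mul x (γ.mul y z) ∧
      γ.cross (γ.cross z x) y = - γ.mul y (γ.mul x z) := by
  obtain ⟨k, hjk, hik⟩ : ∃ k : Fin 3, j ≠ k ∧ i ≠ k := by
    clear hx hy hz
    revert i j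
    decide
  have hyz := γ.mul_mem hjk hik hy hz
  have hzx := γ.mul_mem hik hjk hz hx
  rw [γ.cross_of_mem hy hz, γ.cross_of_mem hz hx, γ.mul_comm' x (γ.mul y z), γ.mul_comm' x z,
    γ.mul_comm' y (γ.mul z x)]
  by_cases h1 : j = i + 1
  · rw [if_pos h1, if_neg (by omega), if_pos h1, map_neg, LinearMap.neg_apply,
      γ.cross_of_mem hyz hx, γ.cross_of_mem hzx hy, if_pos (by omega), if_pos (by omega)]
    simp
  · rw [if_neg h1, if_pos (by omega), if_pos (by omega), map_neg, LinearMap.neg_apply,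
      γ.cross_of_mem hyz hx, γ.cross_of_mem hzx hy, if_neg (by omega), if_pos (by omega),
      if_neg (by omega), if_pos (by omega)]
    simp

lemma brTri_cyclic_aux {i k : Fin 3} {x y z : V} {x' y' z' : V'} (hx : x ∈ γ.comp i)
    (hy : y ∈ γ.comp i) (hz : z ∈ γ.comp k) (hx' : x' ∈ γ'.comp (i + 1))
    (hy' : y' ∈ γ'.comp (i + 1)) (hz' : z' ∈ γ'.comp (k + 1)) :
    brTri γ γ' (x ⊗ₜ x') (y ⊗ₜ y') (z ⊗ₜ z') + brTri γ γ' (y ⊗ₜ y') (z ⊗ₜ z') (x ⊗ₜ x')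
      + brTri γ γ' (z ⊗ₜ z') (x ⊗ₜ x') (y ⊗ₜ y') = 0 := by
  by_cases hik : i = k
  · subst hik
    simp only [brTri, brUp_tmul, brLow_tmul, brTen_tmul, LinearMap.rTensor_smul,
      LinearMap.lTensor_smul, LinearMap.smul_apply, LinearMap.rTensor_tmul, LinearMap.lTensor_tmul,
      rot_apply, γ.mul_self_comp hx hy, γ.mul_self_comp hy hz, γ.mul_self_comp hz hx,
      γ.mul_self_comp hy hx, γ.mul_self_comp hz hy, γ.mul_self_comp hx hz,
      γ'.mul_self_comp hx' hy', γ'.mul_self_comp hy' hz', γ'.mul_self_comp hz' hx',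
      γ'.mul_self_comp hy' hx', γ'.mul_self_comp hz' hy', γ'.mul_self_comp hx' hz',
      map_zero, sub_zero, add_zero, TensorProduct.tmul_zero, LinearMap.zero_apply,
      γ.g_symm y x, γ.g_symm z x, γ.g_symm z y, γ'.g_symm y' x', γ'.g_symm z' x', γ'.g_symm z' y',
      TensorProduct.tmul_sub, TensorProduct.sub_tmul, TensorProduct.tmul_smul,
      ← TensorProduct.smul_tmul', smul_sub]
    module
  · have hik' : i + 1 ≠ k + 1 := by simpa using hik
    obtain ⟨c1, c2⟩ := γ.cross_cross hik hx hy hz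
    have k1 := eq_sub_of_add_eq (γ.clifford₂ hik hy hx hz)
    have k2 := eq_sub_of_add_eq (γ'.clifford₂ hik' hy' hx' hz')
    simp only [brTri, brUp_tmul, brLow_tmul, brTen_tmul, LinearMap.rTensor_smul,
      LinearMap.lTensor_smul, LinearMap.smul_apply, LinearMap.rTensor_tmul, LinearMap.lTensor_tmul,
      rot_apply, γ'.mul_self_comp hx' hy', c1, c2, γ'.mul_comm' (γ'.mul y' z') x',
      γ'.mul_comm' z' x', γ'.mul_comm' (γ'.mul x' z') y', k1, k2,
      γ.comp_orth i k hik x hx z hz, γ.comp_orth i k hik y hy z hz,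
      γ.comp_orth k i (Ne.symm hik) z hz x hx,
      γ'.comp_orth _ _ hik' x' hx' z' hz', γ'.comp_orth _ _ hik' y' hy' z' hz',
      γ'.comp_orth _ _ hik'.symm z' hz' x' hx', zero_smul, smul_zero,
      map_zero, sub_zero, add_zero, zero_add, TensorProduct.tmul_zero, LinearMap.zero_apply,
      γ.g_symm y x, γ'.g_symm y' x', TensorProduct.neg_tmul,
      TensorProduct.zero_tmul,
      TensorProduct.tmul_sub, TensorProduct.sub_tmul, TensorProduct.tmul_smul,
      ← TensorProduct.smul_tmul']
    module

lemma brTri_add₁ (a a' b c : V ⊗[F] V') :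
    brTri γ γ' (a + a') b c = brTri γ γ' a b c + brTri γ γ' a' b c := by
  simp only [brTri, map_add, LinearMap.add_apply, LinearMap.rTensor_add, LinearMap.lTensor_add]
  abel

lemma brTri_add₂ (a b b' c : V ⊗[F] V') :
    brTri γ γ' a (b + b') c = brTri γ γ' a b c + brTri γ γ' a b' c := by
  simp only [brTri, map_add, LinearMap.add_apply, LinearMap.rTensor_add, LinearMap.lTensor_add]
  abel

lemma brTri_add₃ (a b c c' : V ⊗[F] V') :
    brTri γ γ' a b (c + c') = brTri γ γ' a b c + brTri γ γ' a b c' := by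
  simp only [brTri, map_add]
  abel

lemma brTri_cyclic {a b c : V ⊗[F] V'} (ha : a ∈ tensorSpace γ γ') (hb : b ∈ tensorSpace γ γ')
    (hc : c ∈ tensorSpace γ γ') :
    brTri γ γ' a b c + brTri γ γ' b c a + brTri γ γ' c a b = 0 := by
  induction ha using tensorSpace_induction with
  | h0 => simp [brTri]
  | hadd a a' _ _ h h' =>
    simp only [brTri_add₁, brTri_add₂, brTri_add₃] at h h' ⊢
    linear_combination (norm := module) h + h'
  | h i x hx x' hx' =>
  induction hb using tensorSpace_induction with
  | h0 => simp [brTri]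
  | hadd a a' _ _ h h' =>
    simp only [brTri_add₁, brTri_add₂, brTri_add₃] at h h' ⊢
    linear_combination (norm := module) h + h'
  | h j y hy y' hy' =>
  induction hc using tensorSpace_induction with
  | h0 => simp [brTri]
  | hadd a a' _ _ h h' =>
    simp only [brTri_add₁, brTri_add₂, brTri_add₃] at h h' ⊢
    linear_combination (norm := module) h + h'
  | h k z hz z' hz' =>
    by_cases hij : i = j
    · subst hij
      exact brTri_cyclic_aux hx hy hz hx' hy' hz'
    by_cases hjk : j = k
    · subst hjk
      linear_combination (norm := module) brTri_cyclic_aux hy hz hx hy' hz' hx'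
    by_cases hik : i = k
    · subst hik
      linear_combination (norm := module) brTri_cyclic_aux hz hx hy hz' hx' hy'
    have key : ∀ {i j k : Fin 3}, i ≠ j → j ≠ k → i ≠ k → ∀ {x y z : V} {x' y' z' : V'},
        x ∈ γ.comp i → y ∈ γ.comp j → x' ∈ γ'.comp (i + 1) → y' ∈ γ'.comp (j + 1) →
        z' ∈ γ'.comp (k + 1) → brTri γ γ' (x ⊗ₜ x') (y ⊗ₜ y') (z ⊗ₜ z') = 0 := by
      intro i j k hij hjk hik x y z x' y' z' hx hy hx' hy' hz'
      have hm := γ'.mul_mem (r := k + 1) (by simpa using hjk) (by simpa using hik) hx' hy'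
      simp [brTri, γ.comp_orth i j hij x hx y hy,
        γ'.comp_orth (i + 1) (j + 1) (by simpa using hij) x' hx' y' hy', γ'.mul_self_comp hm hz']
    rw [key hij hjk hik hx hy hx' hy' hz', key hjk (Ne.symm hik) (Ne.symm hij) hy hz hy' hz' hx',
      key (Ne.symm hik) hij (Ne.symm hjk) hz hx hz' hx' hy']
    simp

lemma rTensor_lie (p q : Module.End F V) (t : V ⊗[F] V') : (⁅p, q⁆).rTensor V' t
    = p.rTensor V' (q.rTensor V' t) - q.rTensor V' (p.rTensor V' t) := by
  rw [Ring.lie_def, LinearMap.rTensor_sub, LinearMap.rTensor_mul, LinearMap.rTensor_mul]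
  rfl

lemma lTensor_lie (p q : Module.End F V') (t : V ⊗[F] V') : (⁅p, q⁆).lTensor V t
    = p.lTensor V (q.lTensor V t) - q.lTensor V (p.lTensor V t) := by
  rw [Ring.lie_def, LinearMap.lTensor_sub, LinearMap.lTensor_mul, LinearMap.lTensor_mul]
  rfl

lemma lTensor_rTensor (p : Module.End F V) (q : Module.End F V') (t : V ⊗[F] V') :
    q.lTensor V (p.rTensor V' t) = p.rTensor V' (q.lTensor V t) := by
  rw [← LinearMap.comp_apply, ← LinearMap.comp_apply, LinearMap.lTensor_comp_rTensor,
    LinearMap.rTensor_comp_lTensor]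

/-- The Lie algebra of a pair of trialities: the direct sum of the two triality algebras and the
three tensor sectors. -/
def PairAlgebra (γ : Triality F V) (γ' : Triality F V') : Type (max v w) :=
  γ.algebra × γ'.algebra × tensorSpace γ γ'

instance : AddCommGroup (PairAlgebra γ γ') :=
  inferInstanceAs (AddCommGroup (γ.algebra × γ'.algebra × tensorSpace γ γ'))

instance : Module F (PairAlgebra γ γ') :=
  inferInstanceAs (Module F (γ.algebra × γ'.algebra × tensorSpace γ γ'))

namespace PairAlgebra

/-- The upper part of an element. -/
def up : PairAlgebra γ γ' →ₗ[F] Module.End F V :=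
  γ.algebra.toSubmodule.subtype ∘ₗ LinearMap.fst F γ.algebra (γ'.algebra × tensorSpace γ γ')

/-- The lower part of an element. -/
def low : PairAlgebra γ γ' →ₗ[F] Module.End F V' :=
  γ'.algebra.toSubmodule.subtype ∘ₗ LinearMap.fst F γ'.algebra (tensorSpace γ γ') ∘ₗ
    LinearMap.snd F γ.algebra (γ'.algebra × tensorSpace γ γ')

/-- The tensor part of an element. -/
def ten : PairAlgebra γ γ' →ₗ[F] V ⊗[F] V' :=
  (tensorSpace γ γ').subtype ∘ₗ LinearMap.snd F γ'.algebra (tensorSpace γ γ') ∘ₗ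
    LinearMap.snd F γ.algebra (γ'.algebra × tensorSpace γ γ')

lemma up_mem (a : PairAlgebra γ γ') : up a ∈ γ.algebra := a.1.2
lemma low_mem (a : PairAlgebra γ γ') : low a ∈ γ'.algebra := a.2.1.2
lemma ten_mem (a : PairAlgebra γ γ') : ten a ∈ tensorSpace γ γ' := a.2.2.2

/-- The element with given parts. -/
def mk (p : Module.End F V) (q : Module.End F V') (t : V ⊗[F] V') (hp : p ∈ γ.algebra)
    (hq : q ∈ γ'.algebra) (ht : t ∈ tensorSpace γ γ') : PairAlgebra γ γ' :=
  (⟨p, hp⟩, ⟨q, hq⟩, ⟨t, ht⟩)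

@[ext] lemma ext {a b : PairAlgebra γ γ'} (h1 : up a = up b) (h2 : low a = low b)
    (h3 : ten a = ten b) : a = b :=
  Prod.ext (Subtype.ext h1) (Prod.ext (Subtype.ext h2) (Subtype.ext h3))

/-- The triality algebras act on the tensors through their own factor; the bracket of two tensors
has an upper, a lower and a tensor part. -/
instance : Bracket (PairAlgebra γ γ') (PairAlgebra γ γ') where
  bracket a b := mk
    (⁅up a, up b⁆ + brUp γ γ' (ten a) (ten b))
    (⁅low a, low b⁆ + brLow γ γ' (ten a) (ten b))
    (((up a).rTensor V' (ten b) + (low a).lTensor V (ten b))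
      - ((up b).rTensor V' (ten a) + (low b).lTensor V (ten a))
      + brTen γ γ' (ten a) (ten b))
    (add_mem (γ.algebra.lie_mem (up_mem a) (up_mem b)) (brUp_mem γ γ' (ten_mem a) (ten_mem b)))
    (add_mem (γ'.algebra.lie_mem (low_mem a) (low_mem b)) (brLow_mem γ γ' (ten_mem a) (ten_mem b)))
    (add_mem (sub_mem
      (add_mem (rTensor_mem γ γ' (up_mem a) (ten_mem b)) (lTensor_mem γ γ' (low_mem a) (ten_mem b)))
      (add_mem (rTensor_mem γ γ' (up_mem b) (ten_mem a)) (lTensor_mem γ γ' (low_mem b) (ten_mem a))))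
      (brTen_mem γ γ' (ten_mem a) (ten_mem b)))

lemma up_lie (a b : PairAlgebra γ γ') :
    up ⁅a, b⁆ = ⁅up a, up b⁆ + brUp γ γ' (ten a) (ten b) := rfl

lemma low_lie (a b : PairAlgebra γ γ') :
    low ⁅a, b⁆ = ⁅low a, low b⁆ + brLow γ γ' (ten a) (ten b) := rfl

lemma ten_lie (a b : PairAlgebra γ γ') :
    ten ⁅a, b⁆ = ((up a).rTensor V' (ten b) + (low a).lTensor V (ten b))
      - ((up b).rTensor V' (ten a) + (low b).lTensor V (ten a))
      + brTen γ γ' (ten a) (ten b) := rfl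

instance : LieRing (PairAlgebra γ γ') where
  add_lie a b c := by
    ext1
    · simp only [up_lie, map_add, add_lie, LinearMap.add_apply]; abel
    · simp only [low_lie, map_add, add_lie, LinearMap.add_apply]; abel
    · simp only [ten_lie, map_add, LinearMap.add_apply, LinearMap.rTensor_add,
        LinearMap.lTensor_add]; abel
  lie_add a b c := by
    ext1
    · simp only [up_lie, map_add, lie_add]; abel
    · simp only [low_lie, map_add, lie_add]; abel
    · simp only [ten_lie, map_add, LinearMap.add_apply, LinearMap.rTensor_add,
        LinearMap.lTensor_add]; abel
  lie_self a := by
    ext1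
    · simp only [up_lie, lie_self, brUp_self, map_zero, add_zero]
    · simp only [low_lie, lie_self, brLow_self, map_zero, add_zero]
    · simp only [ten_lie, sub_self, brTen_self, map_zero, add_zero]
  leibniz_lie a b c := by
    have hu := brUp_cyclic (ten_mem a) (ten_mem b) (ten_mem c)
    have hl := brLow_cyclic (ten_mem a) (ten_mem b) (ten_mem c)
    have ht := brTri_cyclic (ten_mem a) (ten_mem b) (ten_mem c)
    have hca := brTen_symm γ γ' (ten c) (ten a)
    ext1
    · have e : brUp γ γ' (ten b) (brTen γ γ' (ten c) (ten a))
          = - brUp γ γ' (ten b) (brTen γ γ' (ten a) (ten c)) := by rw [hca, map_neg]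
      simp only [up_lie, ten_lie, map_add, map_sub, add_lie, lie_add, LinearMap.add_apply,
        LinearMap.sub_apply]
      linear_combination (norm := module) leibniz_lie (up a) (up b) (up c)
        + lie_brUp (up_mem a) (ten b) (ten c) - lie_brUp (up_mem b) (ten a) (ten c)
        + lie_brUp (up_mem c) (ten a) (ten b)
        + lie_skew (brUp γ γ' (ten a) (ten b)) (up c)
        + brUp_symm γ γ' (ten b) ((up c).rTensor V' (ten a))
        + brUp_symm γ γ' (ten b) ((low c).lTensor V (ten a))
        + brUp_lTensor (γ := γ) (low_mem b) (ten a) (ten c)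
        - brUp_lTensor (γ := γ) (low_mem a) (ten b) (ten c)
        - brUp_lTensor (γ := γ) (low_mem c) (ten a) (ten b)
        + hu - brUp_symm γ γ' (brTen γ γ' (ten a) (ten b)) (ten c) - e
    · have e : brLow γ γ' (ten b) (brTen γ γ' (ten c) (ten a))
          = - brLow γ γ' (ten b) (brTen γ γ' (ten a) (ten c)) := by rw [hca, map_neg]
      simp only [low_lie, ten_lie, map_add, map_sub, add_lie, lie_add, LinearMap.add_apply,
        LinearMap.sub_apply]
      linear_combination (norm := module) leibniz_lie (low a) (low b) (low c)
        + lie_brLow (low_mem a) (ten b) (ten c) - lie_brLow (low_mem b) (ten a) (ten c)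
        + lie_brLow (low_mem c) (ten a) (ten b)
        + lie_skew (brLow γ γ' (ten a) (ten b)) (low c)
        + brLow_symm γ γ' (ten b) ((up c).rTensor V' (ten a))
        + brLow_symm γ γ' (ten b) ((low c).lTensor V (ten a))
        + brLow_rTensor (γ' := γ') (up_mem b) (ten a) (ten c)
        - brLow_rTensor (γ' := γ') (up_mem a) (ten b) (ten c)
        - brLow_rTensor (γ' := γ') (up_mem c) (ten a) (ten b)
        + hl - brLow_symm γ γ' (brTen γ γ' (ten a) (ten b)) (ten c) - e
    · have e : brTen γ γ' (brTen γ γ' (ten c) (ten a)) (ten b)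
          = - brTen γ γ' (brTen γ γ' (ten a) (ten c)) (ten b) := by
        rw [hca, map_neg, LinearMap.neg_apply]
      have e1 : (brUp γ γ' (ten c) (ten a)).rTensor V' (ten b)
          = - (brUp γ γ' (ten a) (ten c)).rTensor V' (ten b) := by
        rw [brUp_symm, LinearMap.rTensor_neg, LinearMap.neg_apply]
      have e2 : (brLow γ γ' (ten c) (ten a)).lTensor V (ten b)
          = - (brLow γ γ' (ten a) (ten c)).lTensor V (ten b) := by
        rw [brLow_symm, LinearMap.lTensor_neg, LinearMap.neg_apply]
      simp only [brTri] at ht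
      simp only [up_lie, low_lie, ten_lie, map_add, map_sub, LinearMap.add_apply,
        LinearMap.sub_apply, LinearMap.rTensor_add, LinearMap.lTensor_add, rTensor_lie,
        lTensor_lie, lTensor_rTensor]
      linear_combination (norm := module) rTensor_brTen (γ' := γ') (up_mem a) (ten b) (ten c)
        + rTensor_brTen (γ' := γ') (up_mem c) (ten a) (ten b)
        - rTensor_brTen (γ' := γ') (up_mem b) (ten a) (ten c)
        + lTensor_brTen (γ := γ) (low_mem a) (ten b) (ten c)
        + lTensor_brTen (γ := γ) (low_mem c) (ten a) (ten b)
        - lTensor_brTen (γ := γ) (low_mem b) (ten a) (ten c)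
        + brTen_symm γ γ' (ten b) ((up c).rTensor V' (ten a))
        + brTen_symm γ γ' (ten b) ((low c).lTensor V (ten a))
        - ht + brTen_symm γ γ' (ten a) (brTen γ γ' (ten b) (ten c))
        - brTen_symm γ γ' (ten b) (brTen γ γ' (ten a) (ten c)) + e + e1 + e2

instance : LieAlgebra F (PairAlgebra γ γ') where
  lie_smul t a b := by
    ext1
    · simp only [up_lie, map_smul, lie_smul, smul_add]
    · simp only [low_lie, map_smul, lie_smul, smul_add]
    · simp only [ten_lie, map_smul, LinearMap.smul_apply, LinearMap.rTensor_smul,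
        LinearMap.lTensor_smul, smul_add, smul_sub]

/-- The summand `𝔱^up`: the upper triality algebra. -/
def upper (γ : Triality F V) (γ' : Triality F V') : Submodule F (PairAlgebra γ γ') :=
  LinearMap.ker low ⊓ LinearMap.ker ten

/-- The summand `𝔱^low`: the lower triality algebra. -/
def lower (γ : Triality F V) (γ' : Triality F V') : Submodule F (PairAlgebra γ γ') :=
  LinearMap.ker up ⊓ LinearMap.ker ten

/-- The summand `W_i = V_i ⊗ V'_{i+1}`. -/
def tensorSector (γ : Triality F V) (γ' : Triality F V') (i : Fin 3) :
    Submodule F (PairAlgebra γ γ') :=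
  LinearMap.ker up ⊓ LinearMap.ker low ⊓ (sector γ γ' i).comap ten

end PairAlgebra

end Triality

end Pair

end

set_option linter.unusedSectionVars false

noncomputable section

/-! ### Traces on a triality -/

section Traces

namespace Triality

variable {F : Type u} {V : Type v} [Field F] [AddCommGroup V] [Module F V] [FiniteDimensional F V]
  (γ : Triality F V)

/-! Everything is reduced to traces of products of Clifford multiplications and rank-one operators
on `V` and `V'`.

Killing form. For `x ⊗ x'`, `y ⊗ y'` in one sector, the trace of `ad (x ⊗ x') ad (y ⊗ y')` is
computed block by block. On `γ.algebra` the operator is `p ↦ -g'(x',y') R(x, p y)`; cyclicity of the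
trace turns its trace into that of `z ↦ R(x, z) y` on `V_i`, so that the dimension of the triality
algebra never enters. The outcome (`killingForm_tens`) is `-(8(n-1) + 8(n'-1) + 2nn') g(x,y)
g'(x',y')`, a non-zero multiple of the product metric. The automorphisms with signs on the sectors
(`gradeAut`) make the sectors orthogonal to each other and to the triality algebras. Invariance,
applied to `[x ⊗ x', y ⊗ x'] = g'(x',x') R(x,y)`, gives `B(p, R(x,y)) = λ g(px, y)` and the
orthogonality of the two triality algebras. Since the `R(x,y)` span the triality algebra
(`algebra_eq_rotSpan`), this settles non-degeneracy everywhere.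

Simplicity. Let `X = x ⊗ x'` be in `W_i` and `N = g(x,x) g'(x',x')`. On the triality algebras and on
`W_i` the operator `T = (ad X)²` satisfies `T² = -4NT`, while `T = -N` on the other two sectors by
the Clifford identity. Hence `T² + 4NT` is `-3N²` times the projection onto those two sectors
(`adQuartic_tens`), and an ideal contains the sector components of its elements. An ideal without
tensors is zero, because the triality algebras act faithfully and by skew operators on the sectors.
If an ideal meets `W_i` and, say, `n ≠ 2`, then the skew operators of `V_i`, together with the
identity, generate all its endomorphisms. So the ideal contains a pure tensor, and `T` moves its
second factor through all of `V'_{i+1}` (`tmul_mem_of_stable`). Products fill the other sectors, and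
brackets within a sector fill the triality algebras. For `n = n' = 2` the skew operators on both
sides are commutative, and the argument fails.

Dimension `(2, 2)`. Over `K` a triality of dimension two has isotropic coordinates `ξ, η` with
`g(x,x) = ξ(x) η(x)`, `ξ(xy) = η(x) η(y)` and `η(xy) = ξ(x) ξ(y)` (`exists_splitting`). The triality
algebra is diagonal in them. The coordinates `ξξ'` and `ηη'` of the three sectors are the
off-diagonal entries of a traceless `3 × 3` matrix, and the diagonal is determined by the weights
(`repMatrix_lie`). Exchanging `ξ'` and `η'` gives a second representation on the remaining
coordinates. Together they are surjective onto `sl₃ × sl₃`, and the bound `2 + 2 + 12` on the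
dimension makes them bijective. -/

lemma iSup_comp_induction {P : V → Prop} (h0 : P 0) (hadd : ∀ a b, P a → P b → P (a + b))
    (h : ∀ i, ∀ x ∈ γ.comp i, P x) (x : V) : P x := by
  have hx : x ∈ ⨆ s, γ.comp s := by rw [γ.comp_sup]; trivial
  induction hx using Submodule.iSup_induction' with
  | mem s x hx => exact h s x hx
  | zero => exact h0
  | add a b _ _ ha hb => exact hadd a b ha hb

lemma hom_ext_comp {M : Type*} [AddCommGroup M] [Module F M] {f f' : V →ₗ[F] M}
    (h : ∀ i, ∀ x ∈ γ.comp i, f x = f' x) : f = f' := by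
  ext x
  induction x using γ.iSup_comp_induction with
  | h0 => simp
  | hadd a b ha hb => rw [map_add, map_add, ha, hb]
  | h i x hx => exact h i x hx

lemma proj_self {i : Fin 3} {x : V} (hx : x ∈ γ.comp i) : γ.proj i x = x := by
  rw [γ.proj_of_mem hx, if_pos rfl]

lemma proj_ne {i j : Fin 3} (hij : i ≠ j) {x : V} (hx : x ∈ γ.comp i) : γ.proj j x = 0 := by
  rw [γ.proj_of_mem hx, if_neg hij]

lemma sum_proj (x : V) : ∑ i, γ.proj i x = x := by
  have : ∑ i, γ.proj i = LinearMap.id := γ.hom_ext_comp fun i x hx => by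
    simp [LinearMap.sum_apply, γ.proj_of_mem hx]
  simpa [LinearMap.sum_apply] using congrArg (· x) this

lemma g_proj_left (i : Fin 3) (x y : V) : γ.g (γ.proj i x) y = γ.g x (γ.proj i y) := by
  induction x using γ.iSup_comp_induction with
  | h0 => simp
  | hadd a b ha hb => simp only [map_add, LinearMap.add_apply, ha, hb]
  | h s x hx =>
  induction y using γ.iSup_comp_induction with
  | h0 => simp
  | hadd a b ha hb => simp only [map_add, ha, hb]
  | h t y hy =>
    rw [γ.proj_of_mem hx, γ.proj_of_mem hy]
    by_cases hst : s = t
    · subst hst; split_ifs <;> simp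
    · have := γ.comp_orth s t hst x hx y hy
      split_ifs <;> simp [this]

lemma mul_proj_of_mem {i : Fin 3} {x : V} (hx : x ∈ γ.comp i) (y : V) :
    γ.mul x (γ.proj i y) = 0 := γ.mul_self_comp hx (γ.proj_mem i y)

/-- The polarised Clifford identity as an identity of operators. -/
lemma mul_mul_add_mul_mul {i : Fin 3} {x y : V} (hx : x ∈ γ.comp i) (hy : y ∈ γ.comp i) (z : V) :
    γ.mul x (γ.mul y z) + γ.mul y (γ.mul x z) = (2 * γ.g x y) • (z - γ.proj i z) := by
  induction z using γ.iSup_comp_induction with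
  | h0 => simp
  | hadd a b ha hb =>
    simp only [map_add, smul_sub, smul_add] at *
    linear_combination (norm := module) ha + hb
  | h j z hz =>
    by_cases hij : i = j
    · subst hij
      simp [γ.mul_self_comp hx hz, γ.mul_self_comp hy hz, γ.proj_self hz]
    · rw [γ.clifford₂ hij hx hy hz, γ.proj_ne (Ne.symm hij) hz, sub_zero]

/-- The identification of `V` with its dual by `g` conjugates `A` into the transpose of `A'`. -/
lemma trace_eq_of_adjoint {A A' : Module.End F V} (h : ∀ x y, γ.g (A x) y = γ.g x (A' y)) :
    LinearMap.trace F V A = LinearMap.trace F V A' := by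
  rw [← LinearMap.trace_transpose' A', ← LinearMap.trace_conj' A (γ.g.toDual γ.g_nondeg)]
  congr 1
  ext f y
  obtain ⟨x, rfl⟩ := (γ.g.toDual γ.g_nondeg).surjective f
  simp [LinearEquiv.conj_apply, LinearMap.BilinForm.toDual_def, h, Module.Dual.transpose]

lemma trace_proj {n : ℕ} (hγ : γ.HasDim n) (i : Fin 3) : LinearMap.trace F V (γ.proj i) = n := by
  rw [← hγ i]
  exact LinearMap.IsProj.trace ⟨γ.proj_mem i, fun x hx => γ.proj_self hx⟩

lemma trace_smulRight_g (x y : V) : LinearMap.trace F V ((γ.g x).smulRight y) = γ.g x y := by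
  simp [LinearMap.trace_smulRight]

variable [CharZero F]

/-- Passing to the adjoint exchanges `x` and `y` without changing the trace, and by the Clifford
identity the two orders add up to `2 g(x,y)` times the projection. -/
lemma trace_mul_mul_proj {n : ℕ} (hγ : γ.HasDim n) {i j : Fin 3} (hij : i ≠ j) {x y : V}
    (hx : x ∈ γ.comp i) (hy : y ∈ γ.comp i) :
    LinearMap.trace F V (γ.mul x * γ.mul y * γ.proj j) = n * γ.g x y := by
  have e1 := γ.trace_eq_of_adjoint (A := γ.mul x * γ.mul y * γ.proj j)
    (A' := γ.proj j * (γ.mul y * γ.mul x)) fun a b => by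
      simp only [Module.End.mul_apply, γ.g_mul_mul, ← γ.g_proj_left]
  rw [LinearMap.trace_mul_comm F (γ.proj j)] at e1
  have e2 : γ.mul x * γ.mul y * γ.proj j + γ.mul y * γ.mul x * γ.proj j
      = (2 * γ.g x y) • γ.proj j := by
    ext z
    simp only [LinearMap.add_apply, Module.End.mul_apply, LinearMap.smul_apply]
    rw [γ.mul_mul_add_mul_mul hx hy, γ.proj_ne hij.symm (γ.proj_mem j z), sub_zero]
  have e3 := congrArg (LinearMap.trace F V) e2
  rw [map_add, ← e1, map_smul, γ.trace_proj hγ, smul_eq_mul] at e3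
  linear_combination e3 / 2

lemma trace_mul_mul {n : ℕ} (hγ : γ.HasDim n) {i : Fin 3} {x y : V}
    (hx : x ∈ γ.comp i) (hy : y ∈ γ.comp i) :
    LinearMap.trace F V (γ.mul x * γ.mul y) = 2 * n * γ.g x y := by
  have e : γ.mul x * γ.mul y = ∑ j, γ.mul x * γ.mul y * γ.proj j := by
    ext z
    simp only [LinearMap.sum_apply, Module.End.mul_apply]
    rw [← map_sum, ← map_sum, γ.sum_proj]
  have h0 : γ.mul x * γ.mul y * γ.proj i = 0 := by
    ext z
    simp [γ.mul_proj_of_mem hy]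
  rw [e, map_sum, ← Finset.add_sum_erase _ _ (Finset.mem_univ i), h0, map_zero, zero_add,
    Finset.sum_congr rfl fun j hj => γ.trace_mul_mul_proj hγ (Finset.ne_of_mem_erase hj).symm hx hy]
  rw [Finset.sum_const, Finset.card_erase_of_mem (Finset.mem_univ i)]
  simp
  ring

lemma mul_mul_self {i j : Fin 3} (hij : i ≠ j) {x y : V} (hx : x ∈ γ.comp i)
    (hy : y ∈ γ.comp j) : γ.mul x (γ.mul x y) = γ.g x x • y := by
  have := γ.clifford₂ hij hx hx hy
  linear_combination (norm := module) (1 / 2 : F) • this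

lemma g_mul_self {i j : Fin 3} (hij : i ≠ j) {x y : V} (hx : x ∈ γ.comp i)
    (hy : y ∈ γ.comp j) : γ.g (γ.mul x y) (γ.mul x y) = γ.g x x * γ.g y y := by
  rw [γ.g_mul_mul, γ.mul_mul_self hij hx hy, map_smul, smul_eq_mul]

lemma g_algebra_self {p : Module.End F V} (hp : p ∈ γ.algebra) (x : V) : γ.g (p x) x = 0 := by
  have := hp.2.1 x x
  rw [γ.g_symm x] at this
  linear_combination this / 2

/-- The trace form of `V` pairs an element of the triality algebra with an orthogonal generator
through the metric. -/
lemma trace_mul_rot {n : ℕ} (hγ : γ.HasDim n) {p : Module.End F V} (hp : p ∈ γ.algebra) {i : Fin 3}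
    {x y : V} (hx : x ∈ γ.comp i) (hy : y ∈ γ.comp i) :
    LinearMap.trace F V (p * γ.rot x y) = (8 + 2 * n) * γ.g x (p y) := by
  have e : p * γ.rot x y = (4 : F) • ((γ.g x).smulRight (p y) - (γ.g y).smulRight (p x))
      + (p * γ.mul y * γ.mul x - p * (γ.mul x * γ.mul y)) := by
    ext z
    simp [rot_apply]
  -- Commuting `p` past the multiplication by `y` leaves the multiplication by `p y`; the other term
  -- cancels, under the trace, against `p * (γ.mul x * γ.mul y)`. The rank-one part gives `8 g(x, p
  -- y)` and the Clifford part `2 n g(x, p y)`.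
  have e1 : γ.mul x * (p * γ.mul y) = γ.mul x * γ.mul (p y) + γ.mul x * γ.mul y * p := by
    ext z
    simp [γ.algebra_mul hp]
  have e2 := γ.trace_mul_mul hγ hx (hp.1 i y hy)
  have e3 : γ.g y (p x) = - γ.g x (p y) := by
    rw [γ.g_symm y]
    exact eq_neg_of_add_eq_zero_left (hp.2.1 x y)
  rw [e, map_add, map_smul, map_sub, map_sub, γ.trace_smulRight_g, γ.trace_smulRight_g,
    LinearMap.trace_mul_comm F (p * γ.mul y), e1, map_add, e2,
    LinearMap.trace_mul_comm F p, e3, smul_eq_mul]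
  ring

/-- The span of the orthogonal generators. -/
def rotSpan : Submodule F (Module.End F V) :=
  Submodule.span F {r | ∃ i, ∃ x ∈ γ.comp i, ∃ y ∈ γ.comp i, γ.rot x y = r}

lemma rotSpan_le : γ.rotSpan ≤ γ.algebra.toSubmodule := by
  refine Submodule.span_le.2 ?_
  rintro _ ⟨i, x, hx, y, hy, rfl⟩
  exact γ.rot_mem hx hy

/-- The triality algebra is spanned by the orthogonal generators. -/
lemma algebra_eq_rotSpan {n : ℕ} (hγ : γ.HasDim n) : γ.algebra.toSubmodule = γ.rotSpan := by
  refine (Submodule.eq_of_le_of_finrank_le γ.rotSpan_le ?_).symm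
  -- The trace form maps the triality algebra injectively to the dual of the span, by
  -- `trace_mul_rot`; a comparison of dimensions then forces equality.
  let f : γ.algebra.toSubmodule →ₗ[F] Module.Dual F γ.rotSpan :=
    (LinearMap.mul F (Module.End F V)).compr₂ (LinearMap.trace F V) |>.compl₁₂
      γ.algebra.toSubmodule.subtype γ.rotSpan.subtype
  have hf : Function.Injective f := by
    refine (injective_iff_map_eq_zero f).2 ?_
    rintro ⟨p, hp⟩ h
    refine Subtype.ext (γ.hom_ext_comp fun i y hy => γ.g_ext_comp fun j x hx => ?_)
    change γ.g (p y) x = γ.g 0 x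
    rw [map_zero, LinearMap.zero_apply]
    by_cases hij : i = j
    · subst hij
      have h1 := congrArg (· ⟨γ.rot x y, Submodule.subset_span ⟨i, x, hx, y, hy, rfl⟩⟩) h
      have h2 : LinearMap.trace F V (p * γ.rot x y) = 0 := h1
      rw [γ.trace_mul_rot hγ hp hx hy, γ.g_symm] at h2
      refine (mul_eq_zero.1 h2).resolve_left ?_
      exact_mod_cast (by omega : 8 + 2 * n ≠ 0)
    · exact γ.comp_orth i j hij _ (hp.1 i y hy) x hx
  have := LinearMap.finrank_le_finrank_of_injective hf
  rwa [Subspace.dual_finrank_eq] at this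

/-- The form in which the spanning property is used: a linear assertion about the triality algebra
has to be checked only on orthogonal generators. -/
lemma algebra_submodule_eq_top {n : ℕ} (hγ : γ.HasDim n) {U : Submodule F γ.algebra}
    (h : ∀ i, ∀ x (hx : x ∈ γ.comp i), ∀ y (hy : y ∈ γ.comp i),
      (⟨γ.rot x y, γ.rot_mem hx hy⟩ : γ.algebra) ∈ U) : U = ⊤ := by
  refine (Submodule.eq_top_iff').2 fun p => ?_
  have hp : (p : Module.End F V) ∈ γ.rotSpan := γ.algebra_eq_rotSpan hγ ▸ p.2
  have hle : γ.rotSpan ≤ U.map γ.algebra.toSubmodule.subtype := by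
    refine Submodule.span_le.2 ?_
    rintro _ ⟨i, x, hx, y, hy, rfl⟩
    exact ⟨_, h i x hx y hy, rfl⟩
  obtain ⟨q, hq, hqp⟩ := hle hp
  exact (Subtype.ext hqp : q = p) ▸ hq

/-- `z ↦ R(y, z) x` has trace `4 (n - 1) g(x, y)`. -/
lemma trace_rot_flip {n : ℕ} (hγ : γ.HasDim n) {i : Fin 3} {x y : V} (hx : x ∈ γ.comp i)
    (hy : y ∈ γ.comp i) :
    LinearMap.trace F V ((γ.rot y).flip x * γ.proj i) = 4 * (n - 1) * γ.g x y := by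
  have e : (γ.rot y).flip x * γ.proj i
      = (4 : F) • (γ.g x y • γ.proj i - (γ.g x).smulRight y) := by
    ext z
    have hz := γ.proj_mem i z
    simp only [Module.End.mul_apply, LinearMap.flip_apply, rot_apply, LinearMap.smul_apply,
      LinearMap.sub_apply, LinearMap.smulRight_apply]
    rw [γ.mul_self_comp hy hx, γ.mul_self_comp hz hx, map_zero, map_zero, sub_zero, add_zero,
      γ.g_proj_left, γ.proj_self hx, γ.g_symm y x, γ.g_symm z x]
  rw [e, map_smul, map_sub, map_smul, γ.trace_proj hγ, γ.trace_smulRight_g, smul_eq_mul,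
    smul_eq_mul]
  ring

/-- Each component of positive dimension contains a non-isotropic vector. -/
lemma exists_g_self_ne_zero {n : ℕ} (hγ : γ.HasDim n) (hn : n ≠ 0) (i : Fin 3) :
    ∃ x ∈ γ.comp i, γ.g x x ≠ 0 := by
  by_contra! h
  have h2 : ∀ x ∈ γ.comp i, ∀ y ∈ γ.comp i, γ.g x y = 0 := fun x hx y hy => by
    have := h _ (add_mem hx hy)
    simp only [map_add, LinearMap.add_apply, h x hx, h y hy, γ.g_symm y x] at this
    linear_combination this / 2
  have h3 : γ.comp i = ⊥ := by
    refine (Submodule.eq_bot_iff _).2 fun x hx => γ.g_ext_comp fun j z hz => ?_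
    rw [map_zero, LinearMap.zero_apply]
    by_cases hij : i = j
    · subst hij; exact h2 x hx z hz
    · exact γ.comp_orth i j hij x hx z hz
  have h4 := hγ i
  rw [h3, finrank_bot] at h4
  exact hn h4.symm

end Triality

end Traces

/-! ### The Killing form on a tensor sector -/

section KillingSector

namespace Triality

variable {F : Type u} {V : Type v} {V' : Type w} [Field F]
  [AddCommGroup V] [Module F V] [FiniteDimensional F V]
  [AddCommGroup V'] [Module F V'] [FiniteDimensional F V']

/-- Two multiplications by elements of `V_i` lead from `V_j` to the third subspace and back, once
along the cyclic order and once against it, so exactly one sign is negative. -/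
lemma cross_cross_of_mem (γ : Triality F V) {i : Fin 3} {x y : V} (hx : x ∈ γ.comp i)
    (hy : y ∈ γ.comp i) (z : V) : γ.cross x (γ.cross y z) = - γ.mul x (γ.mul y z) := by
  induction z using γ.iSup_comp_induction with
  | h0 => simp
  | hadd a b ha hb => simp only [map_add, ha, hb]; abel
  | h j z hz =>
    by_cases hij : i = j
    · subst hij
      rw [γ.cross_of_mem hy hz, γ.mul_self_comp hy hz]
      simp
    · obtain ⟨k, hjk, hik⟩ : ∃ k : Fin 3, j ≠ k ∧ i ≠ k := by
        clear hx hz hy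
        revert i j
        decide
      have hyz := γ.mul_mem hjk hik hy hz
      rw [γ.cross_of_mem hy hz]
      by_cases h1 : j = i + 1
      · rw [if_pos h1, γ.cross_of_mem hx hyz, if_neg (by omega), if_pos (by omega)]
      · rw [if_neg h1, if_pos (by omega), map_neg, γ.cross_of_mem hx hyz, if_pos (by omega)]

/-- The projection of `V ⊗ V'` onto the sector `V_i ⊗ V'_{i+1}`. -/
def secProj (γ : Triality F V) (γ' : Triality F V') (i : Fin 3) :
    V ⊗[F] V' →ₗ[F] V ⊗[F] V' :=
  TensorProduct.map (γ.proj i) (γ'.proj (i + 1))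

@[simp] lemma secProj_tmul (γ : Triality F V) (γ' : Triality F V') (i : Fin 3) (x : V) (x' : V') :
    secProj γ γ' i (x ⊗ₜ x') = γ.proj i x ⊗ₜ γ'.proj (i + 1) x' := rfl

lemma secProj_mem (γ : Triality F V) (γ' : Triality F V') (i : Fin 3) (t : V ⊗[F] V') :
    secProj γ γ' i t ∈ sector γ γ' i := by
  induction t using TensorProduct.induction_on with
  | zero => simp
  | add a b ha hb => rw [map_add]; exact add_mem ha hb
  | tmul x x' => exact tmul_mem_sector γ γ' (γ.proj_mem i x) (γ'.proj_mem (i + 1) x')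

lemma secProj_of_mem (γ : Triality F V) (γ' : Triality F V') {i : Fin 3} {t : V ⊗[F] V'}
    (ht : t ∈ sector γ γ' i) (j : Fin 3) : secProj γ γ' j t = if i = j then t else 0 := by
  obtain ⟨t, rfl⟩ := ht
  induction t using TensorProduct.induction_on with
  | zero => simp
  | add a b ha hb => rw [map_add, map_add, ha, hb]; split_ifs <;> simp
  | tmul x x' =>
    simp only [TensorProduct.mapIncl, TensorProduct.map_tmul, Submodule.subtype_apply,
      secProj_tmul, γ.proj_of_mem x.2, γ'.proj_of_mem x'.2]
    by_cases h : i = j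
    · simp [h]
    · simp [h]

lemma sum_secProj (γ : Triality F V) (γ' : Triality F V') {t : V ⊗[F] V'}
    (ht : t ∈ tensorSpace γ γ') : ∑ i, secProj γ γ' i t = t := by
  induction ht using Submodule.iSup_induction' with
  | mem i t ht => simp [secProj_of_mem γ γ' ht]
  | zero => simp
  | add a b _ _ ha hb => simp only [map_add, Finset.sum_add_distrib, ha, hb]

/-- `z ↦ R(x, z)` on the component of `x`, with values in the triality algebra. -/
def rotAlg (γ : Triality F V) {i : Fin 3} {x : V} (hx : x ∈ γ.comp i) : V →ₗ[F] γ.algebra :=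
  LinearMap.codRestrict γ.algebra.toSubmodule (γ.rot x ∘ₗ γ.proj i) fun v =>
    show γ.rot x (γ.proj i v) ∈ γ.algebra from γ.rot_mem hx (γ.proj_mem i v)

lemma coe_rotAlg (γ : Triality F V) {i : Fin 3} {x : V} (hx : x ∈ γ.comp i) (z : V) :
    (γ.rotAlg hx z : Module.End F V) = γ.rot x (γ.proj i z) := rfl

/-- Evaluation of the triality algebra at a vector. -/
def evalAlg (γ : Triality F V) (y : V) : γ.algebra →ₗ[F] V :=
  LinearMap.applyₗ y ∘ₗ γ.algebra.toSubmodule.subtype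

lemma evalAlg_apply (γ : Triality F V) (y : V) (p : γ.algebra) :
    γ.evalAlg y p = (p : Module.End F V) y := rfl

/-- Cyclicity moves the trace from the triality algebra to `V`, where the operator `v ↦ R(x, v) y`
on `V_i` is explicit. -/
lemma trace_rotAlg_evalAlg [CharZero F] (γ : Triality F V) {n : ℕ} (hγ : γ.HasDim n) {i : Fin 3}
    {x y : V} (hx : x ∈ γ.comp i) (hy : y ∈ γ.comp i) :
    LinearMap.trace F _ (γ.rotAlg hx ∘ₗ γ.evalAlg y) = 4 * (n - 1) * γ.g x y := by
  have e : γ.evalAlg y ∘ₗ γ.rotAlg hx = (γ.rot x).flip y * γ.proj i := by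
    ext v
    simp [evalAlg_apply, coe_rotAlg]
  rw [LinearMap.trace_comp_comm', e, γ.trace_rot_flip hγ hy hx, γ.g_symm y x]

namespace PairAlgebra

variable {γ : Triality F V} {γ' : Triality F V'}

instance : FiniteDimensional F (PairAlgebra γ γ') :=
  inferInstanceAs (FiniteDimensional F (γ.algebra × γ'.algebra × tensorSpace γ γ'))

/-! ### Inclusions and projections of the summands, and traces by blocks. -/

/-- The inclusion of the upper triality algebra. -/
def inUp (γ : Triality F V) (γ' : Triality F V') : γ.algebra →ₗ[F] PairAlgebra γ γ' :=
  LinearMap.inl F γ.algebra (γ'.algebra × tensorSpace γ γ')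

/-- The inclusion of the lower triality algebra. -/
def inLow (γ : Triality F V) (γ' : Triality F V') : γ'.algebra →ₗ[F] PairAlgebra γ γ' :=
  LinearMap.inr F γ.algebra (γ'.algebra × tensorSpace γ γ') ∘ₗ
    LinearMap.inl F γ'.algebra (tensorSpace γ γ')

/-- The map `V ⊗ V' → W₁ ⊕ W₂ ⊕ W₃` which is the identity on `W_i` and vanishes on the other
`V_i ⊗ V'_j`. -/
def tens (γ : Triality F V) (γ' : Triality F V') : V ⊗[F] V' →ₗ[F] PairAlgebra γ γ' :=
  LinearMap.inr F γ.algebra (γ'.algebra × tensorSpace γ γ') ∘ₗ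
    LinearMap.inr F γ'.algebra (tensorSpace γ γ') ∘ₗ
    LinearMap.codRestrict (tensorSpace γ γ') (∑ i, secProj γ γ' i) (fun t => by
      rw [LinearMap.sum_apply]
      exact sum_mem fun i _ => sector_le γ γ' i (secProj_mem γ γ' i t))

/-- The upper part, as an element of the triality algebra. -/
def upPart : PairAlgebra γ γ' →ₗ[F] γ.algebra :=
  LinearMap.fst F γ.algebra (γ'.algebra × tensorSpace γ γ')

/-- The lower part, as an element of the triality algebra. -/
def lowPart : PairAlgebra γ γ' →ₗ[F] γ'.algebra :=
  LinearMap.fst F γ'.algebra (tensorSpace γ γ') ∘ₗ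
    LinearMap.snd F γ.algebra (γ'.algebra × tensorSpace γ γ')

lemma coe_upPart (a : PairAlgebra γ γ') : (upPart a : Module.End F V) = up a := rfl
lemma coe_lowPart (a : PairAlgebra γ γ') : (lowPart a : Module.End F V') = low a := rfl

@[simp] lemma up_inUp (p : γ.algebra) : up (inUp γ γ' p) = p := rfl
@[simp] lemma low_inUp (p : γ.algebra) : low (inUp γ γ' p) = 0 := rfl
@[simp] lemma ten_inUp (p : γ.algebra) : ten (inUp γ γ' p) = 0 := rfl
@[simp] lemma up_inLow (q : γ'.algebra) : up (inLow γ γ' q) = 0 := rfl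
@[simp] lemma low_inLow (q : γ'.algebra) : low (inLow γ γ' q) = q := rfl
@[simp] lemma ten_inLow (q : γ'.algebra) : ten (inLow γ γ' q) = 0 := rfl
@[simp] lemma up_tens (t : V ⊗[F] V') : up (tens γ γ' t) = 0 := rfl
@[simp] lemma low_tens (t : V ⊗[F] V') : low (tens γ γ' t) = 0 := rfl

lemma ten_tens (t : V ⊗[F] V') : ten (tens γ γ' t) = ∑ i, secProj γ γ' i t := by
  rw [← LinearMap.sum_apply]; rfl

lemma ten_tens_of_mem {i : Fin 3} {t : V ⊗[F] V'} (ht : t ∈ sector γ γ' i) :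
    ten (tens γ γ' t) = t := by
  rw [ten_tens, sum_secProj γ γ' (sector_le γ γ' i ht)]

lemma ten_tens_tmul {i : Fin 3} {x : V} {x' : V'} (hx : x ∈ γ.comp i)
    (hx' : x' ∈ γ'.comp (i + 1)) : ten (tens γ γ' (x ⊗ₜ x')) = x ⊗ₜ x' :=
  ten_tens_of_mem (tmul_mem_sector γ γ' hx hx')

lemma eq_add (a : PairAlgebra γ γ') :
    a = inUp γ γ' (upPart a) + inLow γ γ' (lowPart a) + tens γ γ' (ten a) := by
  ext1
  · simp [coe_upPart]
  · simp [coe_lowPart]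
  · simp [ten_tens, sum_secProj γ γ' (ten_mem a)]

/-- The identity is the sum of the three projections followed by inclusions; cyclicity brings each
projection to the front. The last trace is over all of `V ⊗ V'`, which is harmless as `tens`
vanishes off the sectors, and allows traces of tensor products of operators to be factored. -/
lemma trace_eq (f : Module.End F (PairAlgebra γ γ')) :
    LinearMap.trace F _ f = LinearMap.trace F _ (upPart ∘ₗ f ∘ₗ inUp γ γ')
      + LinearMap.trace F _ (lowPart ∘ₗ f ∘ₗ inLow γ γ')
      + LinearMap.trace F _ (ten ∘ₗ f ∘ₗ tens γ γ') := by
  have e : f = (f ∘ₗ inUp γ γ') ∘ₗ upPart + (f ∘ₗ inLow γ γ') ∘ₗ lowPart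
      + (f ∘ₗ tens γ γ') ∘ₗ ten := by
    refine LinearMap.ext fun a => ?_
    conv_lhs => rw [eq_add a]
    simp only [map_add, LinearMap.add_apply, LinearMap.comp_apply]
  conv_lhs => rw [e]
  rw [map_add, map_add, LinearMap.trace_comp_comm' upPart, LinearMap.trace_comp_comm' lowPart,
    LinearMap.trace_comp_comm' ten]

/-- The inner bracket takes `p` to `-(p y ⊗ y')`, and the outer one returns `-g'(x',y') R(x, p y)`
as upper part. -/
lemma trace_upper_block [CharZero F] {n : ℕ} (hγ : γ.HasDim n) {i : Fin 3} {x y : V} {x' y' : V'}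
    (hx : x ∈ γ.comp i) (hy : y ∈ γ.comp i) (hx' : x' ∈ γ'.comp (i + 1))
    (hy' : y' ∈ γ'.comp (i + 1)) :
    LinearMap.trace F _ (upPart ∘ₗ (LieAlgebra.ad F _ (tens γ γ' (x ⊗ₜ x')) ∘ₗ
      LieAlgebra.ad F _ (tens γ γ' (y ⊗ₜ y'))) ∘ₗ inUp γ γ')
      = - (4 * (n - 1) * γ.g x y * γ'.g x' y') := by
  have e : upPart ∘ₗ (LieAlgebra.ad F _ (tens γ γ' (x ⊗ₜ x')) ∘ₗ
      LieAlgebra.ad F _ (tens γ γ' (y ⊗ₜ y'))) ∘ₗ inUp γ γ'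
      = - γ'.g x' y' • (γ.rotAlg hx ∘ₗ γ.evalAlg y) := by
    refine LinearMap.ext fun p => Subtype.ext ?_
    have hpy : (p : Module.End F V) y ∈ γ.comp i := p.2.1 i y hy
    simp [coe_upPart, up_lie, ten_lie, ten_tens_tmul hx hx', ten_tens_tmul hy hy',
      coe_rotAlg, evalAlg_apply, γ.proj_self hpy]
  rw [e, map_smul, γ.trace_rotAlg_evalAlg hγ hx hy, smul_eq_mul]
  ring

lemma trace_lower_block [CharZero F] {n' : ℕ} (hγ' : γ'.HasDim n') {i : Fin 3} {x y : V}
    {x' y' : V'} (hx : x ∈ γ.comp i) (hy : y ∈ γ.comp i) (hx' : x' ∈ γ'.comp (i + 1))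
    (hy' : y' ∈ γ'.comp (i + 1)) :
    LinearMap.trace F _ (lowPart ∘ₗ (LieAlgebra.ad F _ (tens γ γ' (x ⊗ₜ x')) ∘ₗ
      LieAlgebra.ad F _ (tens γ γ' (y ⊗ₜ y'))) ∘ₗ inLow γ γ')
      = - (4 * (n' - 1) * γ.g x y * γ'.g x' y') := by
  have e : lowPart ∘ₗ (LieAlgebra.ad F _ (tens γ γ' (x ⊗ₜ x')) ∘ₗ
      LieAlgebra.ad F _ (tens γ γ' (y ⊗ₜ y'))) ∘ₗ inLow γ γ'
      = - γ.g x y • (γ'.rotAlg hx' ∘ₗ γ'.evalAlg y') := by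
    refine LinearMap.ext fun p => Subtype.ext ?_
    have hpy : (p : Module.End F V') y' ∈ γ'.comp (i + 1) := p.2.1 (i + 1) y' hy'
    simp [coe_lowPart, low_lie, ten_lie, ten_tens_tmul hx hx', ten_tens_tmul hy hy',
      coe_rotAlg, evalAlg_apply, γ'.proj_self hpy]
  rw [e, map_smul, γ'.trace_rotAlg_evalAlg hγ' hx' hy', smul_eq_mul]
  ring

/-- The double bracket with elements of one tensor sector, on tensors. -/
lemma ten_lie_lie_tens {i : Fin 3} {x y : V} {x' y' : V'}
    (hx : x ∈ γ.comp i) (hy : y ∈ γ.comp i) (hx' : x' ∈ γ'.comp (i + 1))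
    (hy' : y' ∈ γ'.comp (i + 1)) (t : V ⊗[F] V') :
    ten ⁅tens γ γ' (x ⊗ₜ x'), ⁅tens γ γ' (y ⊗ₜ y'), tens γ γ' t⁆⁆
      = - (TensorProduct.map ((γ.rot y).flip x * γ.proj i) ((γ'.g y').smulRight x') t
        + TensorProduct.map ((γ.g y).smulRight x) ((γ'.rot y').flip x' * γ'.proj (i + 1)) t
        + ∑ j, TensorProduct.map (γ.mul x * γ.mul y * γ.proj j)
          (γ'.mul x' * γ'.mul y' * γ'.proj (j + 1)) t) := by
  induction t using TensorProduct.induction_on with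
  | zero => simp
  | add a b ha hb =>
    simp only [map_add, lie_add, Finset.sum_add_distrib] at *
    rw [ha, hb]
    abel
  | tmul z z' =>
    -- Only the sector of `y ⊗ y'` pairs non-trivially with `y` and `y'`, so the sum over the
    -- sectors in `ten_tens` collapses to its `i`-th term in both orthogonal parts.
    have h1 : ∀ j, γ'.g y' (γ'.proj (j + 1) z') • γ.rot y (γ.proj j z)
        = if i = j then γ'.g y' z' • γ.rot y (γ.proj i z) else 0 := fun j => by
      rw [← γ'.g_proj_left, γ'.proj_of_mem hy']
      by_cases h : i = j
      · simp [h]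
      · simp [h]
    have h2 : ∀ j, γ.g y (γ.proj j z) • γ'.rot y' (γ'.proj (j + 1) z')
        = if i = j then γ.g y z • γ'.rot y' (γ'.proj (i + 1) z') else 0 := fun j => by
      rw [← γ.g_proj_left, γ.proj_of_mem hy]
      by_cases h : i = j
      · simp [h]
      · simp [h]
    simp only [ten_lie, up_lie, low_lie, up_tens, low_tens, LinearMap.rTensor_zero,
      LinearMap.lTensor_zero, LinearMap.zero_apply, zero_add, sub_zero, lie_zero,
      ten_tens_tmul hx hx', ten_tens_tmul hy hy']
    rw [ten_tens]
    simp only [map_sum, secProj_tmul, brUp_tmul, brLow_tmul, brTen_tmul, h1, h2,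
      Finset.sum_ite_eq, Finset.mem_univ, if_true, LinearMap.rTensor_tmul, LinearMap.lTensor_tmul,
      LinearMap.smul_apply, γ.cross_cross_of_mem hx hy, TensorProduct.map_tmul,
      Module.End.mul_apply, LinearMap.flip_apply, LinearMap.smulRight_apply,
      TensorProduct.neg_tmul, Finset.sum_neg_distrib, TensorProduct.tmul_smul,
      TensorProduct.smul_tmul']
    abel

/-- In units of `g(x,y) g'(x',y')`, the triality algebras contribute `-4(n-1)` and `-4(n'-1)`; the
sector itself contributes both of these once more, through the orthogonal parts of the inner
bracket; each of the two other sectors contributes `-nn'`. -/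
lemma killingForm_tens [CharZero F] {n n' : ℕ} (hγ : γ.HasDim n) (hγ' : γ'.HasDim n')
    {i : Fin 3} {x y : V} {x' y' : V'}
    (hx : x ∈ γ.comp i) (hy : y ∈ γ.comp i) (hx' : x' ∈ γ'.comp (i + 1))
    (hy' : y' ∈ γ'.comp (i + 1)) :
    killingForm F (PairAlgebra γ γ') (tens γ γ' (x ⊗ₜ x')) (tens γ γ' (y ⊗ₜ y'))
      = - (8 * (n - 1) + 8 * (n' - 1) + 2 * n * n') * (γ.g x y * γ'.g x' y') := by
  have e : ten ∘ₗ (LieAlgebra.ad F _ (tens γ γ' (x ⊗ₜ x')) ∘ₗ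
      LieAlgebra.ad F _ (tens γ γ' (y ⊗ₜ y'))) ∘ₗ tens γ γ'
      = - (TensorProduct.map ((γ.rot y).flip x * γ.proj i) ((γ'.g y').smulRight x')
        + TensorProduct.map ((γ.g y).smulRight x) ((γ'.rot y').flip x' * γ'.proj (i + 1))
        + ∑ j, TensorProduct.map (γ.mul x * γ.mul y * γ.proj j)
          (γ'.mul x' * γ'.mul y' * γ'.proj (j + 1))) := by
    refine LinearMap.ext fun t => ?_
    rw [LinearMap.neg_apply, LinearMap.add_apply, LinearMap.add_apply, LinearMap.sum_apply,
      ← ten_lie_lie_tens hx hy hx' hy']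
    rfl
  have h0 : γ.mul x * γ.mul y * γ.proj i = 0 := by
    ext z
    simp [γ.mul_proj_of_mem hy]
  have e3 : ∑ j, LinearMap.trace F _ (TensorProduct.map (γ.mul x * γ.mul y * γ.proj j)
          (γ'.mul x' * γ'.mul y' * γ'.proj (j + 1))) = 2 * (n * γ.g x y * (n' * γ'.g x' y')) := by
    have : ∀ j ∈ Finset.univ.erase i, LinearMap.trace F _
        (TensorProduct.map (γ.mul x * γ.mul y * γ.proj j)
          (γ'.mul x' * γ'.mul y' * γ'.proj (j + 1))) = n * γ.g x y * (n' * γ'.g x' y') := by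
      intro j hj
      have hij := (Finset.ne_of_mem_erase hj).symm
      rw [LinearMap.trace_tensorProduct', γ.trace_mul_mul_proj hγ hij hx hy,
        γ'.trace_mul_mul_proj hγ' (by simpa using hij) hx' hy']
    rw [← Finset.add_sum_erase _ _ (Finset.mem_univ i), h0, TensorProduct.map_zero_left, map_zero,
      zero_add, Finset.sum_congr rfl this, Finset.sum_const,
      Finset.card_erase_of_mem (Finset.mem_univ i)]
    simp
  rw [killingForm_apply_apply, trace_eq, trace_upper_block hγ hx hy hx' hy',
    trace_lower_block hγ' hx hy hx' hy', e, map_neg, map_add, map_add, map_sum, e3,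
    LinearMap.trace_tensorProduct', LinearMap.trace_tensorProduct', γ.trace_rot_flip hγ hx hy,
    γ'.trace_rot_flip hγ' hx' hy', γ.trace_smulRight_g, γ'.trace_smulRight_g, γ.g_symm y x,
    γ'.g_symm y' x']
  ring

end PairAlgebra

end Triality

end KillingSector

/-! ### The Killing form -/

section KillingForm

namespace Triality

variable {F : Type u} {V : Type v} {V' : Type w} [Field F]
  [AddCommGroup V] [Module F V] [FiniteDimensional F V]
  [AddCommGroup V'] [Module F V'] [FiniteDimensional F V']

/-! ### Sign automorphisms and the grading by the sectors. -/

/-- The reflection of `V` which is the identity on `V_i` and `-1` on the other two subspaces. -/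
def reflect (γ : Triality F V) (i : Fin 3) : Module.End F V := (2 : F) • γ.proj i - 1

lemma reflect_of_mem (γ : Triality F V) (i : Fin 3) {j : Fin 3} {x : V} (hx : x ∈ γ.comp j) :
    γ.reflect i x = if j = i then x else -x := by
  simp only [reflect, LinearMap.sub_apply, LinearMap.smul_apply, γ.proj_of_mem hx,
    Module.End.one_apply]
  split_ifs
  · module
  · simp

lemma reflect_mem (γ : Triality F V) (i : Fin 3) {j : Fin 3} {x : V} (hx : x ∈ γ.comp j) :
    γ.reflect i x ∈ γ.comp j := by
  rw [γ.reflect_of_mem i hx]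
  split_ifs
  · exact hx
  · exact neg_mem hx

lemma reflect_reflect (γ : Triality F V) (i : Fin 3) (x : V) :
    γ.reflect i (γ.reflect i x) = x := by
  induction x using γ.iSup_comp_induction with
  | h0 => simp
  | hadd a b ha hb => rw [map_add, map_add, ha, hb]
  | h j x hx =>
    rw [γ.reflect_of_mem i (γ.reflect_mem i hx), γ.reflect_of_mem i hx]
    split_ifs <;> simp

/-- For factors in different subspaces the product lies in the third one, and the signs of the
reflection on the three subspaces, `+`, `-`, `-`, multiply to `1`. -/
lemma reflect_cross (γ : Triality F V) (i : Fin 3) (x y : V) :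
    γ.reflect i (γ.cross x y) = γ.cross (γ.reflect i x) (γ.reflect i y) := by
  induction x using γ.iSup_comp_induction with
  | h0 => simp
  | hadd a b ha hb => simp only [map_add, LinearMap.add_apply, ha, hb]
  | h j x hx =>
  induction y using γ.iSup_comp_induction with
  | h0 => simp
  | hadd a b ha hb => simp only [map_add, ha, hb]
  | h k y hy =>
    by_cases hjk : j = k
    · subst hjk
      rw [γ.cross_of_mem hx hy, γ.cross_of_mem (γ.reflect_mem i hx) (γ.reflect_mem i hy)]
      simp
    · obtain ⟨l, hkl, hjl⟩ : ∃ l : Fin 3, k ≠ l ∧ j ≠ l := by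
        clear hx hy
        revert j k
        decide
      have h : γ.cross x y ∈ γ.comp l := by
        rw [γ.cross_of_mem hx hy]
        split_ifs
        · exact γ.mul_mem hkl hjl hx hy
        · exact neg_mem (γ.mul_mem hkl hjl hx hy)
        · exact zero_mem _
      rw [γ.reflect_of_mem i h, γ.reflect_of_mem i hx, γ.reflect_of_mem i hy]
      by_cases h1 : i = j
      · subst h1
        rw [if_neg (Ne.symm hjl), if_pos rfl, if_neg (Ne.symm hjk), map_neg]
      · by_cases h2 : i = k
        · subst h2
          rw [if_neg (Ne.symm hkl), if_pos rfl, if_neg hjk, map_neg, LinearMap.neg_apply]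
        · rw [if_pos (by omega), if_neg (Ne.symm h1), if_neg (Ne.symm h2), map_neg, map_neg,
            LinearMap.neg_apply, neg_neg]

lemma algebra_reflect (γ : Triality F V) {p : Module.End F V} (hp : p ∈ γ.algebra) (i : Fin 3)
    (x : V) : p (γ.reflect i x) = γ.reflect i (p x) := by
  simp [reflect, γ.algebra_proj hp]

lemma rTensor_reflect_mem (γ : Triality F V) (γ' : Triality F V') (i : Fin 3) {t : V ⊗[F] V'}
    (ht : t ∈ tensorSpace γ γ') : (γ.reflect i).rTensor V' t ∈ tensorSpace γ γ' := by
  induction ht using tensorSpace_induction with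
  | h0 => simp
  | hadd a b _ _ ha hb => rw [map_add]; exact add_mem ha hb
  | h j x hx x' hx' =>
    exact sector_le γ γ' j (tmul_mem_sector γ γ' (γ.reflect_mem i hx) hx')

lemma brUp_reflect (γ : Triality F V) (γ' : Triality F V') (i : Fin 3) {a b : V ⊗[F] V'}
    (ha : a ∈ tensorSpace γ γ') (hb : b ∈ tensorSpace γ γ') :
    brUp γ γ' ((γ.reflect i).rTensor V' a) ((γ.reflect i).rTensor V' b) = brUp γ γ' a b := by
  induction ha using tensorSpace_induction with
  | h0 => simp
  | hadd a a' _ _ h h' => simp only [map_add, LinearMap.add_apply, h, h']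
  | h j x hx x' hx' =>
  induction hb using tensorSpace_induction with
  | h0 => simp
  | hadd a a' _ _ h h' => simp only [map_add, h, h']
  | h k y hy y' hy' =>
    simp only [LinearMap.rTensor_tmul, brUp_tmul, γ.reflect_of_mem i hx, γ.reflect_of_mem i hy]
    by_cases hjk : j = k
    · subst hjk
      split_ifs <;> simp
    · rw [γ'.comp_orth (j + 1) (k + 1) (by simpa using hjk) x' hx' y' hy', zero_smul, zero_smul]

lemma brLow_reflect (γ : Triality F V) (γ' : Triality F V') (i : Fin 3) {a b : V ⊗[F] V'}
    (ha : a ∈ tensorSpace γ γ') (hb : b ∈ tensorSpace γ γ') :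
    brLow γ γ' ((γ.reflect i).rTensor V' a) ((γ.reflect i).rTensor V' b) = brLow γ γ' a b := by
  induction ha using tensorSpace_induction with
  | h0 => simp
  | hadd a a' _ _ h h' => simp only [map_add, LinearMap.add_apply, h, h']
  | h j x hx x' hx' =>
  induction hb using tensorSpace_induction with
  | h0 => simp
  | hadd a a' _ _ h h' => simp only [map_add, h, h']
  | h k y hy y' hy' =>
    simp only [LinearMap.rTensor_tmul, brLow_tmul, γ.reflect_of_mem i hx, γ.reflect_of_mem i hy]
    by_cases hjk : j = k
    · subst hjk
      split_ifs <;> simp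
    · have := γ.comp_orth j k hjk x hx y hy
      split_ifs <;> simp [this]

lemma brTen_reflect (γ : Triality F V) (γ' : Triality F V') (i : Fin 3) (a b : V ⊗[F] V') :
    brTen γ γ' ((γ.reflect i).rTensor V' a) ((γ.reflect i).rTensor V' b)
      = (γ.reflect i).rTensor V' (brTen γ γ' a b) := by
  induction a using TensorProduct.induction_on with
  | zero => simp
  | add a a' h h' => simp only [map_add, LinearMap.add_apply, h, h']
  | tmul x x' =>
  induction b using TensorProduct.induction_on with
  | zero => simp
  | add a a' h h' => simp only [map_add, h, h']
  | tmul y y' => simp only [LinearMap.rTensor_tmul, brTen_tmul, γ.reflect_cross]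

lemma rTensor_algebra_reflect (γ : Triality F V) {p : Module.End F V} (hp : p ∈ γ.algebra)
    (i : Fin 3) (t : V ⊗[F] V') :
    p.rTensor V' ((γ.reflect i).rTensor V' t) = (γ.reflect i).rTensor V' (p.rTensor V' t) := by
  induction t using TensorProduct.induction_on with
  | zero => simp
  | add a a' h h' => simp only [map_add, h, h']
  | tmul x x' => simp only [LinearMap.rTensor_tmul, γ.algebra_reflect hp]

/-- The product metric is the tensor product of the two isomorphisms onto the dual spaces, followed
by the identification of the tensor product of the duals with the dual of `V ⊗ V'`. -/
lemma tmul_g_separating (γ : Triality F V) (γ' : Triality F V') {t : V ⊗[F] V'}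
    (ht : ∀ x x', (γ.g.tmul γ'.g) t (x ⊗ₜ x') = 0) : t = 0 := by
  let e := (TensorProduct.congr (γ.g.toDual γ.g_nondeg) (γ'.g.toDual γ'.g_nondeg)).trans
    (TensorProduct.dualDistribEquiv F V V')
  have h : e.toLinearMap = γ.g.tmul γ'.g := by
    ext x x' y y'
    simp [e, LinearMap.BilinForm.toDual_def, mul_comm]
  refine e.map_eq_zero_iff.1 ?_
  have h' : e t = (γ.g.tmul γ'.g) t := congrArg (· t) h
  rw [h']
  ext x x'
  simpa using ht x x'

namespace PairAlgebra

variable {γ : Triality F V} {γ' : Triality F V'}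

lemma ten_tens_ten (a : PairAlgebra γ γ') : ten (tens γ γ' (ten a)) = ten a := by
  rw [ten_tens, sum_secProj γ γ' (ten_mem a)]

/-- The linear map of `gradeAut`. -/
def gradeMap (γ : Triality F V) (γ' : Triality F V') (i : Fin 3) :
    PairAlgebra γ γ' →ₗ[F] PairAlgebra γ γ' :=
  inUp γ γ' ∘ₗ upPart + inLow γ γ' ∘ₗ lowPart
    + tens γ γ' ∘ₗ (γ.reflect i).rTensor V' ∘ₗ ten

@[simp] lemma up_gradeMap (i : Fin 3) (a : PairAlgebra γ γ') : up (gradeMap γ γ' i a) = up a := by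
  simp [gradeMap, coe_upPart]

@[simp] lemma low_gradeMap (i : Fin 3) (a : PairAlgebra γ γ') :
    low (gradeMap γ γ' i a) = low a := by
  simp [gradeMap, coe_lowPart]

@[simp] lemma ten_gradeMap (i : Fin 3) (a : PairAlgebra γ γ') :
    ten (gradeMap γ γ' i a) = (γ.reflect i).rTensor V' (ten a) := by
  simp [gradeMap, ten_tens, sum_secProj γ γ' (rTensor_reflect_mem γ γ' i (ten_mem a))]

lemma gradeMap_gradeMap (i : Fin 3) (a : PairAlgebra γ γ') :
    gradeMap γ γ' i (gradeMap γ γ' i a) = a := by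
  ext1
  · simp
  · simp
  · rw [ten_gradeMap, ten_gradeMap]
    induction ten a using TensorProduct.induction_on with
    | zero => simp
    | add a a' h h' => simp only [map_add, h, h']
    | tmul x x' => simp only [LinearMap.rTensor_tmul, γ.reflect_reflect]

lemma gradeMap_lie (i : Fin 3) (a b : PairAlgebra γ γ') :
    gradeMap γ γ' i ⁅a, b⁆ = ⁅gradeMap γ γ' i a, gradeMap γ γ' i b⁆ := by
  ext1
  · simp only [up_gradeMap, up_lie, ten_gradeMap, brUp_reflect γ γ' i (ten_mem a) (ten_mem b)]
  · simp only [low_gradeMap, low_lie, ten_gradeMap, brLow_reflect γ γ' i (ten_mem a) (ten_mem b)]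
  · simp only [ten_gradeMap, ten_lie, brTen_reflect, up_gradeMap, low_gradeMap,
      γ.rTensor_algebra_reflect (up_mem a), γ.rTensor_algebra_reflect (up_mem b),
      lTensor_rTensor, map_add, map_sub]

/-- The automorphism which is the identity on the triality algebras and on `W_i`, and `-1` on the
other two tensor sectors. -/
def gradeAut (γ : Triality F V) (γ' : Triality F V') (i : Fin 3) :
    PairAlgebra γ γ' ≃ₗ⁅F⁆ PairAlgebra γ γ' :=
  { LinearEquiv.ofInvolutive (gradeMap γ γ' i) (gradeMap_gradeMap i) with
    map_lie' := gradeMap_lie i _ _ }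

lemma killingForm_gradeMap (i : Fin 3) (a b : PairAlgebra γ γ') :
    killingForm F _ (gradeMap γ γ' i a) (gradeMap γ γ' i b) = killingForm F _ a b :=
  LieAlgebra.killingForm_of_equiv_apply (gradeAut γ γ' i) a b

lemma gradeMap_inUp (i : Fin 3) (p : γ.algebra) : gradeMap γ γ' i (inUp γ γ' p) = inUp γ γ' p := by
  ext1 <;> simp

lemma gradeMap_inLow (i : Fin 3) (p : γ'.algebra) :
    gradeMap γ γ' i (inLow γ γ' p) = inLow γ γ' p := by
  ext1 <;> simp

lemma gradeMap_tens {i j : Fin 3} {x : V} {x' : V'} (hx : x ∈ γ.comp j)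
    (hx' : x' ∈ γ'.comp (j + 1)) : gradeMap γ γ' i (tens γ γ' (x ⊗ₜ x'))
      = if j = i then tens γ γ' (x ⊗ₜ x') else - tens γ γ' (x ⊗ₜ x') := by
  ext1
  · split_ifs <;> simp
  · split_ifs <;> simp
  · rw [ten_gradeMap, ten_tens_tmul hx hx', LinearMap.rTensor_tmul, γ.reflect_of_mem i hx]
    split_ifs
    · rw [ten_tens_tmul hx hx']
    · rw [map_neg, ten_tens_tmul hx hx', TensorProduct.neg_tmul]

variable [CharZero F]

/-- The Killing form is invariant under automorphisms, so the two eigenspaces of an involutive one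
are orthogonal. -/
lemma killingForm_eq_zero_of_gradeMap {i : Fin 3} {a b : PairAlgebra γ γ'}
    (ha : gradeMap γ γ' i a = a) (hb : gradeMap γ γ' i b = -b) : killingForm F _ a b = 0 := by
  have := killingForm_gradeMap i a b
  rw [ha, hb, map_neg] at this
  exact neg_eq_self.mp this

lemma killingForm_inUp_tens (p : γ.algebra) {t : V ⊗[F] V'} (ht : t ∈ tensorSpace γ γ') :
    killingForm F _ (inUp γ γ' p) (tens γ γ' t) = 0 := by
  induction ht using tensorSpace_induction with
  | h0 => simp
  | hadd a b _ _ ha hb => rw [map_add, map_add, ha, hb, add_zero]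
  | h j x hx x' hx' =>
    -- Any index other than `j` serves: the automorphism fixes the triality algebras and changes the
    -- sign of `W_j`.
    refine killingForm_eq_zero_of_gradeMap (gradeMap_inUp (j + 1) p) ?_
    rw [gradeMap_tens hx hx', if_neg (by simp)]

lemma killingForm_inLow_tens (p : γ'.algebra) {t : V ⊗[F] V'} (ht : t ∈ tensorSpace γ γ') :
    killingForm F _ (inLow γ γ' p) (tens γ γ' t) = 0 := by
  induction ht using tensorSpace_induction with
  | h0 => simp
  | hadd a b _ _ ha hb => rw [map_add, map_add, ha, hb, add_zero]
  | h j x hx x' hx' =>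
    refine killingForm_eq_zero_of_gradeMap (gradeMap_inLow (j + 1) p) ?_
    rw [gradeMap_tens hx hx', if_neg (by simp)]

/-- The factor of the Killing form on the tensor sectors. -/
def killingFactor (F : Type*) [Field F] (n n' : ℕ) : F :=
  - (8 * (n - 1) + 8 * (n' - 1) + 2 * n * n')

lemma killingFactor_ne_zero {n n' : ℕ} (hn : n ≠ 0) (hn' : n' ≠ 0) : killingFactor F n n' ≠ 0 := by
  obtain ⟨m, rfl⟩ := Nat.exists_eq_succ_of_ne_zero hn
  obtain ⟨m', rfl⟩ := Nat.exists_eq_succ_of_ne_zero hn'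
  -- In terms of `m = n - 1` and `m' = n' - 1` the factor is minus a polynomial with positive
  -- integer coefficients, hence minus a positive integer.
  have : killingFactor F m.succ m'.succ = - ((10 * m + 10 * m' + 2 * m * m' + 2 : ℕ) : F) := by
    simp only [killingFactor]
    push_cast
    ring
  rw [this, neg_ne_zero]
  exact_mod_cast (by omega : 10 * m + 10 * m' + 2 * m * m' + 2 ≠ 0)

/-! ### The Killing form on all summands, by invariance. -/

variable {n n' : ℕ} (hγ : γ.HasDim n) (hγ' : γ'.HasDim n')

include hγ hγ'

lemma killingForm_tens_tens {t s : V ⊗[F] V'} (ht : t ∈ tensorSpace γ γ')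
    (hs : s ∈ tensorSpace γ γ') : killingForm F _ (tens γ γ' t) (tens γ γ' s)
      = killingFactor F n n' * (γ.g.tmul γ'.g) t s := by
  induction ht using tensorSpace_induction with
  | h0 => simp
  | hadd a b _ _ ha hb => simp only [map_add, LinearMap.add_apply, ha, hb, mul_add]
  | h i x hx x' hx' =>
  induction hs using tensorSpace_induction with
  | h0 => simp
  | hadd a b _ _ ha hb => simp only [map_add, ha, hb, mul_add]
  | h j y hy y' hy' =>
    by_cases hij : i = j
    · subst hij
      rw [killingForm_tens hγ hγ' hx hy hx' hy', killingFactor]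
      simp [mul_comm]
    · rw [killingForm_eq_zero_of_gradeMap (i := i) (by rw [gradeMap_tens hx hx', if_pos rfl])
        (by rw [gradeMap_tens hy hy', if_neg (Ne.symm hij)])]
      simp [γ.comp_orth i j hij x hx y hy]

omit hγ hγ' [CharZero F] in
lemma lie_tens_tens_same {i : Fin 3} {x y : V} {x' y' : V'} (hx : x ∈ γ.comp i)
    (hy : y ∈ γ.comp i) (hx' : x' ∈ γ'.comp (i + 1)) (hy' : y' ∈ γ'.comp (i + 1)) :
    ⁅tens γ γ' (x ⊗ₜ x'), tens γ γ' (y ⊗ₜ y')⁆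
      = γ'.g x' y' • inUp γ γ' ⟨γ.rot x y, γ.rot_mem hx hy⟩
        + γ.g x y • inLow γ γ' ⟨γ'.rot x' y', γ'.rot_mem hx' hy'⟩ := by
  ext1
  · simp [up_lie, ten_tens_tmul hx hx', ten_tens_tmul hy hy']
  · simp [low_lie, ten_tens_tmul hx hx', ten_tens_tmul hy hy']
  · simp [ten_lie, ten_tens_tmul hx hx', ten_tens_tmul hy hy', γ'.mul_self_comp hx' hy']

omit hγ hγ' [CharZero F] in
lemma lie_inUp_tens (p : γ.algebra) {i : Fin 3} {x : V} {x' : V'} (hx : x ∈ γ.comp i)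
    (hx' : x' ∈ γ'.comp (i + 1)) : ⁅inUp γ γ' p, tens γ γ' (x ⊗ₜ x')⁆
      = tens γ γ' ((p : Module.End F V) x ⊗ₜ x') := by
  ext1
  · simp [up_lie]
  · simp [low_lie]
  · simp [ten_lie, ten_tens_tmul hx hx', ten_tens_tmul (p.2.1 i x hx) hx']

omit hγ hγ' [CharZero F] in
lemma lie_inLow_tens (p : γ'.algebra) {i : Fin 3} {x : V} {x' : V'} (hx : x ∈ γ.comp i)
    (hx' : x' ∈ γ'.comp (i + 1)) : ⁅inLow γ γ' p, tens γ γ' (x ⊗ₜ x')⁆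
      = tens γ γ' (x ⊗ₜ (p : Module.End F V') x') := by
  ext1
  · simp [up_lie]
  · simp [low_lie]
  · simp [ten_lie, ten_tens_tmul hx hx', ten_tens_tmul hx (p.2.1 (i + 1) x' hx')]

omit hγ hγ' in
-- With equal second factors the lower part of the bracket vanishes, as `R'(x', x') = 0`. Invariance
-- thus carries values on orthogonal generators back to values on tensors.
lemma killingForm_inUp_rot (a : PairAlgebra γ γ') {i : Fin 3} {x y : V} {x' : V'}
    (hx : x ∈ γ.comp i) (hy : y ∈ γ.comp i) (hx' : x' ∈ γ'.comp (i + 1)) :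
    γ'.g x' x' * killingForm F _ a (inUp γ γ' ⟨γ.rot x y, γ.rot_mem hx hy⟩)
      = killingForm F _ ⁅a, tens γ γ' (x ⊗ₜ x')⁆ (tens γ γ' (y ⊗ₜ x')) := by
  have h0 : (⟨γ'.rot x' x', γ'.rot_mem hx' hx'⟩ : γ'.algebra) = 0 :=
    Subtype.ext (γ'.rot_self x')
  rw [LieModule.traceForm_apply_lie_apply, lie_tens_tens_same hx hy hx' hx', h0, map_zero,
    smul_zero, add_zero, map_smul, smul_eq_mul]

omit hγ hγ' in
lemma killingForm_inLow_rot (a : PairAlgebra γ γ') {i : Fin 3} {x : V} {x' y' : V'}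
    (hx : x ∈ γ.comp i) (hx' : x' ∈ γ'.comp (i + 1)) (hy' : y' ∈ γ'.comp (i + 1)) :
    γ.g x x * killingForm F _ a (inLow γ γ' ⟨γ'.rot x' y', γ'.rot_mem hx' hy'⟩)
      = killingForm F _ ⁅a, tens γ γ' (x ⊗ₜ x')⁆ (tens γ γ' (x ⊗ₜ y')) := by
  have h0 : (⟨γ.rot x x, γ.rot_mem hx hx⟩ : γ.algebra) = 0 :=
    Subtype.ext (γ.rot_self x)
  rw [LieModule.traceForm_apply_lie_apply, lie_tens_tens_same hx hx hx' hy', h0, map_zero,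
    smul_zero, zero_add, map_smul, smul_eq_mul]

variable (hn : n ≠ 0) (hn' : n' ≠ 0)

include hn'

/-- The bracket of `p` with `x ⊗ x'` stays in its sector, where the form is known; the factor
`g'(x', x')` of a non-isotropic `x'` cancels. -/
lemma killingForm_inUp_inUp_rot (p : γ.algebra) {i : Fin 3} {x y : V} (hx : x ∈ γ.comp i)
    (hy : y ∈ γ.comp i) : killingForm F _ (inUp γ γ' p) (inUp γ γ' ⟨γ.rot x y, γ.rot_mem hx hy⟩)
      = killingFactor F n n' * γ.g ((p : Module.End F V) x) y := by
  obtain ⟨x', hx', h⟩ := γ'.exists_g_self_ne_zero hγ' hn' (i + 1)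
  have := killingForm_inUp_rot (inUp γ γ' p) hx hy hx'
  rw [lie_inUp_tens p hx hx', killingForm_tens hγ hγ' (p.2.1 i x hx) hy hx' hx'] at this
  refine mul_left_cancel₀ h ?_
  rw [this, killingFactor]
  ring

omit hn' in
include hn in
lemma killingForm_inLow_inLow_rot (p : γ'.algebra) {i : Fin 3} {x' y' : V'}
    (hx' : x' ∈ γ'.comp (i + 1)) (hy' : y' ∈ γ'.comp (i + 1)) :
    killingForm F _ (inLow γ γ' p) (inLow γ γ' ⟨γ'.rot x' y', γ'.rot_mem hx' hy'⟩)
      = killingFactor F n n' * γ'.g ((p : Module.End F V') x') y' := by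
  obtain ⟨x, hx, h⟩ := γ.exists_g_self_ne_zero hγ hn i
  have := killingForm_inLow_rot (inLow γ γ' p) hx hx' hy'
  rw [lie_inLow_tens p hx hx', killingForm_tens hγ hγ' hx hx (p.2.1 _ x' hx') hy'] at this
  refine mul_left_cancel₀ h ?_
  rw [this, killingFactor]
  ring

/-- On an orthogonal generator `R(x, y)` the value is proportional to `g'(q x', x')`, which vanishes
because `q` is skew. -/
lemma killingForm_inLow_inUp (q : γ'.algebra) (p : γ.algebra) :
    killingForm F _ (inLow γ γ' q) (inUp γ γ' p) = 0 := by
  have : LinearMap.ker (killingForm F _ (inLow γ γ' q) ∘ₗ inUp γ γ') = ⊤ := by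
    refine γ.algebra_submodule_eq_top hγ fun i x hx y hy => ?_
    change killingForm F _ (inLow γ γ' q) (inUp γ γ' _) = 0
    obtain ⟨x', hx', h⟩ := γ'.exists_g_self_ne_zero hγ' hn' (i + 1)
    have := killingForm_inUp_rot (inLow γ γ' q) hx hy hx'
    rw [lie_inLow_tens q hx hx', killingForm_tens hγ hγ' hx hy (q.2.1 _ x' hx') hx',
      γ'.g_algebra_self q.2, mul_zero, mul_zero] at this
    exact (mul_eq_zero.1 this).resolve_left h
  exact (this ▸ Submodule.mem_top : p ∈ LinearMap.ker (killingForm F _ (inLow γ γ' q) ∘ₗ inUp γ γ'))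

include hn

lemma eq_zero_of_killingForm_inUp {p : γ.algebra} (h : ∀ r : γ.algebra,
    killingForm F _ (inUp γ γ' p) (inUp γ γ' r) = 0) : p = 0 := by
  refine Subtype.ext (γ.hom_ext_comp fun i x hx => γ.g_ext_comp fun j y hy => ?_)
  change γ.g ((p : Module.End F V) x) y = γ.g 0 y
  rw [map_zero, LinearMap.zero_apply]
  by_cases hij : i = j
  · subst hij
    have h1 := h ⟨γ.rot x y, γ.rot_mem hx hy⟩
    rw [killingForm_inUp_inUp_rot hγ hγ' hn' p hx hy] at h1
    exact (mul_eq_zero.1 h1).resolve_left (killingFactor_ne_zero hn hn')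
  · exact γ.comp_orth i j hij _ (p.2.1 i x hx) y hy

lemma eq_zero_of_killingForm_inLow {p : γ'.algebra} (h : ∀ r : γ'.algebra,
    killingForm F _ (inLow γ γ' p) (inLow γ γ' r) = 0) : p = 0 := by
  refine Subtype.ext (γ'.hom_ext_comp fun i x hx => γ'.g_ext_comp fun j y hy => ?_)
  change γ'.g ((p : Module.End F V') x) y = γ'.g 0 y
  rw [map_zero, LinearMap.zero_apply]
  by_cases hij : i = j
  · subst hij
    -- The lower index of a sector is its upper index plus one; every subspace of the lower triality
    -- occurs in some sector.
    obtain ⟨i, rfl⟩ : ∃ k : Fin 3, i = k + 1 := ⟨i - 1, by simp⟩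
    have h1 := h ⟨γ'.rot x y, γ'.rot_mem hx hy⟩
    rw [killingForm_inLow_inLow_rot hγ hγ' hn p hx hy] at h1
    exact (mul_eq_zero.1 h1).resolve_left (killingFactor_ne_zero hn hn')
  · exact γ'.comp_orth i j hij _ (p.2.1 i x hx) y hy

lemma eq_zero_of_killingForm_tens {t : V ⊗[F] V'} (ht : t ∈ tensorSpace γ γ')
    (h : ∀ i, ∀ x ∈ γ.comp i, ∀ x' ∈ γ'.comp (i + 1),
      killingForm F _ (tens γ γ' t) (tens γ γ' (x ⊗ₜ x')) = 0) : t = 0 := by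
  refine tmul_g_separating γ γ' fun x x' => ?_
  induction x using γ.iSup_comp_induction with
  | h0 => simp
  | hadd a b ha hb => rw [TensorProduct.add_tmul, map_add, ha, hb, add_zero]
  | h i x hx =>
  induction x' using γ'.iSup_comp_induction with
  | h0 => simp
  | hadd a b ha hb => rw [TensorProduct.tmul_add, map_add, ha, hb, add_zero]
  | h j x' hx' =>
    by_cases hij : j = i + 1
    · subst hij
      have h1 := h i x hx x' hx'
      rw [killingForm_tens_tens hγ hγ' ht (sector_le γ γ' i (tmul_mem_sector γ γ' hx hx'))] at h1
      exact (mul_eq_zero.1 h1).resolve_left (killingFactor_ne_zero hn hn')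
    -- Off the sectors the hypothesis says nothing, but there the product metric with an element of
    -- `tensorSpace` vanishes by orthogonality of the subspaces.
    · clear h
      induction ht using tensorSpace_induction with
      | h0 => simp
      | hadd a b _ _ ha hb => rw [map_add, LinearMap.add_apply, ha, hb, add_zero]
      | h k y hy y' hy' =>
        rw [LinearMap.BilinForm.tensorDistrib_tmul]
        by_cases hk : k = i
        · subst hk
          rw [γ'.comp_orth _ j (Ne.symm hij) y' hy' x' hx', zero_smul]
        · rw [γ.comp_orth k i hk y hy x hx, smul_zero]

/-- An element orthogonal to all three kinds of summands for the Killing form vanishes. -/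
lemma eq_zero_of_killingForm {a : PairAlgebra γ γ'}
    (h : ∀ b, killingForm F _ a b = 0) : a = 0 := by
  have e := eq_add a
  have hp : upPart a = 0 := eq_zero_of_killingForm_inUp hγ hγ' hn hn' fun r => by
    have := h (inUp γ γ' r)
    rw [e] at this
    simp only [map_add, LinearMap.add_apply] at this
    rwa [killingForm_inLow_inUp hγ hγ' hn',
      LieModule.traceForm_comm F _ _ (tens γ γ' (ten a)), killingForm_inUp_tens r (ten_mem a),
      add_zero, add_zero] at this
  have hq : lowPart a = 0 := eq_zero_of_killingForm_inLow hγ hγ' hn hn' fun r => by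
    have := h (inLow γ γ' r)
    rw [e] at this
    simp only [map_add, LinearMap.add_apply] at this
    rwa [hp, map_zero, map_zero, LinearMap.zero_apply, zero_add,
      LieModule.traceForm_comm F _ _ (tens γ γ' (ten a)), killingForm_inLow_tens r (ten_mem a),
      add_zero] at this
  rw [hp, hq, map_zero, map_zero, zero_add, zero_add] at e
  have ht : ten a = 0 := eq_zero_of_killingForm_tens hγ hγ' hn hn' (ten_mem a)
    fun i x _ x' _ => by rw [← e]; exact h _
  rw [e, ht, map_zero]

/-! ### Non-degeneracy on the whole algebra and on each summand. -/

theorem killingForm_nondegenerate : (killingForm F (PairAlgebra γ γ')).Nondegenerate :=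
  (LinearMap.IsRefl.nondegenerate_iff_separatingLeft
    (LieModule.traceForm_isSymm F (PairAlgebra γ γ') (PairAlgebra γ γ')).isRefl).2
    fun _ h => eq_zero_of_killingForm hγ hγ' hn hn' h

omit hγ hγ' hn hn' in
lemma restrict_killingForm_nondegenerate {U : Submodule F (PairAlgebra γ γ')}
    (h : ∀ a ∈ U, (∀ b ∈ U, killingForm F _ a b = 0) → a = 0) :
    ((killingForm F (PairAlgebra γ γ')).restrict U).Nondegenerate := by
  refine (LinearMap.IsRefl.nondegenerate_iff_separatingLeft ?_).2 fun a ha => ?_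
  · intro a b hab
    have : killingForm F _ (a : PairAlgebra γ γ') (b : PairAlgebra γ γ') = 0 := hab
    rw [LieModule.traceForm_comm] at this
    exact this
  · exact Subtype.ext (h a a.2 fun b hb => ha ⟨b, hb⟩)

theorem killingForm_restrict_upper_nondegenerate :
    ((killingForm F (PairAlgebra γ γ')).restrict (upper γ γ')).Nondegenerate := by
  refine restrict_killingForm_nondegenerate fun a ha h => ?_
  have e : a = inUp γ γ' (upPart a) := by
    ext1
    · rfl
    · exact ha.1
    · exact ha.2
  have hp : upPart a = 0 := eq_zero_of_killingForm_inUp hγ hγ' hn hn' fun r => by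
    rw [← e]
    exact h _ ⟨rfl, rfl⟩
  rw [e, hp, map_zero]

theorem killingForm_restrict_lower_nondegenerate :
    ((killingForm F (PairAlgebra γ γ')).restrict (lower γ γ')).Nondegenerate := by
  refine restrict_killingForm_nondegenerate fun a ha h => ?_
  have e : a = inLow γ γ' (lowPart a) := by
    ext1
    · exact ha.1
    · rfl
    · exact ha.2
  have hp : lowPart a = 0 := eq_zero_of_killingForm_inLow hγ hγ' hn hn' fun r => by
    rw [← e]
    exact h _ ⟨rfl, rfl⟩
  rw [e, hp, map_zero]

omit hγ hγ' hn hn' [CharZero F] in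
lemma eq_tens_of_mem_tensorSector {i : Fin 3} {a : PairAlgebra γ γ'}
    (ha : a ∈ tensorSector γ γ' i) : a = tens γ γ' (ten a) := by
  obtain ⟨⟨h1, h2⟩, h3⟩ := ha
  ext1
  · exact h1
  · exact h2
  · rw [ten_tens_ten]

omit hγ hγ' hn hn' [CharZero F] in
lemma tens_mem_tensorSector {i : Fin 3} {t : V ⊗[F] V'} (ht : t ∈ sector γ γ' i) :
    tens γ γ' t ∈ tensorSector γ γ' i :=
  ⟨⟨rfl, rfl⟩, by
    change ten (tens γ γ' t) ∈ sector γ γ' i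
    rwa [ten_tens_of_mem ht]⟩

omit hn hn' in
theorem killingForm_tensorSector {i : Fin 3} {a b : PairAlgebra γ γ'}
    (ha : a ∈ tensorSector γ γ' i) (hb : b ∈ tensorSector γ γ' i) :
    killingForm F _ a b = killingFactor F n n' * (γ.g.tmul γ'.g) (ten a) (ten b) := by
  conv_lhs => rw [eq_tens_of_mem_tensorSector ha, eq_tens_of_mem_tensorSector hb]
  exact killingForm_tens_tens hγ hγ' (ten_mem a) (ten_mem b)

theorem killingForm_restrict_tensorSector_nondegenerate (i : Fin 3) :
    ((killingForm F (PairAlgebra γ γ')).restrict (tensorSector γ γ' i)).Nondegenerate := by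
  refine restrict_killingForm_nondegenerate fun a ha h => ?_
  have e := eq_tens_of_mem_tensorSector ha
  have ht : ten a = 0 := eq_zero_of_killingForm_tens hγ hγ' hn hn' (ten_mem a)
    fun j x hx x' hx' => by
      by_cases hij : i = j
      · subst hij
        rw [← e]
        exact h _ (tens_mem_tensorSector (tmul_mem_sector γ γ' hx hx'))
      -- The automorphism of index `i` fixes `W_i` and is `-1` on `W_j`; so orthogonality to `W_i`
      -- alone implies orthogonality to all tensors.
      · refine killingForm_eq_zero_of_gradeMap (i := i) ?_ ?_
        · have : ten a ∈ sector γ γ' i := ha.2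
          generalize ten a = t at this
          obtain ⟨s, rfl⟩ := this
          induction s using TensorProduct.induction_on with
          | zero => simp
          | add a b ha hb => simp only [map_add, ha, hb]
          | tmul z z' => exact (gradeMap_tens z.2 z'.2).trans (if_pos rfl)
        · rw [gradeMap_tens hx hx', if_neg (Ne.symm hij)]
  rw [e, ht, map_zero]

end PairAlgebra

end Triality

end KillingForm

/-! ### Simplicity -/

section Simplicity

namespace Triality

variable {F : Type u} {V : Type v} {V' : Type w} [Field F] [CharZero F]
  [AddCommGroup V] [Module F V] [FiniteDimensional F V]
  [AddCommGroup V'] [Module F V'] [FiniteDimensional F V']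

/-! ### Operators on one subspace and stable spaces of tensors. -/

/-- The rank-one operator `v ↦ g(x, v) z`. -/
def rankOne (γ : Triality F V) : V →ₗ[F] V →ₗ[F] Module.End F V :=
  LinearMap.mk₂ F (fun x z => (γ.g x).smulRight z)
    (by intro a b c; ext z; simp [add_smul]) (by intro a b c; ext z; simp [mul_smul])
    (by intro a b c; ext z; simp) (by intro a b c; ext z; simp; module)

@[simp] lemma rankOne_apply (γ : Triality F V) (x z v : V) : γ.rankOne x z v = γ.g x v • z := rfl

lemma exists_orthogonal_family (γ : Triality F V) {n : ℕ} (hγ : γ.HasDim n) (i : Fin 3) :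
    ∃ e : Fin n → V, (∀ a, e a ∈ γ.comp i) ∧ (∀ a b, a ≠ b → γ.g (e a) (e b) = 0) ∧
      (∀ a, γ.g (e a) (e a) ≠ 0) ∧ Submodule.span F (Set.range e) = γ.comp i := by
  have : Invertible (2 : F) := invertibleOfNonzero two_ne_zero
  have hs : LinearMap.IsSymm (γ.g.restrict (γ.comp i)) := ⟨fun x y => γ.g_symm x y⟩
  obtain ⟨b, hb⟩ := LinearMap.BilinForm.exists_orthogonal_basis hs
  have hn : (γ.g.restrict (γ.comp i)).SeparatingLeft := by
    refine fun x hx => Subtype.ext (γ.g_ext_comp fun j z hz => ?_)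
    change γ.g x z = γ.g 0 z
    rw [map_zero, LinearMap.zero_apply]
    by_cases hij : i = j
    · subst hij; exact hx ⟨z, hz⟩
    · exact γ.comp_orth i j hij x x.2 z hz
  have hb' := fun a => LinearMap.IsOrthoᵢ.not_isOrtho_basis_self_of_separatingLeft hb hn a
  let c := finCongr (hγ i)
  refine ⟨fun a => b (c.symm a), fun a => (b _).2, fun a a' h => ?_, fun a => hb' _, ?_⟩
  · exact hb (fun h' => h (c.symm.injective h'))
  · have : Set.range (fun a => (b (c.symm a) : V)) = (γ.comp i).subtype '' Set.range b := by
      rw [← Set.range_comp]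
      exact c.symm.surjective.range_comp (fun a => (b a : V))
    rw [this, Submodule.span_image, b.span_eq, Submodule.map_top, Submodule.range_subtype]

/-- In dimension other than `2`, the skew operators and the projection generate all rank-one
operators of `V_i`. -/
lemma rankOne_mem (γ : Triality F V) {n : ℕ} (hγ : γ.HasDim n) (hn : n ≠ 2) (i : Fin 3)
    (S : Subalgebra F (Module.End F V)) (hS : γ.proj i ∈ S)
    (hD : ∀ x ∈ γ.comp i, ∀ y ∈ γ.comp i, γ.rankOne x y - γ.rankOne y x ∈ S)
    {x z : V} (hx : x ∈ γ.comp i) (hz : z ∈ γ.comp i) : γ.rankOne x z ∈ S := by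
  obtain ⟨e, he, ho, hne, hspan⟩ := γ.exists_orthogonal_family hγ i
  have hoff : ∀ a b, a ≠ b → γ.rankOne (e a) (e b) ∈ S := by
    intro a b hab
    -- Two distinct indices and `n ≠ 2` force a third one. The product of the skew operators of the
    -- pairs `(c, b)` and `(a, c)` is then `g(e_c, e_c)` times the rank-one operator of `(a, b)`,
    -- all other terms being zero by orthogonality.
    obtain ⟨c, hca, hcb⟩ : ∃ c : Fin n, c ≠ a ∧ c ≠ b := by
      have h2 : ({a, b} : Finset (Fin n)).card < (Finset.univ : Finset (Fin n)).card := by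
        have := Fin.val_ne_of_ne hab
        rw [Finset.card_pair hab, Finset.card_univ, Fintype.card_fin]
        omega
      obtain ⟨c, -, hc⟩ := Finset.exists_mem_notMem_of_card_lt_card h2
      simp only [Finset.mem_insert, Finset.mem_singleton, not_or] at hc
      exact ⟨c, hc⟩
    have h := S.smul_mem (S.mul_mem (hD _ (he c) _ (he b)) (hD _ (he a) _ (he c)))
      (γ.g (e c) (e c))⁻¹
    convert h using 1
    ext v
    simp [ho c a hca, ho b c hcb.symm, ho b a hab.symm, smul_smul, mul_comm, hne c]
  have hall : ∀ a b, γ.rankOne (e a) (e b) ∈ S := by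
    intro a b
    by_cases hab : a = b
    · subst hab
      by_cases h : ∃ c : Fin n, c ≠ a
      · obtain ⟨c, hc⟩ := h
        have h := S.smul_mem (S.mul_mem (hoff c a hc) (hoff a c hc.symm)) (γ.g (e c) (e c))⁻¹
        convert h using 1
        ext v
        simp [smul_smul, mul_comm, hne c]
      -- Here `V_i` is a line: there are no skew operators to use, but the rank-one operator is a
      -- multiple of the projection.
      · push Not at h
        have hr : Set.range e = {e a} := by
          ext v
          constructor
          · rintro ⟨c, rfl⟩; rw [h c]; rfl
          · rintro rfl; exact ⟨a, rfl⟩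
        have hv : ∀ v, γ.rankOne (e a) (e a) v = (γ.g (e a) (e a) • γ.proj i) v := by
          intro v
          obtain ⟨k, hk⟩ := Submodule.mem_span_singleton.1
            (hr ▸ hspan ▸ γ.proj_mem i v : γ.proj i v ∈ Submodule.span F {e a})
          rw [rankOne_apply, LinearMap.smul_apply, ← γ.proj_self (he a), γ.g_proj_left, ← hk,
            γ.proj_self (he a), map_smul, smul_smul, smul_eq_mul, mul_comm]
        exact (LinearMap.ext hv : γ.rankOne (e a) (e a) = _) ▸ S.smul_mem hS _
    · exact hoff a b hab
  rw [← hspan] at hx hz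
  induction hx using Submodule.span_induction with
  | zero => simp
  | add x y _ _ h h' => rw [map_add, LinearMap.add_apply]; exact add_mem h h'
  | smul c x _ h => rw [map_smul, LinearMap.smul_apply]; exact S.smul_mem h c
  | mem x hx =>
  obtain ⟨a, rfl⟩ := hx
  induction hz using Submodule.span_induction with
  | zero => simp
  | add x y _ _ h h' => rw [map_add]; exact add_mem h h'
  | smul c x _ h => rw [map_smul]; exact S.smul_mem h c
  | mem z hz =>
  obtain ⟨b, rfl⟩ := hz
  exact hall a b

/-- The operator of `V ⊗ V'` which describes the square of `ad (x ⊗ x')` on the sector of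
`x ⊗ x'`, up to the factor `-4`. -/
def sectorOp (γ : Triality F V) (γ' : Triality F V') (x : V) (x' : V') :
    Module.End F (V ⊗[F] V') :=
  TensorProduct.map (γ.g x x • 1 - γ.rankOne x x) (γ'.rankOne x' x')
    + TensorProduct.map (γ.rankOne x x) (γ'.g x' x' • 1 - γ'.rankOne x' x')

lemma sectorOp_tmul (γ : Triality F V) (γ' : Triality F V') (x z : V) (x' z' : V') :
    sectorOp γ γ' x x' (z ⊗ₜ z') = (γ'.g x' z' * γ.g x x) • (z ⊗ₜ x')
      + (γ.g x z * γ'.g x' x') • (x ⊗ₜ z') - (2 * γ.g x z * γ'.g x' z') • (x ⊗ₜ x') := by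
  simp only [sectorOp, LinearMap.add_apply, TensorProduct.map_tmul, LinearMap.sub_apply,
    LinearMap.smul_apply, Module.End.one_apply, rankOne_apply, TensorProduct.sub_tmul,
    TensorProduct.tmul_sub, TensorProduct.tmul_smul, ← TensorProduct.smul_tmul']
  module

/-- Put `c = g(x,x)`. The rank-one operator `P` of `x` satisfies `P² = cP` and `(c - P)P = 0`, hence
`(c - P)² = c(c - P)`; the same holds for `x'`. So the two summands annihilate each other, and each
squares to the stated multiple of itself. -/
lemma sectorOp_sectorOp (γ : Triality F V) (γ' : Triality F V') (x : V) (x' : V')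
    (t : V ⊗[F] V') : sectorOp γ γ' x x' (sectorOp γ γ' x x' t)
      = (γ.g x x * γ'.g x' x') • sectorOp γ γ' x x' t := by
  induction t using TensorProduct.induction_on with
  | zero => simp
  | add a b ha hb => rw [map_add, map_add, ha, hb, smul_add]
  | tmul z z' =>
    simp only [sectorOp_tmul, map_add, map_sub, map_smul]
    module

/-- A non-zero space of tensors in `V_i ⊗ V'_k` which is stable under the skew operators of `V_i`
and under the operators `sectorOp` is all of `V_i ⊗ V'_k`, if `V_i` has dimension other
than `2`. -/
lemma tmul_mem_of_stable (γ : Triality F V) (γ' : Triality F V') {n : ℕ} (hγ : γ.HasDim n)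
    (hn0 : n ≠ 0) (hn : n ≠ 2) (i k : Fin 3) (J : Submodule F (V ⊗[F] V'))
    (hJ : J ≤ LinearMap.range (TensorProduct.mapIncl (γ.comp i) (γ'.comp k)))
    (hD : ∀ x ∈ γ.comp i, ∀ y ∈ γ.comp i, ∀ t ∈ J,
      (γ.rankOne x y - γ.rankOne y x).rTensor V' t ∈ J)
    (hN : ∀ x ∈ γ.comp i, ∀ x' ∈ γ'.comp k, ∀ t ∈ J, sectorOp γ γ' x x' t ∈ J)
    (hne : J ≠ ⊥) {z : V} {z' : V'} (hz : z ∈ γ.comp i) (hz' : z' ∈ γ'.comp k) :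
    z ⊗ₜ z' ∈ J := by
  -- The operators `A` for which `A ⊗ 1` preserves `J` form an algebra. It contains the skew
  -- operators by hypothesis and the projection because `J` lies over `V_i`, hence all rank-one
  -- operators of `V_i` by `rankOne_mem`.
  let S : Subalgebra F (Module.End F V) :=
    { carrier := {A | ∀ t ∈ J, A.rTensor V' t ∈ J}
      mul_mem' := fun {A B} hA hB t ht => by
        rw [LinearMap.rTensor_mul]; exact hA _ (hB t ht)
      add_mem' := fun {A B} hA hB t ht => by
        rw [LinearMap.rTensor_add]; exact add_mem (hA t ht) (hB t ht)
      algebraMap_mem' := fun c t ht => by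
        rw [Algebra.algebraMap_eq_smul_one, LinearMap.rTensor_smul, LinearMap.smul_apply]
        refine J.smul_mem c ?_
        change (LinearMap.id).rTensor V' t ∈ J
        rwa [LinearMap.rTensor_id] }
  have hR : ∀ x ∈ γ.comp i, ∀ y ∈ γ.comp i, ∀ t ∈ J, (γ.rankOne x y).rTensor V' t ∈ J := by
    intro x hx y hy
    refine γ.rankOne_mem hγ hn i S (fun t ht => ?_) (fun x hx y hy => hD x hx y hy) hx hy
    have : (γ.proj i).rTensor V' t = t := by
      obtain ⟨s, rfl⟩ := hJ ht
      clear ht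
      induction s using TensorProduct.induction_on with
      | zero => simp
      | add a b ha hb => rw [map_add, map_add, ha, hb]
      | tmul y y' => simp [TensorProduct.mapIncl, γ.proj_self y.2]
    rwa [this]
  -- Contraction of the first factor with `x`. A rank-one operator turns an arbitrary tensor of `J`
  -- into a pure one, `y ⊗ con x t`, and some contraction of a non-zero tensor is non-zero.
  let con : V → V ⊗[F] V' →ₗ[F] V' := fun x => (TensorProduct.lid F V').toLinearMap ∘ₗ
    (γ.g x).rTensor V'
  have hcon : ∀ x y t, (γ.rankOne x y).rTensor V' t = y ⊗ₜ con x t := by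
    intro x y t
    induction t using TensorProduct.induction_on with
    | zero => simp
    | add a b ha hb => rw [map_add, map_add, TensorProduct.tmul_add, ha, hb]
    | tmul z z' => simp [con, TensorProduct.smul_tmul]
  obtain ⟨t, ht, ht0⟩ := (Submodule.ne_bot_iff J).1 hne
  have hmem : ∀ x, con x t ∈ γ'.comp k := by
    intro x
    obtain ⟨s, rfl⟩ := hJ ht
    clear ht ht0
    induction s using TensorProduct.induction_on with
    | zero => simp
    | add a b ha hb => rw [map_add, map_add]; exact add_mem ha hb
    | tmul y y' =>
      simpa [con, TensorProduct.mapIncl] using Submodule.smul_mem _ (γ.g x y) y'.2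
  have hoff : ∀ j, j ≠ i → ∀ x ∈ γ.comp j, con x t = 0 := by
    intro j hj x hx
    obtain ⟨s, rfl⟩ := hJ ht
    clear ht ht0 hmem
    induction s using TensorProduct.induction_on with
    | zero => simp
    | add a b ha hb => rw [map_add, map_add, ha, hb, add_zero]
    | tmul y y' => simp [con, TensorProduct.mapIncl, γ.comp_orth j i hj x hx y y.2]
  have hgcon : ∀ x x', (γ.g.tmul γ'.g) t (x ⊗ₜ x') = γ'.g (con x t) x' := by
    intro x x'
    clear ht ht0 hmem hoff
    induction t using TensorProduct.induction_on with
    | zero => simp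
    | add a b ha hb => simp only [map_add, LinearMap.add_apply, ha, hb]
    | tmul y y' => simp [con, γ.g_symm x y, mul_comm]
  obtain ⟨x, hx, hs0⟩ : ∃ x ∈ γ.comp i, con x t ≠ 0 := by
    by_contra! h
    refine ht0 (tmul_g_separating γ γ' fun x x' => ?_)
    induction x using γ.iSup_comp_induction with
    | h0 => simp
    | hadd a b ha hb => rw [TensorProduct.add_tmul, map_add, ha, hb, add_zero]
    | h j x hx =>
      by_cases hj : j = i
      · rw [hgcon, h x (hj ▸ hx), map_zero, LinearMap.zero_apply]
      · rw [hgcon, hoff j hj x hx, map_zero, LinearMap.zero_apply]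
  obtain ⟨x₁, hx₁, h1⟩ : ∃ x' ∈ γ'.comp k, γ'.g x' (con x t) ≠ 0 := by
    by_contra! h
    refine hs0 (γ'.g_ext_comp fun j y hy => ?_)
    rw [map_zero, LinearMap.zero_apply]
    by_cases hj : k = j
    · subst hj
      rw [γ'.g_symm]
      exact h y hy
    · exact γ'.comp_orth k j hj _ (hmem x) y hy
  obtain ⟨z₀, hz₀, hz0⟩ := γ.exists_g_self_ne_zero hγ hn0 i
  have hzs : z₀ ⊗ₜ con x t ∈ J := hcon x z₀ t ▸ hR x hx z₀ hz₀ t ht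
  -- With `s = con x t`, the operator takes `z₀ ⊗ s` to `g(z₀,z₀) (g'(x',x') z₀ ⊗ s - g'(x',s) z₀ ⊗
  -- x')`; this can be solved for `z₀ ⊗ x'`.
  have h2 : ∀ x' ∈ γ'.comp k, γ'.g x' (con x t) ≠ 0 → z₀ ⊗ₜ x' ∈ J := by
    intro x' hx' hne'
    have h3 := hN z₀ hz₀ x' hx' _ hzs
    rw [sectorOp_tmul] at h3
    have h4 := J.smul_mem (γ'.g x' (con x t) * γ.g z₀ z₀)⁻¹
      (sub_mem (J.smul_mem (γ.g z₀ z₀ * γ'.g x' x') hzs) h3)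
    convert h4 using 1
    match_scalars
    · field_simp
      ring
    · ring
  have h5 : z₀ ⊗ₜ z' ∈ J := by
    -- A vector orthogonal to `con x t` is the difference of `z' + x₁` and `x₁`, neither of which is
    -- orthogonal to it.
    by_cases h : γ'.g z' (con x t) = 0
    · have h6 := sub_mem (h2 (z' + x₁) (add_mem hz' hx₁) (by simpa [h] using h1)) (h2 x₁ hx₁ h1)
      rwa [← TensorProduct.tmul_sub, add_sub_cancel_right] at h6
    · exact h2 z' hz' h
  have h7 := J.smul_mem (γ.g z₀ z₀)⁻¹ (hR z₀ hz₀ z hz _ h5)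
  rwa [LinearMap.rTensor_tmul, rankOne_apply, TensorProduct.smul_tmul', smul_smul,
    inv_mul_cancel₀ hz0, one_smul] at h7

namespace PairAlgebra

variable {γ : Triality F V} {γ' : Triality F V'}

/-! ### Squares of the adjoint action of a pure tensor. -/

lemma sectorOp_comm (x : V) (x' : V') (t : V ⊗[F] V') :
    sectorOp γ' γ x' x (TensorProduct.comm F V V' t)
      = TensorProduct.comm F V V' (sectorOp γ γ' x x' t) := by
  induction t using TensorProduct.induction_on with
  | zero => simp
  | add a b ha hb => simp only [map_add, ha, hb]
  | tmul z z' =>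
    simp only [TensorProduct.comm_tmul, sectorOp_tmul, map_add, map_sub, map_smul]
    module

lemma rankOne_sub (x y v : V) :
    (γ.rankOne x y - γ.rankOne y x) v = γ.g x v • y - γ.g y v • x := rfl

lemma rot_apply_same {i : Fin 3} {x y z : V} (hx : x ∈ γ.comp i) (hy : y ∈ γ.comp i)
    (hz : z ∈ γ.comp i) : γ.rot x y z = (4 : F) • (γ.g x z • y - γ.g y z • x) := by
  rw [rot_apply, γ.mul_self_comp hx hz, γ.mul_self_comp hy hz, map_zero, map_zero, sub_zero,
    add_zero]

/-- On another sector the Clifford identity applies in both factors, and the sign comes from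
`cross_cross_of_mem`. On its own sector the product part is zero and only the two orthogonal
generators act. -/
lemma lie_lie_tens {i : Fin 3} {x : V} {x' : V'} (hx : x ∈ γ.comp i) (hx' : x' ∈ γ'.comp (i + 1))
    {j : Fin 3} {z : V} {z' : V'} (hz : z ∈ γ.comp j) (hz' : z' ∈ γ'.comp (j + 1)) :
    ⁅tens γ γ' (x ⊗ₜ x'), ⁅tens γ γ' (x ⊗ₜ x'), tens γ γ' (z ⊗ₜ z')⁆⁆
      = if i = j then (-4 : F) • tens γ γ' (sectorOp γ γ' x x' (z ⊗ₜ z'))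
        else - (γ.g x x * γ'.g x' x') • tens γ γ' (z ⊗ₜ z') := by
  -- A product with `x'` is orthogonal to `x'`, because multiplication is self-adjoint and `x' x' =
  -- 0`. Hence the double bracket of tensors has no part in the triality algebras.
  have hg' : γ'.g x' (γ'.mul x' z') = 0 := by
    rw [← γ'.g_mul_mul, γ'.mul_self_comp hx' hx', map_zero, LinearMap.zero_apply]
  have hg : γ.g x (γ.cross x z) = 0 := by
    have : γ.g x (γ.mul x z) = 0 := by
      rw [← γ.g_mul_mul, γ.mul_self_comp hx hx, map_zero, LinearMap.zero_apply]
    rw [γ.cross_of_mem hx hz]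
    split_ifs <;> simp [this]
  ext1
  · trans (0 : Module.End F V)
    · simp [up_lie, ten_lie, ten_tens_tmul hx hx', ten_tens_tmul hz hz', hg']
    · split_ifs <;> simp
  · trans (0 : Module.End F V')
    · simp [low_lie, ten_lie, ten_tens_tmul hx hx', ten_tens_tmul hz hz', hg]
    · split_ifs <;> simp
  · rw [ten_lie_lie_tens hx hx hx' hx']
    by_cases hij : i = j
    · subst hij
      have h0 : ∀ k, γ.mul x (γ.mul x (γ.proj k z)) ⊗ₜ[F]
          γ'.mul x' (γ'.mul x' (γ'.proj (k + 1) z')) = 0 := fun k => by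
        rw [γ.proj_of_mem hz]
        split_ifs
        · rw [γ.mul_self_comp hx hz, map_zero, TensorProduct.zero_tmul]
        · simp
      rw [if_pos rfl, sectorOp_tmul]
      simp only [TensorProduct.map_tmul, Module.End.mul_apply, LinearMap.flip_apply,
        LinearMap.smulRight_apply, γ.proj_self hz, γ'.proj_self hz', h0, Finset.sum_const_zero,
        map_smul, map_add, map_sub, ten_tens_tmul hz hx', ten_tens_tmul hx hz',
        ten_tens_tmul hx hx', rot_apply_same hx hz hx, rot_apply_same hx' hz' hx',
        TensorProduct.tmul_sub, TensorProduct.sub_tmul, TensorProduct.tmul_smul,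
        ← TensorProduct.smul_tmul', γ.g_symm z x, γ'.g_symm z' x']
      module
    · have hij' : i + 1 ≠ j + 1 := by simpa using hij
      have h1 := γ.mul_mul_self hij hx hz
      have h2 := γ'.mul_mul_self hij' hx' hz'
      rw [if_neg hij, Finset.sum_eq_single j]
      · simp [γ.proj_ne (Ne.symm hij) hz, γ'.proj_ne hij'.symm hz', γ.proj_self hz,
          γ'.proj_self hz', h1, h2, ten_tens_tmul hz hz', TensorProduct.smul_tmul', smul_smul]
        rw [mul_comm]
      · intro k _ hk
        simp [γ.proj_ne (Ne.symm hk) hz]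
      · simp

lemma sector_induction {i : Fin 3} {P : (t : V ⊗[F] V') → t ∈ sector γ γ' i → Prop}
    (h0 : P 0 (zero_mem _)) (hadd : ∀ a b ha hb, P a ha → P b hb → P (a + b) (add_mem ha hb))
    (h : ∀ x (hx : x ∈ γ.comp i) x' (hx' : x' ∈ γ'.comp (i + 1)),
      P (x ⊗ₜ x') (tmul_mem_sector γ γ' hx hx')) {t : V ⊗[F] V'}
    (ht : t ∈ sector γ γ' i) : P t ht := by
  obtain ⟨s, rfl⟩ := ht
  induction s using TensorProduct.induction_on with
  | zero => simpa using h0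
  | add a b ha hb => simp only [map_add]; exact hadd _ _ _ _ ha hb
  | tmul y y' => exact h y y.2 y' y'.2

lemma sectorOp_mem_sector {i : Fin 3} {x : V} {x' : V'} (hx : x ∈ γ.comp i)
    (hx' : x' ∈ γ'.comp (i + 1)) {t : V ⊗[F] V'} (ht : t ∈ sector γ γ' i) :
    sectorOp γ γ' x x' t ∈ sector γ γ' i := by
  induction ht using sector_induction with
  | h0 => rw [map_zero]; exact zero_mem _
  | hadd a b _ _ ha hb => rw [map_add]; exact add_mem ha hb
  | h z hz z' hz' =>
    rw [sectorOp_tmul]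
    exact sub_mem (add_mem (Submodule.smul_mem _ _ (tmul_mem_sector γ γ' hz hx'))
      (Submodule.smul_mem _ _ (tmul_mem_sector γ γ' hx hz')))
      (Submodule.smul_mem _ _ (tmul_mem_sector γ γ' hx hx'))

lemma lie_lie_tens_same {i : Fin 3} {x : V} {x' : V'} (hx : x ∈ γ.comp i)
    (hx' : x' ∈ γ'.comp (i + 1)) {t : V ⊗[F] V'} (ht : t ∈ sector γ γ' i) :
    ⁅tens γ γ' (x ⊗ₜ x'), ⁅tens γ γ' (x ⊗ₜ x'), tens γ γ' t⁆⁆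
      = (-4 : F) • tens γ γ' (sectorOp γ γ' x x' t) := by
  induction ht using sector_induction with
  | h0 => simp
  | hadd a b _ _ ha hb => rw [map_add, lie_add, lie_add, ha, hb, map_add, map_add, smul_add]
  | h z hz z' hz' => rw [lie_lie_tens hx hx' hz hz', if_pos rfl]

lemma algebra_apply_mem (p : γ.algebra) {i : Fin 3} {x : V} (hx : x ∈ γ.comp i) :
    (p : Module.End F V) x ∈ γ.comp i := p.2.1 i x hx

/-- The orthogonal generator, as an element of the triality algebra. -/
def rotGen {i : Fin 3} {x y : V} (hx : x ∈ γ.comp i) (hy : y ∈ γ.comp i) : γ.algebra :=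
  ⟨γ.rot x y, γ.rot_mem hx hy⟩

/-- As `p x` is orthogonal to `x`, the generator `R(x, p x)` takes `x` to `4 g(x,x) p x`. So `p ↦
R(x, p x)`, which is the square of the adjoint action up to a scalar, is proportional to an
idempotent when `x` is not isotropic. -/
lemma rotGen_rotGen {i : Fin 3} {x : V} (hx : x ∈ γ.comp i) (p : γ.algebra) :
    rotGen hx (algebra_apply_mem (rotGen hx (algebra_apply_mem p hx)) hx)
      = (4 * γ.g x x) • rotGen hx (algebra_apply_mem p hx) := by
  refine Subtype.ext ?_
  have h0 : γ.g ((p : Module.End F V) x) x = 0 := γ.g_algebra_self p.2 x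
  change γ.rot x (γ.rot x ((p : Module.End F V) x) x)
    = (4 * γ.g x x) • γ.rot x ((p : Module.End F V) x)
  rw [rot_apply_same hx (algebra_apply_mem p hx) hx, h0, zero_smul, sub_zero, map_smul, map_smul,
    smul_smul]

lemma lie_lie_inUp {i : Fin 3} {x : V} {x' : V'} (hx : x ∈ γ.comp i)
    (hx' : x' ∈ γ'.comp (i + 1)) (p : γ.algebra) :
    ⁅tens γ γ' (x ⊗ₜ x'), ⁅tens γ γ' (x ⊗ₜ x'), inUp γ γ' p⁆⁆
      = - γ'.g x' x' • inUp γ γ' (rotGen hx (algebra_apply_mem p hx)) := by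
  have h0 : (⟨γ'.rot x' x', γ'.rot_mem hx' hx'⟩ : γ'.algebra) = 0 := Subtype.ext (γ'.rot_self x')
  have h1 := lie_skew (tens γ γ' (x ⊗ₜ[F] x')) (inUp γ γ' p)
  rw [← h1, lie_inUp_tens p hx hx', lie_neg,
    lie_tens_tens_same hx (algebra_apply_mem p hx) hx' hx', h0, map_zero, smul_zero, add_zero,
    neg_smul]
  rfl

lemma lie_lie_inLow {i : Fin 3} {x : V} {x' : V'} (hx : x ∈ γ.comp i)
    (hx' : x' ∈ γ'.comp (i + 1)) (p : γ'.algebra) :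
    ⁅tens γ γ' (x ⊗ₜ x'), ⁅tens γ γ' (x ⊗ₜ x'), inLow γ γ' p⁆⁆
      = - γ.g x x • inLow γ γ' (rotGen hx' (algebra_apply_mem p hx')) := by
  have h0 : (⟨γ.rot x x, γ.rot_mem hx hx⟩ : γ.algebra) = 0 := Subtype.ext (γ.rot_self x)
  have h1 := lie_skew (tens γ γ' (x ⊗ₜ[F] x')) (inLow γ γ' p)
  rw [← h1, lie_inLow_tens p hx hx', lie_neg,
    lie_tens_tens_same hx hx hx' (algebra_apply_mem p hx'), h0, map_zero, smul_zero, zero_add,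
    neg_smul]
  rfl

/-! ### A polynomial in the adjoint action which separates the sectors. -/

/-- `(ad X)⁴ + c (ad X)²`. -/
def adQuartic (c : F) (X : PairAlgebra γ γ') : Module.End F (PairAlgebra γ γ') :=
  LieAlgebra.ad F _ X * LieAlgebra.ad F _ X * (LieAlgebra.ad F _ X * LieAlgebra.ad F _ X)
    + c • (LieAlgebra.ad F _ X * LieAlgebra.ad F _ X)

lemma adQuartic_apply (c : F) (X v : PairAlgebra γ γ') :
    adQuartic c X v = ⁅X, ⁅X, ⁅X, ⁅X, v⁆⁆⁆⁆ + c • ⁅X, ⁅X, v⁆⁆ := rfl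

/-- A polynomial in `ad (x ⊗ x')` is a multiple of the projection onto the other two sectors. -/
lemma adQuartic_tens {i : Fin 3} {x : V} {x' : V'} (hx : x ∈ γ.comp i)
    (hx' : x' ∈ γ'.comp (i + 1)) (v : PairAlgebra γ γ') :
    adQuartic (4 * (γ.g x x * γ'.g x' x')) (tens γ γ' (x ⊗ₜ x')) v
      = (-3 * (γ.g x x * γ'.g x' x') ^ 2) • tens γ γ' (ten v - secProj γ γ' i (ten v)) := by
  -- With `N = g(x,x) g'(x',x')`, the coefficient `4N` is chosen because `(ad X)⁴ = -4N (ad X)²` on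
  -- both triality algebras and on the sector of `X`. On the other sectors `(ad X)² = -N`, which
  -- leaves `N² - 4N² = -3N²`.
  have hup : ∀ p, adQuartic (4 * (γ.g x x * γ'.g x' x')) (tens γ γ' (x ⊗ₜ x')) (inUp γ γ' p)
      = 0 := by
    intro p
    rw [adQuartic_apply, lie_lie_inUp hx hx', lie_smul, lie_smul, lie_lie_inUp hx hx',
      rotGen_rotGen, map_smul]
    module
  have hlow : ∀ p, adQuartic (4 * (γ.g x x * γ'.g x' x')) (tens γ γ' (x ⊗ₜ x')) (inLow γ γ' p)
      = 0 := by
    intro p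
    rw [adQuartic_apply, lie_lie_inLow hx hx', lie_smul, lie_smul, lie_lie_inLow hx hx',
      rotGen_rotGen, map_smul]
    module
  have hten : ∀ t ∈ tensorSpace γ γ',
      adQuartic (4 * (γ.g x x * γ'.g x' x')) (tens γ γ' (x ⊗ₜ x')) (tens γ γ' t)
      = (-3 * (γ.g x x * γ'.g x' x') ^ 2) • tens γ γ' (t - secProj γ γ' i t) := by
    intro t ht
    induction ht using tensorSpace_induction with
    | h0 => simp
    | hadd a b _ _ ha hb =>
      rw [map_add, map_add, ha, hb, ← smul_add, ← map_add,
        map_add (secProj γ γ' i), add_sub_add_comm]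
    | h j z hz z' hz' =>
      rw [adQuartic_apply]
      by_cases hij : i = j
      · subst hij
        have hz2 := tmul_mem_sector γ γ' hz hz'
        rw [lie_lie_tens_same hx hx' hz2, lie_smul, lie_smul,
          lie_lie_tens_same hx hx' (sectorOp_mem_sector hx hx' hz2), sectorOp_sectorOp,
          secProj_tmul, γ.proj_self hz, γ'.proj_self hz', sub_self, map_zero, smul_zero, map_smul]
        module
      · rw [lie_lie_tens hx hx' hz hz', if_neg hij, lie_smul, lie_smul,
          lie_lie_tens hx hx' hz hz', if_neg hij, secProj_tmul, γ.proj_ne (Ne.symm hij) hz,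
          TensorProduct.zero_tmul, sub_zero]
        module
  conv_lhs => rw [eq_add v]
  rw [map_add, map_add, hup, hlow, hten _ (ten_mem v), zero_add, zero_add]

lemma adQuartic_mem (I : LieIdeal F (PairAlgebra γ γ')) (c : F) (X : PairAlgebra γ γ')
    {v : PairAlgebra γ γ'} (hv : v ∈ I) : adQuartic c X v ∈ I := by
  rw [adQuartic_apply]
  have h : ∀ w ∈ I, ⁅X, w⁆ ∈ I := fun w hw => I.lie_mem hw
  exact add_mem (h _ (h _ (h _ (h _ hv)))) (I.smul_mem c (h _ (h _ hv)))

variable {n n' : ℕ} (hγ : γ.HasDim n) (hγ' : γ'.HasDim n') (hn : n ≠ 0) (hn' : n' ≠ 0)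
  (I : LieIdeal F (PairAlgebra γ γ'))

include hγ hγ' hn hn'

/-- A non-isotropic tensor in `W_i` makes `adQuartic` a non-zero multiple of the projection onto the
other two sectors. Over the three values of `i` each sector is retained twice, so half the sum is
the full tensor part, and differences are the single components. -/
lemma tens_secProj_mem {v : PairAlgebra γ γ'} (hv : v ∈ I) (i : Fin 3) :
    tens γ γ' (secProj γ γ' i (ten v)) ∈ I := by
  have h : ∀ i, tens γ γ' (ten v - secProj γ γ' i (ten v)) ∈ I := by
    intro i
    obtain ⟨x, hx, hx0⟩ := γ.exists_g_self_ne_zero hγ hn i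
    obtain ⟨x', hx', hx0'⟩ := γ'.exists_g_self_ne_zero hγ' hn' (i + 1)
    have h3 := I.smul_mem (-3 * (γ.g x x * γ'.g x' x') ^ 2)⁻¹ (adQuartic_tens hx hx' v ▸
      adQuartic_mem I (4 * (γ.g x x * γ'.g x' x')) (tens γ γ' (x ⊗ₜ x')) hv)
    rwa [smul_smul, inv_mul_cancel₀, one_smul] at h3
    simp [hx0, hx0']
  have h4 : tens γ γ' (ten v) ∈ I := by
    have h5 := I.smul_mem (2 : F)⁻¹ (sum_mem fun i (_ : i ∈ Finset.univ) => h i)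
    rw [← map_sum, Finset.sum_sub_distrib, sum_secProj γ γ' (ten_mem v)] at h5
    have h6 : (2 : F)⁻¹ • tens γ γ' (∑ i : Fin 3, ten v - ten v) = tens γ γ' (ten v) := by
      rw [← map_smul]
      congr 1
      simp only [Finset.sum_const, Finset.card_univ, Fintype.card_fin]
      module
    rwa [h6] at h5
  have h7 := sub_mem h4 (h i)
  rwa [map_sub, sub_sub_cancel] at h7

omit hγ hγ' hn hn' in
lemma lie_mem_of_mem_left {a b : PairAlgebra γ γ'} (hb : b ∈ I) : ⁅a, b⁆ ∈ I := I.lie_mem hb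

/-- An ideal which meets the tensor sectors trivially vanishes. -/
lemma eq_zero_of_mem (h : ∀ i, ∀ t ∈ sector γ γ' i, tens γ γ' t ∈ I → t = 0)
    {v : PairAlgebra γ γ'} (hv : v ∈ I) : v = 0 := by
  have hten : ∀ w ∈ I, ten w = 0 := fun w hw => by
    rw [← sum_secProj γ γ' (ten_mem w)]
    exact Finset.sum_eq_zero fun i _ => h i _ (secProj_mem γ γ' i _)
      (tens_secProj_mem hγ hγ' hn hn' I hw i)
  -- Elements of the ideal have no tensor part. The bracket of `v` with `x ⊗ x'` is again in the
  -- ideal, so its tensor part, the action of `v` on `x ⊗ x'` up to sign, vanishes.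
  have h1 : ∀ {i : Fin 3} {x : V} {x' : V'}, x ∈ γ.comp i → x' ∈ γ'.comp (i + 1) →
      up v x ⊗ₜ[F] x' + x ⊗ₜ[F] low v x' = 0 := by
    intro i x x' hx hx'
    have h2 := hten _ (lie_mem_of_mem_left I (a := tens γ γ' (x ⊗ₜ x')) hv)
    rw [ten_lie, hten v hv, ten_tens_tmul hx hx'] at h2
    have h3 : -(up v x ⊗ₜ[F] x' + x ⊗ₜ[F] low v x') = 0 := by simpa using h2
    exact neg_eq_zero.1 h3
  have h2 : ∀ {i : Fin 3} {x : V} {x' : V'}, x ∈ γ.comp i → x' ∈ γ'.comp (i + 1) →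
      ∀ y y', γ.g (up v x) y * γ'.g x' y' + γ.g x y * γ'.g (low v x') y' = 0 := by
    intro i x x' hx hx' y y'
    have := congrArg (fun t : V ⊗[F] V' => (γ.g.tmul γ'.g) t (y ⊗ₜ[F] y')) (h1 hx hx')
    simpa [mul_comm] using this
  ext1
  · refine γ.hom_ext_comp fun i x hx => γ.g_ext fun y => ?_
    -- Pairing the second factor with `x'` itself removes the lower term, since `g'(q x', x') = 0`
    -- for a skew `q`.
    obtain ⟨x', hx', h0⟩ := γ'.exists_g_self_ne_zero hγ' hn' (i + 1)
    have h3 := h2 hx hx' y x'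
    rw [γ'.g_algebra_self (low_mem v), mul_zero, add_zero] at h3
    simpa using (mul_eq_zero.1 h3).resolve_right h0
  · refine γ'.hom_ext_comp fun i x' hx' => γ'.g_ext fun y' => ?_
    obtain ⟨i, rfl⟩ : ∃ k : Fin 3, i = k + 1 := ⟨i - 1, by simp⟩
    obtain ⟨x, hx, h0⟩ := γ.exists_g_self_ne_zero hγ hn i
    have h3 := h2 hx hx' x y'
    rw [γ.g_algebra_self (up_mem v), zero_mul, zero_add] at h3
    simpa using (mul_eq_zero.1 h3).resolve_left h0
  · rw [hten v hv, map_zero]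

/-! ### Ideals and their intersections with the sectors. -/

/-- The tensors of the sector `V_i ⊗ V'_{i+1}` which belong to an ideal. -/
def sectorInter (i : Fin 3) : Submodule F (V ⊗[F] V') :=
  sector γ γ' i ⊓ I.toSubmodule.comap (tens γ γ')

omit hγ hγ' hn hn' in
lemma sectorOp_mem {i : Fin 3} {x : V} {x' : V'} (hx : x ∈ γ.comp i)
    (hx' : x' ∈ γ'.comp (i + 1)) {t : V ⊗[F] V'} (ht : t ∈ sectorInter I i) :
    sectorOp γ γ' x x' t ∈ sectorInter I i := by
  refine ⟨sectorOp_mem_sector hx hx' ht.1, ?_⟩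
  have h4 : (-4 : F) • tens γ γ' (sectorOp γ γ' x x' t) ∈ I :=
    lie_lie_tens_same hx hx' ht.1 ▸ lie_mem_of_mem_left I (lie_mem_of_mem_left I ht.2)
  have h5 := I.smul_mem (-4 : F)⁻¹ h4
  rwa [smul_smul, inv_mul_cancel₀ (by norm_num), one_smul] at h5

omit hγ hγ' hn hn' in
lemma rTensor_mem_sectorInter {i : Fin 3} {x y : V} (hx : x ∈ γ.comp i) (hy : y ∈ γ.comp i)
    {t : V ⊗[F] V'} (ht : t ∈ sectorInter I i) :
    (γ.rankOne x y - γ.rankOne y x).rTensor V' t ∈ sectorInter I i := by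
  have h1 : ∀ t ∈ sector γ γ' i,
      (γ.rankOne x y - γ.rankOne y x).rTensor V' t ∈ sector γ γ' i ∧
      ⁅inUp γ γ' ⟨γ.rot x y, γ.rot_mem hx hy⟩, tens γ γ' t⁆
        = (4 : F) • tens γ γ' ((γ.rankOne x y - γ.rankOne y x).rTensor V' t) := by
    intro t ht
    induction ht using sector_induction with
    | h0 => simp
    | hadd a b _ _ ha hb =>
      simp only [map_add, smul_add, lie_add, ha.2, hb.2, and_true]
      exact add_mem ha.1 hb.1
    | h z hz z' hz' =>
      refine ⟨tmul_mem_sector γ γ' (sub_mem (Submodule.smul_mem _ _ hy)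
        (Submodule.smul_mem _ _ hx)) hz', ?_⟩
      rw [lie_inUp_tens _ hz hz', ← map_smul, LinearMap.rTensor_tmul, TensorProduct.smul_tmul',
        rankOne_sub, ← rot_apply_same hx hy hz]
  obtain ⟨h2, h3⟩ := h1 t ht.1
  refine ⟨h2, ?_⟩
  have h4 : (4 : F) • tens γ γ' ((γ.rankOne x y - γ.rankOne y x).rTensor V' t) ∈ I :=
    h3 ▸ lie_mem_of_mem_left I ht.2
  have h5 := I.smul_mem (4 : F)⁻¹ h4
  rwa [smul_smul, inv_mul_cancel₀ (by norm_num), one_smul] at h5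

omit hγ hγ' hn hn' in
lemma lTensor_mem_sectorInter {i : Fin 3} {x y : V'} (hx : x ∈ γ'.comp (i + 1))
    (hy : y ∈ γ'.comp (i + 1)) {t : V ⊗[F] V'} (ht : t ∈ sectorInter I i) :
    (γ'.rankOne x y - γ'.rankOne y x).lTensor V t ∈ sectorInter I i := by
  have h1 : ∀ t ∈ sector γ γ' i,
      (γ'.rankOne x y - γ'.rankOne y x).lTensor V t ∈ sector γ γ' i ∧
      ⁅inLow γ γ' ⟨γ'.rot x y, γ'.rot_mem hx hy⟩, tens γ γ' t⁆
        = (4 : F) • tens γ γ' ((γ'.rankOne x y - γ'.rankOne y x).lTensor V t) := by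
    intro t ht
    induction ht using sector_induction with
    | h0 => simp
    | hadd a b _ _ ha hb =>
      simp only [map_add, smul_add, lie_add, ha.2, hb.2, and_true]
      exact add_mem ha.1 hb.1
    | h z hz z' hz' =>
      refine ⟨tmul_mem_sector γ γ' hz (sub_mem (Submodule.smul_mem _ _ hy)
        (Submodule.smul_mem _ _ hx)), ?_⟩
      rw [lie_inLow_tens _ hz hz', ← map_smul, LinearMap.lTensor_tmul, ← TensorProduct.tmul_smul,
        rankOne_sub, ← rot_apply_same hx hy hz']
  obtain ⟨h2, h3⟩ := h1 t ht.1
  refine ⟨h2, ?_⟩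
  have h4 : (4 : F) • tens γ γ' ((γ'.rankOne x y - γ'.rankOne y x).lTensor V t) ∈ I :=
    h3 ▸ lie_mem_of_mem_left I ht.2
  have h5 := I.smul_mem (4 : F)⁻¹ h4
  rwa [smul_smul, inv_mul_cancel₀ (by norm_num), one_smul] at h5

/-- `tmul_mem_of_stable` needs only one factor of dimension other than two; if this is the lower
one, the two tensor factors are exchanged. -/
lemma tmul_mem_sectorInter (h22 : ¬ (n = 2 ∧ n' = 2)) {i : Fin 3} (hne : sectorInter I i ≠ ⊥)
    {z : V} {z' : V'} (hz : z ∈ γ.comp i) (hz' : z' ∈ γ'.comp (i + 1)) :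
    z ⊗ₜ z' ∈ sectorInter I i := by
  by_cases h2 : n = 2
  · have h2' : n' ≠ 2 := fun h => h22 ⟨h2, h⟩
    let J := (sectorInter I i).map (TensorProduct.comm F V V').toLinearMap
    have key := tmul_mem_of_stable γ' γ hγ' hn' h2' (i + 1) i J ?_ ?_ ?_ ?_ hz' hz
    · obtain ⟨t, ht, e⟩ := key
      have : t = z ⊗ₜ z' := (TensorProduct.comm F V V').injective e
      exact this ▸ ht
    · rintro _ ⟨t, ⟨ht, -⟩, rfl⟩
      induction ht using sector_induction with
      | h0 => rw [map_zero]; exact zero_mem _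
      | hadd a b _ _ ha hb => rw [map_add]; exact add_mem ha hb
      | h z hz z' hz' => exact ⟨⟨z', hz'⟩ ⊗ₜ ⟨z, hz⟩, rfl⟩
    · rintro x hx y hy _ ⟨t, ht, rfl⟩
      refine ⟨_, lTensor_mem_sectorInter I hx hy ht, ?_⟩
      clear ht
      induction t using TensorProduct.induction_on with
      | zero => simp
      | add a b ha hb => simp only [map_add, ha, hb]
      | tmul y y' => rfl
    · rintro x' hx' x hx _ ⟨t, ht, rfl⟩
      exact ⟨_, sectorOp_mem I hx hx' ht, (sectorOp_comm x x' t).symm⟩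
    · exact fun h => hne ((Submodule.map_eq_bot_iff (e := TensorProduct.comm F V V')).1 h)
  · exact tmul_mem_of_stable γ γ' hγ hn h2 i (i + 1) (sectorInter I i) inf_le_left
      (fun x hx y hy t ht => rTensor_mem_sectorInter I hx hy ht)
      (fun x hx x' hx' t ht => sectorOp_mem I hx hx' ht) hne hz hz'

/-- The product of non-isotropic pure tensors of `W_i` and `W_{i+1}` is a non-zero element of
`W_{i+2}`, because norms are multiplicative in both trialities. -/
lemma sectorInter_add_two_ne_bot {i : Fin 3}
    (h : ∀ z ∈ γ.comp i, ∀ z' ∈ γ'.comp (i + 1), z ⊗ₜ z' ∈ sectorInter I i) :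
    sectorInter I (i + 2) ≠ ⊥ := by
  obtain ⟨x, hx, hx0⟩ := γ.exists_g_self_ne_zero hγ hn i
  obtain ⟨x', hx', hx0'⟩ := γ'.exists_g_self_ne_zero hγ' hn' (i + 1)
  obtain ⟨y, hy, hy0⟩ := γ.exists_g_self_ne_zero hγ hn (i + 1)
  obtain ⟨y', hy', hy0'⟩ := γ'.exists_g_self_ne_zero hγ' hn' (i + 1 + 1)
  have hxy := γ.mul_mem (r := i + 2) (by omega) (by omega) hx hy
  have hxy' := γ'.mul_mem (r := i + 2 + 1) (by omega) (by omega) hx' hy'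
  have h1 : ⁅tens γ γ' (x ⊗ₜ x'), tens γ γ' (y ⊗ₜ y')⁆
      = tens γ γ' (γ.mul x y ⊗ₜ γ'.mul x' y') := by
    ext1
    · simp [up_lie, ten_tens_tmul hx hx', ten_tens_tmul hy hy',
        γ'.comp_orth (i + 1) (i + 1 + 1) (by omega) x' hx' y' hy']
    · simp [low_lie, ten_tens_tmul hx hx', ten_tens_tmul hy hy',
        γ.comp_orth i (i + 1) (by omega) x hx y hy]
    · simp [ten_lie, ten_tens_tmul hx hx', ten_tens_tmul hy hy', ten_tens_tmul hxy hxy',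
        γ.cross_of_mem hx hy]
  refine (Submodule.ne_bot_iff _).2 ⟨γ.mul x y ⊗ₜ γ'.mul x' y', ⟨tmul_mem_sector γ γ' hxy hxy', ?_⟩,
    fun h => ?_⟩
  · change tens γ γ' _ ∈ I
    rw [← h1, ← lie_skew]
    exact neg_mem (lie_mem_of_mem_left I (h x hx x' hx').2)
  · have h2 : (γ.g.tmul γ'.g) (γ.mul x y ⊗ₜ γ'.mul x' y') (γ.mul x y ⊗ₜ γ'.mul x' y') ≠ 0 := by
      rw [LinearMap.BilinForm.tensorDistrib_tmul, γ.g_mul_self (by omega) hx hy,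
        γ'.g_mul_self (by omega) hx' hy']
      simp [hx0, hx0', hy0, hy0']
    exact h2 (by rw [h, map_zero])

/-- An ideal that meets one sector contains it, and in steps of two all three; brackets of tensors
with a common non-isotropic factor then give all orthogonal generators. An ideal that meets no
sector is zero by `eq_zero_of_mem`. -/
theorem isSimple (h22 : ¬ (n = 2 ∧ n' = 2)) : LieAlgebra.IsSimple F (PairAlgebra γ γ') := by
  refine ⟨fun I => ?_, fun hab => ?_⟩
  · by_cases hI : ∃ i, sectorInter I i ≠ ⊥
    · right
      obtain ⟨i, hi⟩ := hI
      have hfull : ∀ i, sectorInter I i ≠ ⊥ →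
          ∀ z ∈ γ.comp i, ∀ z' ∈ γ'.comp (i + 1), z ⊗ₜ z' ∈ sectorInter I i :=
        fun i hi z hz z' hz' => tmul_mem_sectorInter hγ hγ' hn hn' I h22 hi hz hz'
      have hstep : ∀ i, sectorInter I i ≠ ⊥ → sectorInter I (i + 2) ≠ ⊥ := fun i hi =>
        sectorInter_add_two_ne_bot hγ hγ' hn hn' I (hfull i hi)
      have hall : ∀ j, sectorInter I j ≠ ⊥ := by
        intro j
        have h1 := hstep i hi
        have h2 := hstep _ h1
        have : j = i ∨ j = i + 2 ∨ j = i + 2 + 2 := by omega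
        rcases this with rfl | rfl | rfl <;> assumption
      have ht : ∀ t ∈ tensorSpace γ γ', tens γ γ' t ∈ I := by
        intro t ht
        induction ht using tensorSpace_induction with
        | h0 => simp
        | hadd a b _ _ ha hb => rw [map_add]; exact add_mem ha hb
        | h j x hx x' hx' => exact (hfull j (hall j) x hx x' hx').2
      have hup : I.toSubmodule.comap (inUp γ γ') = ⊤ := by
        refine γ.algebra_submodule_eq_top hγ fun i x hx y hy => ?_
        obtain ⟨x', hx', h0⟩ := γ'.exists_g_self_ne_zero hγ' hn' (i + 1)
        have h1 : ⁅tens γ γ' (x ⊗ₜ x'), tens γ γ' (y ⊗ₜ x')⁆ ∈ I :=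
          lie_mem_of_mem_left I (ht _ (sector_le γ γ' i (tmul_mem_sector γ γ' hy hx')))
        have h2 : (⟨γ'.rot x' x', γ'.rot_mem hx' hx'⟩ : γ'.algebra) = 0 :=
          Subtype.ext (γ'.rot_self x')
        rw [lie_tens_tens_same hx hy hx' hx', h2, map_zero, smul_zero, add_zero] at h1
        have h3 := I.smul_mem (γ'.g x' x')⁻¹ h1
        rwa [smul_smul, inv_mul_cancel₀ h0, one_smul] at h3
      have hlow : I.toSubmodule.comap (inLow γ γ') = ⊤ := by
        refine γ'.algebra_submodule_eq_top hγ' fun i x' hx' y' hy' => ?_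
        obtain ⟨i, rfl⟩ : ∃ k : Fin 3, i = k + 1 := ⟨i - 1, by simp⟩
        obtain ⟨x, hx, h0⟩ := γ.exists_g_self_ne_zero hγ hn i
        have h1 : ⁅tens γ γ' (x ⊗ₜ x'), tens γ γ' (x ⊗ₜ y')⁆ ∈ I :=
          lie_mem_of_mem_left I (ht _ (sector_le γ γ' i (tmul_mem_sector γ γ' hx hy')))
        have h2 : (⟨γ.rot x x, γ.rot_mem hx hx⟩ : γ.algebra) = 0 := Subtype.ext (γ.rot_self x)
        rw [lie_tens_tens_same hx hx hx' hy', h2, map_zero, smul_zero, zero_add] at h1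
        have h3 := I.smul_mem (γ.g x x)⁻¹ h1
        rwa [smul_smul, inv_mul_cancel₀ h0, one_smul] at h3
      refine (LieSubmodule.toSubmodule_eq_top I).1 (Submodule.eq_top_iff'.2 fun v => ?_)
      rw [eq_add v]
      exact add_mem (add_mem
        (hup ▸ Submodule.mem_top : upPart v ∈ I.toSubmodule.comap (inUp γ γ'))
        (hlow ▸ Submodule.mem_top : lowPart v ∈ I.toSubmodule.comap (inLow γ γ')))
        (ht _ (ten_mem v))
    · left
      push Not at hI
      refine (LieSubmodule.eq_bot_iff I).2 fun v hv => ?_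
      refine eq_zero_of_mem hγ hγ' hn hn' I (fun i t ht htI => ?_) hv
      exact (Submodule.mem_bot F).1 (hI i ▸ (⟨ht, htI⟩ : t ∈ sectorInter I i))
  -- The algebra is not abelian, since its Killing form does not vanish on a non-isotropic pure
  -- tensor.
  · obtain ⟨x, hx, h0⟩ := γ.exists_g_self_ne_zero hγ hn 0
    obtain ⟨x', hx', h0'⟩ := γ'.exists_g_self_ne_zero hγ' hn' (0 + 1)
    have h1 := killingForm_tens hγ hγ' hx hx hx' hx'
    have h2 : LieAlgebra.ad F _ (tens γ γ' (x ⊗ₜ x')) = 0 := LinearMap.ext fun v => hab.trivial _ v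
    rw [killingForm_apply_apply, h2, LinearMap.zero_comp, map_zero] at h1
    exact mul_ne_zero (killingFactor_ne_zero hn hn') (mul_ne_zero h0 h0') h1.symm

end PairAlgebra

end Triality

end Simplicity

/-! ### Splittings of trialities of dimension two -/

section Splitting

namespace Triality

/-- Isotropic coordinates on a triality, with values in an extension field: two functionals `ξ, η`
such that `g(x, x) = ξ(x) η(x)` on each of the three subspaces, with `ξ(xy) = η(x) η(y)` and
`η(xy) = ξ(x) ξ(y)`. -/
structure Splitting {F : Type u} {V : Type v} [Field F] [AddCommGroup V] [Module F V]
    [FiniteDimensional F V] (γ : Triality F V) (K : Type*) [Field K] [Algebra F K] where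
  /-- the first coordinate -/
  ξ : V →ₗ[F] K
  /-- the second coordinate -/
  η : V →ₗ[F] K
  g_eq : ∀ i, ∀ x ∈ γ.comp i, ∀ y ∈ γ.comp i,
    2 * algebraMap F K (γ.g x y) = ξ x * η y + η x * ξ y
  ξ_mul : ∀ i j, i ≠ j → ∀ x ∈ γ.comp i, ∀ y ∈ γ.comp j, ξ (γ.mul x y) = η x * η y
  η_mul : ∀ i j, i ≠ j → ∀ x ∈ γ.comp i, ∀ y ∈ γ.comp j, η (γ.mul x y) = ξ x * ξ y
  /-- a non-isotropic vector in each subspace -/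
  base : Fin 3 → V
  base_mem : ∀ i, base i ∈ γ.comp i
  g_base : ∀ i, γ.g (base i) (base i) ≠ 0

variable {F : Type u} {V : Type v} {V' : Type w} [Field F] [CharZero F]
  [AddCommGroup V] [Module F V] [FiniteDimensional F V]
  [AddCommGroup V'] [Module F V'] [FiniteDimensional F V']
  {K : Type*} [Field K] [Algebra F K]

lemma exists_eq_of_orthogonal_pair (γ : Triality F V) (hγ : γ.HasDim 2) {i : Fin 3} {u v : V}
    (hu : u ∈ γ.comp i) (hv : v ∈ γ.comp i) (huv : γ.g u v = 0) (hu0 : γ.g u u ≠ 0)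
    (hv0 : γ.g v v ≠ 0) {x : V} (hx : x ∈ γ.comp i) : ∃ a b : F, a • u + b • v = x := by
  have hli : LinearIndependent F ![u, v] := by
    refine LinearIndependent.pair_iff.2 fun a b hab => ⟨?_, ?_⟩
    · have := congrArg (γ.g u) hab
      simpa [huv, hu0] using this
    · have := congrArg (γ.g v) hab
      simpa [γ.g_symm v u, huv, hv0] using this
  have hle : Submodule.span F {u, v} ≤ γ.comp i := by
    refine Submodule.span_le.2 ?_
    rintro _ (rfl | rfl)
    · exact hu
    · exact hv
  have hfin : Module.finrank F (Submodule.span F {u, v}) = 2 := by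
    have := finrank_span_eq_card hli
    rwa [Matrix.range_cons_cons_empty, Fintype.card_fin] at this
  have heq := Submodule.eq_of_le_of_finrank_eq hle (by rw [hfin, hγ i])
  exact Submodule.mem_span_pair.1 (heq ▸ hx)

lemma bilin_eq_of_pairs {M : Type*} [AddCommGroup M] [Module F M] {C C' : Submodule F V}
    {u₁ u₂ v₁ v₂ : V} (hC : ∀ x ∈ C, ∃ a b : F, a • u₁ + b • u₂ = x)
    (hC' : ∀ x ∈ C', ∃ a b : F, a • v₁ + b • v₂ = x) (B B' : V →ₗ[F] V →ₗ[F] M)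
    (h11 : B u₁ v₁ = B' u₁ v₁) (h12 : B u₁ v₂ = B' u₁ v₂) (h21 : B u₂ v₁ = B' u₂ v₁)
    (h22 : B u₂ v₂ = B' u₂ v₂) : ∀ x ∈ C, ∀ y ∈ C', B x y = B' x y := by
  intro x hx y hy
  obtain ⟨a, b, rfl⟩ := hC x hx
  obtain ⟨c, d, rfl⟩ := hC' y hy
  simp only [map_add, map_smul, LinearMap.add_apply, LinearMap.smul_apply, h11, h12, h21, h22]

/-- A triality of dimension two splits over every algebraically closed extension field. -/
lemma exists_splitting [IsAlgClosed K] (γ : Triality F V) (hγ : γ.HasDim 2) :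
    Nonempty (Splitting γ K) := by
  obtain ⟨x₀, hx₀, gx₀⟩ := γ.exists_g_self_ne_zero hγ two_ne_zero 0
  obtain ⟨z, hz, hzo, gz, -⟩ := γ.exists_orthogonal_family hγ 2
  obtain ⟨z₀, hz₀, gz₀⟩ : ∃ z₀, z₀ = z 0 ∧ γ.g z₀ z₀ ≠ 0 := ⟨z 0, rfl, gz 0⟩
  obtain ⟨z₁, hz₁, gz₁⟩ : ∃ z₁, z₁ = z 1 ∧ γ.g z₁ z₁ ≠ 0 := ⟨z 1, rfl, gz 1⟩
  have g01 : γ.g z₀ z₁ = 0 := by rw [hz₀, hz₁]; exact hzo 0 1 (by simp)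
  replace hz₀ : z₀ ∈ γ.comp 2 := hz₀ ▸ hz 0
  replace hz₁ : z₁ ∈ γ.comp 2 := hz₁ ▸ hz 1
  have m02 : (0 : Fin 3) ≠ 2 := by decide
  have m12 : (1 : Fin 3) ≠ 2 := by decide
  have m01 : (0 : Fin 3) ≠ 1 := by decide
  -- By the Clifford identity this is the vector of `V_1` with `x₀ x₁ = z₀`.
  obtain ⟨x₁, rfl⟩ : ∃ x₁, x₁ = (γ.g x₀ x₀)⁻¹ • γ.mul x₀ z₀ := ⟨_, rfl⟩
  set x₁ := (γ.g x₀ x₀)⁻¹ • γ.mul x₀ z₀ with hx₁_def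
  have hx₁ : x₁ ∈ γ.comp 1 := Submodule.smul_mem _ _ (γ.mul_mem (by decide) (by decide) hx₀ hz₀)
  have p01 : γ.mul x₀ x₁ = z₀ := by
    rw [hx₁_def, map_smul, γ.mul_mul_self m02 hx₀ hz₀, smul_smul, inv_mul_cancel₀ gx₀, one_smul]
  have gz₀' : γ.g z₀ z₀ = γ.g x₀ x₀ * γ.g x₁ x₁ := by rw [← p01, γ.g_mul_self m01 hx₀ hx₁]
  have gx₁ : γ.g x₁ x₁ ≠ 0 := fun h => gz₀ (by rw [gz₀', h, mul_zero])
  clear_value x₁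
  -- The products `x₁ z₁` and `x₀ z₁` complete `x₀` and `x₁` to orthogonal bases of `V_0` and `V_1`;
  -- with `z₀, z₁` in `V_2` the whole multiplication table is determined by the norms of `x₀`, `x₁`
  -- and `z₁`.
  obtain ⟨w₀, hw₀_def⟩ : ∃ w₀, w₀ = γ.mul x₁ z₁ := ⟨_, rfl⟩
  obtain ⟨w₁, hw₁_def⟩ : ∃ w₁, w₁ = γ.mul x₀ z₁ := ⟨_, rfl⟩
  have hw₀ : w₀ ∈ γ.comp 0 := hw₀_def ▸ γ.mul_mem (by decide) (by decide) hx₁ hz₁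
  have hw₁ : w₁ ∈ γ.comp 1 := hw₁_def ▸ γ.mul_mem (by decide) (by decide) hx₀ hz₁
  have gw₀ : γ.g w₀ w₀ = γ.g x₁ x₁ * γ.g z₁ z₁ := by rw [hw₀_def, γ.g_mul_self m12 hx₁ hz₁]
  have gw₁ : γ.g w₁ w₁ = γ.g x₀ x₀ * γ.g z₁ z₁ := by rw [hw₁_def, γ.g_mul_self m02 hx₀ hz₁]
  have g0 : γ.g x₀ w₀ = 0 := by rw [hw₀_def, ← γ.g_mul_mul, γ.mul_comm', p01, g01]
  have g1 : γ.g x₁ w₁ = 0 := by rw [hw₁_def, ← γ.g_mul_mul, p01, g01]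
  -- the multiplication table
  have p0w : γ.mul x₀ w₁ = γ.g x₀ x₀ • z₁ := by rw [hw₁_def, γ.mul_mul_self m02 hx₀ hz₁]
  have pw1 : γ.mul w₀ x₁ = γ.g x₁ x₁ • z₁ := by
    rw [γ.mul_comm', hw₀_def, γ.mul_mul_self m12 hx₁ hz₁]
  have p00 : γ.mul x₀ z₀ = γ.g x₀ x₀ • x₁ := by rw [← p01, γ.mul_mul_self m01 hx₀ hx₁]
  have p10 : γ.mul x₁ z₀ = γ.g x₁ x₁ • x₀ := by
    rw [← p01, γ.mul_comm' x₀, γ.mul_mul_self m01.symm hx₁ hx₀]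
  have pw0z1 : γ.mul w₀ z₁ = γ.g z₁ z₁ • x₁ := by
    rw [hw₀_def, γ.mul_comm', γ.mul_comm' x₁, γ.mul_mul_self m12.symm hz₁ hx₁]
  have pw1z1 : γ.mul w₁ z₁ = γ.g z₁ z₁ • x₀ := by
    rw [hw₁_def, γ.mul_comm', γ.mul_comm' x₀, γ.mul_mul_self m02.symm hz₁ hx₀]
  have pw0z0 : γ.mul w₀ z₀ = - γ.g x₁ x₁ • w₁ := by
    have := γ.clifford₂ m12.symm hz₀ hz₁ hx₁
    rw [g01, mul_zero, zero_smul, γ.mul_comm' z₁ x₁, ← hw₀_def, γ.mul_comm' z₀ x₁, p10, map_smul,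
      γ.mul_comm' z₁ x₀, ← hw₁_def, γ.mul_comm' z₀] at this
    rw [eq_neg_of_add_eq_zero_left this, neg_smul]
  have pw1z0 : γ.mul w₁ z₀ = - γ.g x₀ x₀ • w₀ := by
    have := γ.clifford₂ m02.symm hz₀ hz₁ hx₀
    rw [g01, mul_zero, zero_smul, γ.mul_comm' z₁ x₀, ← hw₁_def, γ.mul_comm' z₀ x₀, p00, map_smul,
      γ.mul_comm' z₁ x₁, ← hw₀_def, γ.mul_comm' z₀] at this
    rw [eq_neg_of_add_eq_zero_left this, neg_smul]
  have pww : γ.mul w₀ w₁ = - γ.g z₁ z₁ • z₀ := by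
    have := γ.clifford₂ m02 hw₀ hx₀ hz₁
    rw [γ.g_symm w₀, g0, mul_zero, zero_smul, ← hw₁_def, pw0z1, map_smul, p01] at this
    rw [eq_neg_of_add_eq_zero_left this, neg_smul]
  have s0 : ∀ x ∈ γ.comp 0, ∃ a b : F, a • x₀ + b • w₀ = x := fun x hx =>
    γ.exists_eq_of_orthogonal_pair hγ hx₀ hw₀ g0 gx₀ (by rw [gw₀]; exact mul_ne_zero gx₁ gz₁) hx
  have s1 : ∀ x ∈ γ.comp 1, ∃ a b : F, a • x₁ + b • w₁ = x := fun x hx =>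
    γ.exists_eq_of_orthogonal_pair hγ hx₁ hw₁ g1 gx₁ (by rw [gw₁]; exact mul_ne_zero gx₀ gz₁) hx
  have s2 : ∀ x ∈ γ.comp 2, ∃ a b : F, a • z₀ + b • z₁ = x := fun x hx =>
    γ.exists_eq_of_orthogonal_pair hγ hz₀ hz₁ g01 gz₀ gz₁ hx
  -- The metric is to become `A² - B²` with `A` supported on `x₀, x₁, z₀` and `B` on `w₀, w₁, z₁`;
  -- hence the sign under the root for `z₁`.
  obtain ⟨c₀, hc₀⟩ := IsAlgClosed.exists_pow_nat_eq (algebraMap F K (γ.g x₀ x₀)) two_pos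
  obtain ⟨c₁, hc₁⟩ := IsAlgClosed.exists_pow_nat_eq (algebraMap F K (γ.g x₁ x₁)) two_pos
  obtain ⟨d, hd⟩ := IsAlgClosed.exists_pow_nat_eq (- algebraMap F K (γ.g z₁ z₁)) two_pos
  have inj := (algebraMap F K).injective
  have hc₀0 : c₀ ≠ 0 := by
    rintro rfl
    rw [zero_pow two_ne_zero] at hc₀
    exact gx₀ (inj (by rw [← hc₀, map_zero]))
  have hc₁0 : c₁ ≠ 0 := by
    rintro rfl
    rw [zero_pow two_ne_zero] at hc₁
    exact gx₁ (inj (by rw [← hc₁, map_zero]))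
  have hd0 : d ≠ 0 := by
    rintro rfl
    rw [zero_pow two_ne_zero] at hd
    exact gz₁ (inj (by rw [map_zero, ← neg_eq_zero, ← hd]))
  have hd' : algebraMap F K (γ.g z₁ z₁) = - d ^ 2 := by rw [hd, neg_neg]
  let G : V → V →ₗ[F] K := fun z => Algebra.linearMap F K ∘ₗ γ.g z
  -- Pairing with `z₀` or `z₁` sees only `V_2`. The three terms of each functional therefore read
  -- off the components in `V_2`, in `V_0` (brought to `V_2` by `x₁`) and in `V_1` (brought to `V_2`
  -- by `x₀`). The coordinates will be `ξ = A + B` and `η = A - B`.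
  let A : V →ₗ[F] K := (c₀ * c₁)⁻¹ • G z₀ + (c₁⁻¹ * (c₀ * c₁)⁻¹) • (G z₀ ∘ₗ γ.mul x₁)
    + (c₀⁻¹ * (c₀ * c₁)⁻¹) • (G z₀ ∘ₗ γ.mul x₀)
  let B : V →ₗ[F] K := d⁻¹ • G z₁ - (c₁⁻¹ * d⁻¹) • (G z₁ ∘ₗ γ.mul x₁)
    - (c₀⁻¹ * d⁻¹) • (G z₁ ∘ₗ γ.mul x₀)
  have Adef : ∀ v, A v = (c₀ * c₁)⁻¹ * algebraMap F K (γ.g z₀ v)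
      + c₁⁻¹ * (c₀ * c₁)⁻¹ * algebraMap F K (γ.g z₀ (γ.mul x₁ v))
      + c₀⁻¹ * (c₀ * c₁)⁻¹ * algebraMap F K (γ.g z₀ (γ.mul x₀ v)) := fun v => rfl
  have Bdef : ∀ v, B v = d⁻¹ * algebraMap F K (γ.g z₁ v)
      - c₁⁻¹ * d⁻¹ * algebraMap F K (γ.g z₁ (γ.mul x₁ v))
      - c₀⁻¹ * d⁻¹ * algebraMap F K (γ.g z₁ (γ.mul x₀ v)) := fun v => rfl
  have o0 : ∀ z ∈ γ.comp 2, ∀ x ∈ γ.comp 0, γ.g z x = 0 := γ.comp_orth 2 0 (by decide)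
  have o1 : ∀ z ∈ γ.comp 2, ∀ x ∈ γ.comp 1, γ.g z x = 0 := γ.comp_orth 2 1 (by decide)
  have hz0x : algebraMap F K (γ.g z₀ z₀) = c₀ ^ 2 * c₁ ^ 2 := by rw [gz₀', map_mul, hc₀, hc₁]
  have g10 : γ.g z₁ z₀ = 0 := by rw [γ.g_symm, g01]
  have A0 : A x₀ = c₀ ∧ B x₀ = 0 := by
    rw [Adef, Bdef, γ.mul_comm' x₁, p01, γ.mul_self_comp hx₀ hx₀, o0 _ hz₀ _ hx₀, o0 _ hz₁ _ hx₀,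
      g10, hz0x]
    simp only [map_zero]
    constructor <;> field_simp <;> ring
  have Aw0 : A w₀ = 0 ∧ B w₀ = c₁ * d := by
    rw [Adef, Bdef, γ.mul_comm' x₁, pw1, γ.mul_self_comp hx₀ hw₀, o0 _ hz₀ _ hw₀, o0 _ hz₁ _ hw₀]
    simp only [map_zero, map_smul, smul_eq_mul, map_mul, g01, hd', ← hc₁]
    constructor <;> field_simp <;> ring
  have A1 : A x₁ = c₁ ∧ B x₁ = 0 := by
    rw [Adef, Bdef, p01, γ.mul_self_comp hx₁ hx₁, o1 _ hz₀ _ hx₁, o1 _ hz₁ _ hx₁, g10, hz0x]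
    simp only [map_zero]
    constructor <;> field_simp <;> ring
  have Aw1 : A w₁ = 0 ∧ B w₁ = c₀ * d := by
    rw [Adef, Bdef, p0w, γ.mul_self_comp hx₁ hw₁, o1 _ hz₀ _ hw₁, o1 _ hz₁ _ hw₁]
    simp only [map_zero, map_smul, smul_eq_mul, map_mul, g01, hd', ← hc₀]
    constructor <;> field_simp <;> ring
  have Az0 : A z₀ = c₀ * c₁ ∧ B z₀ = 0 := by
    rw [Adef, Bdef, p10, p00]
    simp only [map_zero, map_smul, smul_eq_mul, map_mul, g10, hz0x, o0 _ hz₀ _ hx₀,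
      o0 _ hz₁ _ hx₀, o1 _ hz₀ _ hx₁, o1 _ hz₁ _ hx₁]
    constructor <;> field_simp <;> ring
  have Az1 : A z₁ = 0 ∧ B z₁ = - d := by
    rw [Adef, Bdef, ← hw₀_def, ← hw₁_def, g01, o0 _ hz₀ _ hw₀, o0 _ hz₁ _ hw₀, o1 _ hz₀ _ hw₁,
      o1 _ hz₁ _ hw₁, hd']
    simp only [map_zero]
    constructor <;> field_simp <;> ring
  -- The rules for `ξ` and for `η` differ only in the sign of `B`, so both follow from one
  -- computation on the bases, with `ε = 1` and `ε = -1`.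
  have key : ∀ (P Q : V →ₗ[F] K) (ε : K), ε ^ 2 = 1 → P = A + ε • B → Q = A - ε • B →
      ∀ i j, i ≠ j → ∀ x ∈ γ.comp i, ∀ y ∈ γ.comp j, P (γ.mul x y) = Q x * Q y := by
    intro P Q ε hε hP hQ
    have hPv : ∀ v, P v = A v + ε * B v := fun v => by rw [hP]; rfl
    have hQv : ∀ v, Q v = A v - ε * B v := fun v => by rw [hQ]; rfl
    have k01 := bilin_eq_of_pairs s0 s1 (γ.mul.compr₂ P) ((LinearMap.mul F K).compl₁₂ Q Q)
    have k02 := bilin_eq_of_pairs s0 s2 (γ.mul.compr₂ P) ((LinearMap.mul F K).compl₁₂ Q Q)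
    have k12 := bilin_eq_of_pairs s1 s2 (γ.mul.compr₂ P) ((LinearMap.mul F K).compl₁₂ Q Q)
    simp only [LinearMap.compr₂_apply, LinearMap.compl₁₂_apply, LinearMap.mul_apply', p01, p0w,
      pw1, pww, p00, p10, pw0z1, pw1z1, pw0z0, pw1z0, ← hw₀_def, ← hw₁_def, map_smul, hPv, hQv,
      A0.1, A0.2, Aw0.1, Aw0.2, A1.1, A1.2, Aw1.1, Aw1.2, Az0.1, Az0.2, Az1.1, Az1.2,
      Algebra.smul_def, map_neg, ← hc₀, ← hc₁, hd'] at k01 k02 k12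
    replace k01 := k01 (by ring) (by ring) (by ring) (by linear_combination (-c₀ * c₁ * d ^ 2) * hε)
    replace k02 := k02 (by ring) (by ring) (by ring) (by linear_combination (c₁ * d ^ 2) * hε)
    replace k12 := k12 (by ring) (by ring) (by ring) (by linear_combination (c₀ * d ^ 2) * hε)
    intro i j hij x hx y hy
    rw [hPv, hQv, hQv]
    fin_cases i <;> fin_cases j
    · exact absurd rfl hij
    · exact k01 x hx y hy
    · exact k02 x hx y hy
    · rw [γ.mul_comm', mul_comm (A x - _)]; exact k01 y hy x hx
    · exact absurd rfl hij
    · exact k12 x hx y hy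
    · rw [γ.mul_comm', mul_comm (A x - _)]; exact k02 y hy x hx
    · rw [γ.mul_comm', mul_comm (A x - _)]; exact k12 y hy x hx
    · exact absurd rfl hij
  refine ⟨⟨A + B, A - B, ?_, ?_, ?_, ![x₀, x₁, z₀], ?_, ?_⟩⟩
  · have k0 := bilin_eq_of_pairs s0 s0 (LinearMap.compr₂ γ.g (2 • Algebra.linearMap F K))
      ((LinearMap.mul F K).compl₁₂ (A + B) (A - B) + (LinearMap.mul F K).compl₁₂ (A - B) (A + B))
    have k1 := bilin_eq_of_pairs s1 s1 (LinearMap.compr₂ γ.g (2 • Algebra.linearMap F K))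
      ((LinearMap.mul F K).compl₁₂ (A + B) (A - B) + (LinearMap.mul F K).compl₁₂ (A - B) (A + B))
    have k2 := bilin_eq_of_pairs s2 s2 (LinearMap.compr₂ γ.g (2 • Algebra.linearMap F K))
      ((LinearMap.mul F K).compl₁₂ (A + B) (A - B) + (LinearMap.mul F K).compl₁₂ (A - B) (A + B))
    simp only [LinearMap.compr₂_apply, LinearMap.add_apply, LinearMap.sub_apply,
      LinearMap.smul_apply, Algebra.linearMap_apply, LinearMap.compl₁₂_apply, LinearMap.mul_apply',
      nsmul_eq_mul, Nat.cast_ofNat, g0, g1, g01, g10, γ.g_symm w₀ x₀, γ.g_symm w₁ x₁, gw₀, gw₁,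
      map_mul, hd', hz0x, ← hc₀, ← hc₁, map_zero,
      A0.1, A0.2, Aw0.1, Aw0.2, A1.1, A1.2, Aw1.1, Aw1.2, Az0.1, Az0.2, Az1.1, Az1.2] at k0 k1 k2
    replace k0 := k0 (by ring) (by ring) (by ring) (by ring)
    replace k1 := k1 (by ring) (by ring) (by ring) (by ring)
    replace k2 := k2 (by ring) (by ring) (by ring) (by ring)
    intro i x hx y hy
    fin_cases i
    · exact k0 x hx y hy
    · exact k1 x hx y hy
    · exact k2 x hx y hy
  · exact key _ _ 1 (one_pow 2) (by rw [one_smul]) (by rw [one_smul])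
  · exact key _ _ (-1) (by ring) (by rw [neg_one_smul, sub_eq_add_neg])
      (by rw [neg_one_smul, sub_neg_eq_add])
  · intro i
    fin_cases i
    exacts [hx₀, hx₁, hz₀]
  · intro i
    fin_cases i
    exacts [gx₀, gx₁, gz₀]

end Triality

end Splitting
/-! ### The two standard representations in dimension `(2, 2)` -/

section Representation

namespace Triality

namespace Splitting

variable {F : Type u} {V : Type v} {V' : Type w} [Field F] [CharZero F]
  [AddCommGroup V] [Module F V] [FiniteDimensional F V]
  [AddCommGroup V'] [Module F V'] [FiniteDimensional F V']
  {γ : Triality F V} {γ' : Triality F V'} {K : Type*} [Field K] [Algebra F K]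

/-- The splitting with the two coordinates exchanged. -/
def swap (S : Splitting γ K) : Splitting γ K where
  ξ := S.η
  η := S.ξ
  g_eq i x hx y hy := by rw [S.g_eq i x hx y hy, add_comm]
  ξ_mul := S.η_mul
  η_mul := S.ξ_mul
  base := S.base
  base_mem := S.base_mem
  g_base := S.g_base

@[simp] lemma swap_ξ (S : Splitting γ K) : S.swap.ξ = S.η := rfl
@[simp] lemma swap_η (S : Splitting γ K) : S.swap.η = S.ξ := rfl
lemma swap_swap (S : Splitting γ K) : S.swap.swap = S := rfl

lemma ξ_base_ne_zero (S : Splitting γ K) (i : Fin 3) : S.ξ (S.base i) ≠ 0 := by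
  intro h
  have h' := S.g_eq i _ (S.base_mem i) _ (S.base_mem i)
  rw [h, zero_mul, mul_zero, add_zero, mul_eq_zero, map_eq_zero] at h'
  have : CharZero K := charZero_of_injective_algebraMap (algebraMap F K).injective
  exact h'.elim two_ne_zero (S.g_base i)

/-- The area form of the two coordinates. -/
def area (S : Splitting γ K) (x y : V) : K := S.ξ x * S.η y - S.η x * S.ξ y

/-- The factor by which an element of the triality algebra multiplies `ξ` on `V_i`. -/
def weight (S : Splitting γ K) (i : Fin 3) : Module.End F V →ₗ[F] K :=
  LinearMap.mulRight F (S.ξ (S.base i))⁻¹ ∘ₗ S.ξ ∘ₗ LinearMap.applyₗ (S.base i)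

lemma weight_apply (S : Splitting γ K) (i : Fin 3) (p : Module.End F V) :
    S.weight i p = S.ξ (p (S.base i)) * (S.ξ (S.base i))⁻¹ := rfl

/-- On `V_i` the metric formula applies, with `2g = ξη + ηξ`. On the other subspaces `ξ(y(xz)) =
η(y) ξ(x) ξ(z)`, and antisymmetrisation in `x, y` produces the area form. -/
lemma ξ_rot (S : Splitting γ K) {i j : Fin 3} {x y z : V} (hx : x ∈ γ.comp i) (hy : y ∈ γ.comp i)
    (hz : z ∈ γ.comp j) :
    S.ξ (γ.rot x y z) = (if j = i then -2 * S.area x y else S.area x y) * S.ξ z := by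
  by_cases h : j = i
  · subst h
    have e1 := S.g_eq j x hx z hz
    have e2 := S.g_eq j y hy z hz
    rw [if_pos rfl, γ.rot_apply, γ.mul_self_comp hx hz, γ.mul_self_comp hy hz]
    simp only [map_zero, sub_zero, add_zero, map_smul, map_sub, Algebra.smul_def, area, map_ofNat]
    linear_combination 2 * S.ξ y * e1 - 2 * S.ξ x * e2
  · obtain ⟨k, hjk, hik⟩ : ∃ k : Fin 3, j ≠ k ∧ i ≠ k := by
      clear hx hy hz
      revert i j
      decide
    rw [if_neg h, γ.rot_apply, γ.comp_orth i j (Ne.symm h) x hx z hz,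
      γ.comp_orth i j (Ne.symm h) y hy z hz]
    simp only [zero_smul, sub_zero, smul_zero, zero_add, map_sub]
    rw [S.ξ_mul i k hik y hy _ (γ.mul_mem hjk hik hx hz),
      S.ξ_mul i k hik x hx _ (γ.mul_mem hjk hik hy hz), S.η_mul i j (Ne.symm h) x hx z hz,
      S.η_mul i j (Ne.symm h) y hy z hz, area]
    ring

lemma weight_rot (S : Splitting γ K) {i : Fin 3} {x y : V} (hx : x ∈ γ.comp i)
    (hy : y ∈ γ.comp i) (j : Fin 3) :
    S.weight j (γ.rot x y) = if j = i then -2 * S.area x y else S.area x y := by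
  rw [weight_apply, S.ξ_rot hx hy (S.base_mem j), mul_assoc,
    mul_inv_cancel₀ (S.ξ_base_ne_zero j), mul_one]

/-- The orthogonal generators are diagonal in the coordinate `ξ`, and they span; so the whole
triality algebra acts on `ξ` by scalars, which may be read at the base vectors. -/
lemma ξ_algebra (S : Splitting γ K) {n : ℕ} (hγ : γ.HasDim n) {p : Module.End F V}
    (hp : p ∈ γ.algebra) {i : Fin 3} {x : V} (hx : x ∈ γ.comp i) :
    S.ξ (p x) = S.weight i p * S.ξ x := by
  let U : Submodule F γ.algebra := LinearMap.ker
    ((S.ξ ∘ₗ LinearMap.applyₗ x - LinearMap.mulRight F (S.ξ x) ∘ₗ S.weight i) ∘ₗ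
      γ.algebra.toSubmodule.subtype)
  have hU : U = ⊤ := γ.algebra_submodule_eq_top hγ fun j a ha b hb => by
    change S.ξ (γ.rot a b x) - S.weight i (γ.rot a b) * S.ξ x = 0
    rw [S.ξ_rot ha hb hx, S.weight_rot ha hb, sub_self]
  exact sub_eq_zero.1 (show (⟨p, hp⟩ : γ.algebra) ∈ U from hU ▸ Submodule.mem_top)

lemma weight_swap (S : Splitting γ K) {n : ℕ} (hγ : γ.HasDim n) {p : Module.End F V}
    (hp : p ∈ γ.algebra) (i : Fin 3) : S.swap.weight i p = - S.weight i p := by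
  let U : Submodule F γ.algebra := LinearMap.ker
    ((S.swap.weight i + S.weight i) ∘ₗ γ.algebra.toSubmodule.subtype)
  have hU : U = ⊤ := γ.algebra_submodule_eq_top hγ fun j a ha b hb => by
    change S.swap.weight i (γ.rot a b) + S.weight i (γ.rot a b) = 0
    rw [S.weight_rot ha hb, S.swap.weight_rot ha hb, area, area, swap_ξ, swap_η]
    split_ifs <;> ring
  exact eq_neg_of_add_eq_zero_left
    (show (⟨p, hp⟩ : γ.algebra) ∈ U from hU ▸ Submodule.mem_top)

/-- On an orthogonal generator the three weights are `-2ω, ω, ω` in some order, where `ω` is the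
area. -/
lemma weight_sum (S : Splitting γ K) {n : ℕ} (hγ : γ.HasDim n) {p : Module.End F V}
    (hp : p ∈ γ.algebra) : S.weight 0 p + S.weight 1 p + S.weight 2 p = 0 := by
  let U : Submodule F γ.algebra := LinearMap.ker
    ((S.weight 0 + S.weight 1 + S.weight 2) ∘ₗ γ.algebra.toSubmodule.subtype)
  have hU : U = ⊤ := γ.algebra_submodule_eq_top hγ fun j a ha b hb => by
    change S.weight 0 (γ.rot a b) + S.weight 1 (γ.rot a b) + S.weight 2 (γ.rot a b) = 0
    rw [S.weight_rot ha hb, S.weight_rot ha hb, S.weight_rot ha hb]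
    fin_cases j <;> simp <;> ring
  exact show (⟨p, hp⟩ : γ.algebra) ∈ U from hU ▸ Submodule.mem_top

lemma weight_lie (S : Splitting γ K) {n : ℕ} (hγ : γ.HasDim n) {p q : Module.End F V}
    (hp : p ∈ γ.algebra) (hq : q ∈ γ.algebra) (i : Fin 3) : S.weight i ⁅p, q⁆ = 0 := by
  rw [weight_apply, Ring.lie_def, LinearMap.sub_apply, map_sub, Module.End.mul_apply,
    Module.End.mul_apply, S.ξ_algebra hγ hp (hq.1 i _ (S.base_mem i)),
    S.ξ_algebra hγ hq (hp.1 i _ (S.base_mem i)), S.ξ_algebra hγ hp (S.base_mem i),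
    S.ξ_algebra hγ hq (S.base_mem i)]
  ring

/-- The coordinate `ξ ⊗ ξ'` on the sector `V_i ⊗ V'_{i+1}`. -/
def sectorCoord (S : Splitting γ K) (S' : Splitting γ' K) (i : Fin 3) : V ⊗[F] V' →ₗ[F] K :=
  LinearMap.mul' F K ∘ₗ TensorProduct.map (S.ξ ∘ₗ γ.proj i) (S'.ξ ∘ₗ γ'.proj (i + 1))

variable (S : Splitting γ K) (S' : Splitting γ' K)

@[simp] lemma sectorCoord_tmul (i : Fin 3) (x : V) (x' : V') :
    sectorCoord S S' i (x ⊗ₜ x') = S.ξ (γ.proj i x) * S'.ξ (γ'.proj (i + 1) x') := rfl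

lemma sectorCoord_tmul_of_mem {i : Fin 3} {x : V} {x' : V'} (hx : x ∈ γ.comp i)
    (hx' : x' ∈ γ'.comp (i + 1)) (k : Fin 3) :
    sectorCoord S S' k (x ⊗ₜ x') = if i = k then S.ξ x * S'.ξ x' else 0 := by
  rw [sectorCoord_tmul, γ.proj_of_mem hx, γ'.proj_of_mem hx']
  by_cases h : i = k
  · simp [h]
  · simp [h]

lemma sectorCoord_rTensor {n : ℕ} (hγ : γ.HasDim n) {p : Module.End F V} (hp : p ∈ γ.algebra)
    (i : Fin 3) (t : V ⊗[F] V') :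
    sectorCoord S S' i (p.rTensor V' t) = S.weight i p * sectorCoord S S' i t := by
  induction t using TensorProduct.induction_on with
  | zero => simp
  | add a b ha hb => simp only [map_add, ha, hb, mul_add]
  | tmul x x' =>
    rw [LinearMap.rTensor_tmul, sectorCoord_tmul, sectorCoord_tmul, γ.algebra_proj hp,
      S.ξ_algebra hγ hp (γ.proj_mem i x), mul_assoc]

lemma sectorCoord_lTensor {n' : ℕ} (hγ' : γ'.HasDim n') {q : Module.End F V'}
    (hq : q ∈ γ'.algebra) (i : Fin 3) (t : V ⊗[F] V') :
    sectorCoord S S' i (q.lTensor V t) = S'.weight (i + 1) q * sectorCoord S S' i t := by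
  induction t using TensorProduct.induction_on with
  | zero => simp
  | add a b ha hb => simp only [map_add, ha, hb, mul_add]
  | tmul x x' =>
    rw [LinearMap.lTensor_tmul, sectorCoord_tmul, sectorCoord_tmul, γ'.algebra_proj hq,
      S'.ξ_algebra hγ' hq (γ'.proj_mem (i + 1) x')]
    ring

/-- The product takes the coordinates `ηη'` of two sectors to `ξξ'` of the third, and the sign of
the cyclic order makes the result antisymmetric. These are the products of two off-diagonal entries
in a commutator of `3 × 3` matrices. -/
lemma sectorCoord_brTen (k : Fin 3) {s t : V ⊗[F] V'} (hs : s ∈ tensorSpace γ γ')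
    (ht : t ∈ tensorSpace γ γ') :
    sectorCoord S S' k (brTen γ γ' s t) =
      sectorCoord S.swap S'.swap (k + 1) s * sectorCoord S.swap S'.swap (k + 2) t
      - sectorCoord S.swap S'.swap (k + 2) s * sectorCoord S.swap S'.swap (k + 1) t := by
  induction hs using tensorSpace_induction with
  | h0 => simp
  | hadd a b ha hb h1 h2 => simp only [map_add, LinearMap.add_apply, h1, h2]; ring
  | h i x hx x' hx' =>
    induction ht using tensorSpace_induction with
    | h0 => simp
    | hadd a b ha hb h1 h2 => simp only [map_add, h1, h2]; ring
    | h j y hy y' hy' =>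
      simp only [sectorCoord_tmul_of_mem S.swap S'.swap hx hx',
        sectorCoord_tmul_of_mem S.swap S'.swap hy hy', brTen_tmul, γ.cross_of_mem hx hy, swap_ξ]
      have key : ∀ r, r ≠ i → r ≠ j → i ≠ j →
          sectorCoord S S' k (γ.mul x y ⊗ₜ γ'.mul x' y') =
            if r = k then (S.η x * S.η y) * (S'.η x' * S'.η y') else 0 := fun r hi hj hij => by
        rw [sectorCoord_tmul_of_mem S S' (γ.mul_mem hj.symm hi.symm hx hy)
          (γ'.mul_mem (r := r + 1) (by simpa using hj.symm) (by simpa using hi.symm) hx' hy'),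
          S.ξ_mul i j hij x hx y hy, S'.ξ_mul _ _ (by simpa using hij) x' hx' y' hy']
      rcases (by clear key hx hy hx' hy'; revert i j; decide : j = i ∨ j = i + 1 ∨ i = j + 1)
        with rfl | rfl | rfl
      · have e : (k + 1 = k + 2) = False := by clear key; revert k; decide
        rw [γ.mul_self_comp hx hy, γ'.mul_self_comp hx' hy', TensorProduct.tmul_zero, map_zero]
        by_cases h1 : j = k + 1
        · simp [h1, e]
        · simp [h1]
      · rw [if_pos rfl, key (i + 2) (by simp) (by simp) (by simp)]
        generalize S.η x = a, S.η y = b, S'.η x' = c, S'.η y' = d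
        fin_cases i <;> fin_cases k <;> simp <;> ring
      · have e : ∀ j : Fin 3, ¬ j = j + 1 + 1 := by decide
        rw [if_neg (e j), if_pos rfl, TensorProduct.neg_tmul, map_neg,
          key (j + 2) (by simp) (by simp) (by simp)]
        generalize S.η x = a, S.η y = b, S'.η x' = c, S'.η y' = d
        fin_cases j <;> fin_cases k <;> simp <;> ring

/-- This is the diagonal of a commutator. For two tensors of sector `i`, the differences of weights
on the left are `-3` for `i = k`, `3` for `i = k + 2` and `0` otherwise, in the upper and in the
lower triality alike, owing to the index shift in `V_i ⊗ V'_{i+1}`. -/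
lemma weight_brUp (k : Fin 3) {s t : V ⊗[F] V'} (hs : s ∈ tensorSpace γ γ')
    (ht : t ∈ tensorSpace γ γ') :
    S.weight k (brUp γ γ' s t) - S.weight (k + 2) (brUp γ γ' s t)
      + S'.weight (k + 1) (brLow γ γ' s t) - S'.weight k (brLow γ γ' s t) =
    3 * (sectorCoord S S' (k + 2) s * sectorCoord S.swap S'.swap (k + 2) t
      - sectorCoord S.swap S'.swap (k + 2) s * sectorCoord S S' (k + 2) t
      - (sectorCoord S S' k s * sectorCoord S.swap S'.swap k t
        - sectorCoord S.swap S'.swap k s * sectorCoord S S' k t)) := by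
  induction hs using tensorSpace_induction with
  | h0 => simp
  | hadd a b ha hb h1 h2 =>
    simp only [map_add, LinearMap.add_apply]
    linear_combination h1 + h2
  | h i x hx x' hx' =>
    induction ht using tensorSpace_induction with
    | h0 => simp
    | hadd a b ha hb h1 h2 =>
      simp only [map_add]
      linear_combination h1 + h2
    | h j y hy y' hy' =>
      simp only [sectorCoord_tmul_of_mem S.swap S'.swap hx hx',
        sectorCoord_tmul_of_mem S.swap S'.swap hy hy', sectorCoord_tmul_of_mem S S' hx hx',
        sectorCoord_tmul_of_mem S S' hy hy', brUp_tmul, brLow_tmul, swap_ξ, map_smul]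
      simp only [Algebra.smul_def]
      by_cases h : i = j
      · subst h
        have : CharZero K := charZero_of_injective_algebraMap (algebraMap F K).injective
        -- The polarisation `2g = ξη + ηξ`, with the area `ξη - ηξ`, combines the two contributions
        -- into the coordinates `ξξ'` and `ηη'` alone; the mixed products cancel.
        have hZ : algebraMap F K (γ'.g x' y') * S.area x y
            + algebraMap F K (γ.g x y) * S'.area x' y'
            = S.ξ x * S'.ξ x' * (S.η y * S'.η y') - S.η x * S'.η x' * (S.ξ y * S'.ξ y') := by
          have e := S.g_eq i x hx y hy
          have e' := S'.g_eq (i + 1) x' hx' y' hy'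
          simp only [area]
          linear_combination (S.ξ x * S.η y - S.η x * S.ξ y) / 2 * e'
            + (S'.ξ x' * S'.η y' - S'.η x' * S'.ξ y') / 2 * e
        rw [S.weight_rot hx hy, S.weight_rot hx hy, S'.weight_rot hx' hy', S'.weight_rot hx' hy']
        generalize S.area x y = ω, S'.area x' y' = ω' at *
        fin_cases i <;> fin_cases k <;> simp <;>
          first | ring1 | linear_combination 3 * hZ | linear_combination (-3) * hZ
      · rw [γ.comp_orth i j h x hx y hy, γ'.comp_orth _ _ (by simpa using h) x' hx' y' hy']
        have e : ∀ (k : Fin 3) (a b : K), (if i = k then a else 0) * (if j = k then b else 0) = 0 :=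
          fun k a b => by
            by_cases hk : i = k
            · rw [if_neg (c := j = k) (fun hj => h (hk.trans hj.symm)), mul_zero]
            · rw [if_neg hk, zero_mul]
        simp [e]

/-- The diagonal entries of the standard representation. -/
def diagEntry (k : Fin 3) : PairAlgebra γ γ' →ₗ[F] K :=
  LinearMap.mulRight F (3 : K)⁻¹ ∘ₗ ((S.weight k - S.weight (k + 2)) ∘ₗ PairAlgebra.up
    + (S'.weight (k + 1) - S'.weight k) ∘ₗ PairAlgebra.low)

lemma diagEntry_apply (k : Fin 3) (a : PairAlgebra γ γ') : diagEntry S S' k a =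
    (S.weight k a.up - S.weight (k + 2) a.up + (S'.weight (k + 1) a.low - S'.weight k a.low))
      * 3⁻¹ := rfl

/-- The off-diagonal entries of the standard representation. -/
def coordEntry (k : Fin 3) : PairAlgebra γ γ' →ₗ[F] K := sectorCoord S S' k ∘ₗ PairAlgebra.ten

lemma coordEntry_apply (k : Fin 3) (a : PairAlgebra γ γ') :
    coordEntry S S' k a = sectorCoord S S' k a.ten := rfl

section Brackets

variable {n n' : ℕ} (hγ : γ.HasDim n) (hγ' : γ'.HasDim n') (a b : PairAlgebra γ γ')
include hγ hγ'

lemma diagEntry_lie (k : Fin 3) : diagEntry S S' k ⁅a, b⁆ =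
    coordEntry S S' (k + 2) a * coordEntry S.swap S'.swap (k + 2) b
      - coordEntry S.swap S'.swap (k + 2) a * coordEntry S S' (k + 2) b
      - (coordEntry S S' k a * coordEntry S.swap S'.swap k b
        - coordEntry S.swap S'.swap k a * coordEntry S S' k b) := by
  have : CharZero K := charZero_of_injective_algebraMap (algebraMap F K).injective
  have h := weight_brUp S S' k a.ten_mem b.ten_mem
  simp only [diagEntry_apply, PairAlgebra.up_lie, PairAlgebra.low_lie, map_add,
    S.weight_lie hγ a.up_mem b.up_mem, S'.weight_lie hγ' a.low_mem b.low_mem, coordEntry_apply]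
  linear_combination h / 3

lemma coordEntry_lie (k : Fin 3) : coordEntry S S' k ⁅a, b⁆ =
    (S.weight k a.up + S'.weight (k + 1) a.low) * coordEntry S S' k b
      - (S.weight k b.up + S'.weight (k + 1) b.low) * coordEntry S S' k a
      + (coordEntry S.swap S'.swap (k + 1) a * coordEntry S.swap S'.swap (k + 2) b
        - coordEntry S.swap S'.swap (k + 2) a * coordEntry S.swap S'.swap (k + 1) b) := by
  simp only [coordEntry_apply, PairAlgebra.ten_lie, map_add, map_sub,
    sectorCoord_rTensor S S' hγ a.up_mem, sectorCoord_rTensor S S' hγ b.up_mem,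
    sectorCoord_lTensor S S' hγ' a.low_mem, sectorCoord_lTensor S S' hγ' b.low_mem,
    sectorCoord_brTen S S' k a.ten_mem b.ten_mem]
  ring

omit b in
-- The weight of the coordinate `ξξ'` on sector `k` must be the root belonging to the matrix
-- position `(k, k + 1)`. The diagonal entries, with their factor `1/3`, solve these equations under
-- trace zero, because the weights of each triality sum to zero.
lemma weight_add_weight (k : Fin 3) : S.weight k a.up + S'.weight (k + 1) a.low
    = diagEntry S S' k a - diagEntry S S' (k + 1) a := by
  have : CharZero K := charZero_of_injective_algebraMap (algebraMap F K).injective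
  have h := S.weight_sum hγ a.up_mem
  have h' := S'.weight_sum hγ' a.low_mem
  simp only [diagEntry_apply]
  fin_cases k <;> simp <;> linear_combination (h' + h) / 3

omit b hγ hγ' in
lemma diagEntry_sum : diagEntry S S' 0 a + diagEntry S S' 1 a + diagEntry S S' 2 a = 0 := by
  simp only [diagEntry_apply]
  simp
  ring

end Brackets

/-- The standard representation attached to a pair of splittings, over the ground field. -/
def repMatrix : PairAlgebra γ γ' →ₗ[F] Matrix (Fin 3) (Fin 3) K where
  toFun a := !![diagEntry S S' 0 a, -coordEntry S S' 0 a, coordEntry S.swap S'.swap 2 a;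
    coordEntry S.swap S'.swap 0 a, diagEntry S S' 1 a, -coordEntry S S' 1 a;
    -coordEntry S S' 2 a, coordEntry S.swap S'.swap 1 a, diagEntry S S' 2 a]
  map_add' a b := by
    ext i j
    fin_cases i <;> fin_cases j <;> simp <;> ring
  map_smul' c a := by
    ext i j
    fin_cases i <;> fin_cases j <;> simp

lemma repMatrix_apply (a : PairAlgebra γ γ') : repMatrix S S' a =
    !![diagEntry S S' 0 a, -coordEntry S S' 0 a, coordEntry S.swap S'.swap 2 a;
    coordEntry S.swap S'.swap 0 a, diagEntry S S' 1 a, -coordEntry S S' 1 a;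
    -coordEntry S S' 2 a, coordEntry S.swap S'.swap 1 a, diagEntry S S' 2 a] := rfl

lemma trace_repMatrix (a : PairAlgebra γ γ') : (repMatrix S S' a).trace = 0 := by
  rw [repMatrix_apply, Matrix.trace_fin_three]
  exact diagEntry_sum S S' a

lemma diagEntry_swap {n n' : ℕ} (hγ : γ.HasDim n) (hγ' : γ'.HasDim n') (k : Fin 3)
    (a : PairAlgebra γ γ') : diagEntry S.swap S'.swap k a = - diagEntry S S' k a := by
  simp only [diagEntry_apply, S.weight_swap hγ a.up_mem, S'.weight_swap hγ' a.low_mem]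
  ring

/-- Exchanging the coordinates in both trialities replaces the matrix by its negative transpose. So
the bracket formulas for the swapped pair supply the remaining off-diagonal entries, and the
commutator is compared entry by entry. -/
lemma repMatrix_lie {n n' : ℕ} (hγ : γ.HasDim n) (hγ' : γ'.HasDim n') (a b : PairAlgebra γ γ') :
    repMatrix S S' ⁅a, b⁆ = ⁅repMatrix S S' a, repMatrix S S' b⁆ := by
  have hX := coordEntry_lie S S' hγ hγ' a b
  have hY := coordEntry_lie S.swap S'.swap hγ hγ' a b
  simp only [weight_add_weight S S' hγ hγ', weight_add_weight S.swap S'.swap hγ hγ',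
    diagEntry_swap S S' hγ hγ', swap_swap] at hX hY
  have hd := diagEntry_lie S S' hγ hγ' a b
  simp only [Fin.forall_fin_succ] at hX hY hd
  simp at hX hY hd
  obtain ⟨x0, x1, x2⟩ := hX
  obtain ⟨y0, y1, y2⟩ := hY
  obtain ⟨d0, d1, d2⟩ := hd
  rw [Ring.lie_def, repMatrix_apply, repMatrix_apply, repMatrix_apply, x0, x1, x2, y0, y1, y2,
    d0, d1, d2]
  ext i j
  fin_cases i <;> fin_cases j <;> simp <;> ring

end Splitting

end Triality

end Representation
/-! ### The algebra of dimension `(2, 2)` -/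

section SpecialLinear

open LieAlgebra.SpecialLinear

/-- The trace is a functional on a space of dimension nine. The lower bound suffices, since it will
meet an upper bound for the other side. -/
lemma le_finrank_sl (K : Type*) [Field K] : 8 ≤ Module.finrank K (sl (Fin 3) K) := by
  have h := (Matrix.traceLinearMap (Fin 3) K K).finrank_range_add_finrank_ker
  have h1 : Module.finrank K (LinearMap.range (Matrix.traceLinearMap (Fin 3) K K)) ≤ 1 :=
    (Submodule.finrank_le _).trans_eq (Module.finrank_self K)
  have h2 : Module.finrank K (Matrix (Fin 3) (Fin 3) K) = 9 := by
    simp [Module.finrank_matrix]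
  have h3 : Module.finrank K (sl (Fin 3) K)
      = Module.finrank K (LinearMap.ker (Matrix.traceLinearMap (Fin 3) K K)) := rfl
  omega

lemma single_lie_single {K : Type*} [Field K] {i j : Fin 3} (hij : i ≠ j) (c : K) :
    ⁅single i j hij c, single j i hij.symm 1⁆ = singleSubSingle i j c := by
  refine Subtype.ext ?_
  rw [sl_bracket, val_single, val_single, val_singleSubSingle, Matrix.single_mul_single_same,
    Matrix.single_mul_single_same, mul_one, one_mul]

/-- Commutators of opposite elementary matrices supply the traceless diagonal matrices. -/
lemma eq_top_of_single_mem {K : Type*} [Field K] {U : LieSubalgebra K (sl (Fin 3) K)}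
    (h : ∀ i j (hij : i ≠ j), single i j hij 1 ∈ U) : U = ⊤ := by
  have h1 : ∀ i j (hij : i ≠ j) (c : K), single i j hij c ∈ U := fun i j hij c => by
    have := U.smul_mem c (h i j hij)
    rwa [← map_smul, smul_eq_mul, mul_one] at this
  have h2 : ∀ i j (_ : i ≠ j) (c : K), singleSubSingle i j c ∈ U := fun i j hij c =>
    single_lie_single hij c ▸ U.lie_mem (h1 i j hij c) (h j i hij.symm)
  refine eq_top_iff.2 fun A _ => ?_
  have hA : A.1 0 0 + A.1 1 1 + A.1 2 2 = 0 := by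
    rw [← Matrix.trace_fin_three]
    exact A.2
  have e : A = single 0 1 (by decide) (A.1 0 1) + single 1 0 (by decide) (A.1 1 0)
      + single 0 2 (by decide) (A.1 0 2) + single 2 0 (by decide) (A.1 2 0)
      + single 1 2 (by decide) (A.1 1 2) + single 2 1 (by decide) (A.1 2 1)
      + singleSubSingle 0 2 (A.1 0 0) + singleSubSingle 1 2 (A.1 1 1) := by
    refine Subtype.ext ?_
    ext i j
    fin_cases i <;> fin_cases j <;> simp
    linear_combination hA
  rw [e]
  exact U.add_mem (U.add_mem (U.add_mem (U.add_mem (U.add_mem (U.add_mem (U.add_mem (h1 ..)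
    (h1 ..)) (h1 ..)) (h1 ..)) (h1 ..)) (h1 ..)) (h2 _ _ (by decide) _)) (h2 _ _ (by decide) _)

/-- The adjoint action of a pair is the product of the two adjoint actions, so the trace splits. -/
lemma killingForm_prod {R L L' : Type*} [Field R] [LieRing L] [LieAlgebra R L]
    [FiniteDimensional R L] [LieRing L'] [LieAlgebra R L'] [FiniteDimensional R L']
    (a b : L × L') : killingForm R (L × L') a b =
      killingForm R L a.1 b.1 + killingForm R L' a.2 b.2 := by
  rw [killingForm_apply_apply, killingForm_apply_apply, killingForm_apply_apply,
    ← LinearMap.trace_prodMap']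
  rfl

end SpecialLinear

/-! ### Dimension bounds and the isomorphism in dimension `(2, 2)`. -/

section Dimension

variable {F : Type u} {V : Type v} {V' : Type w} [Field F] [CharZero F]
  [AddCommGroup V] [Module F V] [FiniteDimensional F V]
  [AddCommGroup V'] [Module F V'] [FiniteDimensional F V']

namespace Triality

lemma exists_orthogonal_pair (γ : Triality F V) (hγ : γ.HasDim 2) (i : Fin 3) :
    ∃ u ∈ γ.comp i, ∃ v ∈ γ.comp i, γ.g u v = 0 ∧ γ.g u u ≠ 0 ∧ γ.g v v ≠ 0 := by
  obtain ⟨e, he, ho, hg, -⟩ := γ.exists_orthogonal_family hγ i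
  exact ⟨e 0, he 0, e 1, he 1, ho 0 1 (by decide), hg 0, hg 1⟩

/-- A skew operator of a plane has a single matrix entry, `g(p u, v)`. -/
lemma algebra_eq_zero_on (γ : Triality F V) (hγ : γ.HasDim 2) {p : Module.End F V}
    (hp : p ∈ γ.algebra) {i : Fin 3} {u v : V} (hu : u ∈ γ.comp i) (hv : v ∈ γ.comp i)
    (huv : γ.g u v = 0) (hu0 : γ.g u u ≠ 0) (hv0 : γ.g v v ≠ 0) (h : γ.g (p u) v = 0) :
    ∀ x ∈ γ.comp i, p x = 0 := by
  have key : ∀ y ∈ γ.comp i, γ.g y u = 0 → γ.g y v = 0 → y = 0 := by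
    intro y hy h1 h2
    obtain ⟨a, b, rfl⟩ := γ.exists_eq_of_orthogonal_pair hγ hu hv huv hu0 hv0 hy
    have ha : a = 0 := by simpa [γ.g_symm v u, huv, hu0] using h1
    have hb : b = 0 := by simpa [huv, hv0] using h2
    simp [ha, hb]
  have hpu : p u = 0 := key _ (hp.1 i u hu) (γ.g_algebra_self hp u) h
  have hpv : p v = 0 := by
    refine key _ (hp.1 i v hv) ?_ (γ.g_algebra_self hp v)
    have := hp.2.1 v u
    rwa [hpu, map_zero, add_zero] at this
  intro x hx
  obtain ⟨a, b, rfl⟩ := γ.exists_eq_of_orthogonal_pair hγ hu hv huv hu0 hv0 hx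
  simp [hpu, hpv]

/-- An element of the triality algebra is determined by its one entry on `V_0` and its one entry on
`V_1`. -/
lemma finrank_algebra_le (γ : Triality F V) (hγ : γ.HasDim 2) :
    Module.finrank F γ.algebra ≤ 2 := by
  obtain ⟨u₀, hu₀, v₀, hv₀, o₀, gu₀, gv₀⟩ := γ.exists_orthogonal_pair hγ 0
  obtain ⟨u₁, hu₁, v₁, hv₁, o₁, gu₁, gv₁⟩ := γ.exists_orthogonal_pair hγ 1
  let f : γ.algebra →ₗ[F] F × F := LinearMap.prod
    (γ.g.flip v₀ ∘ₗ γ.evalAlg u₀) (γ.g.flip v₁ ∘ₗ γ.evalAlg u₁)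
  have hf : Function.Injective f := by
    refine (injective_iff_map_eq_zero f).2 fun p hp => Subtype.ext ?_
    have h0 : γ.g (p.1 u₀) v₀ = 0 := congrArg Prod.fst hp
    have h1 : γ.g (p.1 u₁) v₁ = 0 := congrArg Prod.snd hp
    have k0 := γ.algebra_eq_zero_on hγ p.2 hu₀ hv₀ o₀ gu₀ gv₀ h0
    have k1 := γ.algebra_eq_zero_on hγ p.2 hu₁ hv₁ o₁ gu₁ gv₁ h1
    refine γ.hom_ext_comp fun i x hx => ?_
    change p.1 x = 0
    fin_cases i
    · exact k0 x hx
    · exact k1 x hx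
    -- By the Clifford identity, every vector of `V_2` is the product of `u₀` with a vector of
    -- `V_1`, up to a non-zero scalar; a derivation which vanishes on `V_0` and `V_1` vanishes there
    -- too.
    · have hm : γ.mul u₀ x ∈ γ.comp 1 := γ.mul_mem (by decide) (by decide) hu₀ hx
      have := congrArg p.1 (γ.mul_mul_self (by decide) hu₀ hx)
      rw [γ.algebra_mul p.2, k0 u₀ hu₀, k1 _ hm, map_smul, map_zero, LinearMap.zero_apply,
        map_zero, add_zero, eq_comm, smul_eq_zero] at this
      exact this.resolve_left gu₀
  have := LinearMap.finrank_le_finrank_of_injective hf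
  rwa [Module.finrank_prod, Module.finrank_self] at this

lemma finrank_sector_le (γ : Triality F V) (γ' : Triality F V') (hγ : γ.HasDim 2)
    (hγ' : γ'.HasDim 2) (i : Fin 3) : Module.finrank F (sector γ γ' i) ≤ 4 := by
  refine (LinearMap.finrank_range_le _).trans_eq ?_
  rw [Module.finrank_tensorProduct, hγ, hγ']

lemma finrank_tensorSpace_le (γ : Triality F V) (γ' : Triality F V') (hγ : γ.HasDim 2)
    (hγ' : γ'.HasDim 2) : Module.finrank F (tensorSpace γ γ') ≤ 12 := by
  have e : tensorSpace γ γ' = sector γ γ' 0 ⊔ sector γ γ' 1 ⊔ sector γ γ' 2 := by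
    refine le_antisymm (iSup_le fun i => ?_)
      (sup_le (sup_le (sector_le γ γ' 0) (sector_le γ γ' 1)) (sector_le γ γ' 2))
    fin_cases i
    · exact le_sup_left.trans le_sup_left
    · exact le_sup_right.trans le_sup_left
    · exact le_sup_right
  rw [e]
  have h1 := Submodule.finrank_add_le_finrank_add_finrank (sector γ γ' 0 ⊔ sector γ γ' 1)
    (sector γ γ' 2)
  have h2 := Submodule.finrank_add_le_finrank_add_finrank (sector γ γ' 0) (sector γ γ' 1)
  have h := finrank_sector_le γ γ' hγ hγ'
  have k0 := h 0
  have k1 := h 1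
  have k2 := h 2
  omega

lemma finrank_pairAlgebra_le (γ : Triality F V) (γ' : Triality F V') (hγ : γ.HasDim 2)
    (hγ' : γ'.HasDim 2) : Module.finrank F (γ.PairAlgebra γ') ≤ 16 := by
  have h : Module.finrank F (γ.PairAlgebra γ') = Module.finrank F γ.algebra
      + (Module.finrank F γ'.algebra + Module.finrank F (tensorSpace γ γ')) := by
    rw [← Module.finrank_prod, ← Module.finrank_prod]
    rfl
  have h1 := γ.finrank_algebra_le hγ
  have h2 := γ'.finrank_algebra_le hγ'
  have h3 := finrank_tensorSpace_le γ γ' hγ hγ'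
  omega

namespace Splitting

open LieAlgebra.SpecialLinear

variable {γ : Triality F V} {γ' : Triality F V'} {K : Type*} [Field K] [Algebra F K]
  (S : Splitting γ K) (S' : Splitting γ' K)

/-- The standard representation attached to a pair of splittings. -/
def repHom {n n' : ℕ} (hγ : γ.HasDim n) (hγ' : γ'.HasDim n') :
    K ⊗[F] γ.PairAlgebra γ' →ₗ⁅K⁆ sl (Fin 3) K where
  __ := LinearMap.codRestrict (sl (Fin 3) K).toSubmodule ((repMatrix S S').liftBaseChange K)
    (fun t => by
      induction t using TensorProduct.induction_on with
      | zero => rw [map_zero]; exact zero_mem _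
      | add a b ha hb => rw [map_add]; exact add_mem ha hb
      | tmul c a =>
        rw [LinearMap.liftBaseChange_tmul]
        exact Submodule.smul_mem _ c (show (repMatrix S S' a).trace = 0 from trace_repMatrix S S' a))
  map_lie' {s t} := by
    refine Subtype.ext ?_
    change (repMatrix S S').liftBaseChange K ⁅s, t⁆
      = ⁅(repMatrix S S').liftBaseChange K s, (repMatrix S S').liftBaseChange K t⁆
    induction s using TensorProduct.induction_on with
    | zero => rw [show ⁅(0 : K ⊗[F] γ.PairAlgebra γ'), t⁆ = 0 from zero_lie t, map_zero, zero_lie]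
    | add a b ha hb =>
      rw [show ⁅a + b, t⁆ = ⁅a, t⁆ + ⁅b, t⁆ from add_lie a b t, map_add, map_add, add_lie, ha, hb]
    | tmul c a =>
      induction t using TensorProduct.induction_on with
      | zero => rw [show ⁅c ⊗ₜ[F] a, (0 : K ⊗[F] γ.PairAlgebra γ')⁆ = 0 from
          lie_zero (M := K ⊗[F] γ.PairAlgebra γ') (c ⊗ₜ[F] a), map_zero,
          lie_zero]
      | add b b' hb hb' =>
        rw [show ⁅c ⊗ₜ[F] a, b + b'⁆ = ⁅c ⊗ₜ[F] a, b⁆ + ⁅c ⊗ₜ[F] a, b'⁆ from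
          lie_add (M := K ⊗[F] γ.PairAlgebra γ') (c ⊗ₜ[F] a) b b',
          map_add, map_add, lie_add, hb, hb']
      | tmul d b =>
        rw [LieAlgebra.ExtendScalars.bracket_tmul, LinearMap.liftBaseChange_tmul,
          LinearMap.liftBaseChange_tmul, LinearMap.liftBaseChange_tmul, repMatrix_lie S S' hγ hγ',
          smul_lie, lie_smul, smul_smul]

lemma coe_repHom {n n' : ℕ} (hγ : γ.HasDim n) (hγ' : γ'.HasDim n') (t : K ⊗[F] γ.PairAlgebra γ') :
    (repHom S S' hγ hγ' t).1 = (repMatrix S S').liftBaseChange K t := rfl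

lemma repMatrix_tens {k : Fin 3} {x : V} {x' : V'} (hx : x ∈ γ.comp k)
    (hx' : x' ∈ γ'.comp (k + 1)) : repMatrix S S' (PairAlgebra.tens γ γ' (x ⊗ₜ x')) =
      Matrix.single k (k + 1) (-(S.ξ x * S'.ξ x')) + Matrix.single (k + 1) k (S.η x * S'.η x') := by
  have hd : ∀ j, diagEntry S S' j (PairAlgebra.tens γ γ' (x ⊗ₜ x')) = 0 := fun j => by
    simp [diagEntry_apply]
  simp only [repMatrix_apply, hd, coordEntry_apply, PairAlgebra.ten_tens_tmul hx hx',
    sectorCoord_tmul_of_mem S S' hx hx', sectorCoord_tmul_of_mem S.swap S'.swap hx hx', swap_ξ]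
  ext i j
  fin_cases k <;> fin_cases i <;> fin_cases j <;> simp

/-- For an orthogonal pair `u, v` one has `ξ(u) η(v) + η(u) ξ(v) = 0`, so the determinant of the
coordinates is `2 ξ(u) η(v)`. It is non-zero because neither vector is isotropic, and the `2 × 2`
system is solved by Cramer's rule. -/
lemma exists_coords (hγ : γ.HasDim 2) (i : Fin 3) : ∃ x ∈ γ.comp i, ∃ y ∈ γ.comp i,
    ∀ c d : K, ∃ a b : K, a * S.ξ x + b * S.ξ y = c ∧ a * S.η x + b * S.η y = d := by
  obtain ⟨u, hu, v, hv, huv, hu0, hv0⟩ := γ.exists_orthogonal_pair hγ i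
  have : CharZero K := charZero_of_injective_algebraMap (algebraMap F K).injective
  have e1 := S.g_eq i u hu v hv
  have e2 := S.g_eq i u hu u hu
  have e3 := S.g_eq i v hv v hv
  rw [huv, map_zero, mul_zero] at e1
  have hu1 : algebraMap F K (γ.g u u) ≠ 0 := (map_ne_zero _).2 hu0
  have hv1 : algebraMap F K (γ.g v v) ≠ 0 := (map_ne_zero _).2 hv0
  have hξu : S.ξ u ≠ 0 := fun h => hu1 (by linear_combination e2 / 2 + S.η u * h)
  have hηv : S.η v ≠ 0 := fun h => hv1 (by linear_combination e3 / 2 + S.ξ v * h)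
  have hD : S.ξ u * S.η v - S.η u * S.ξ v ≠ 0 := fun h =>
    mul_ne_zero hξu hηv (by linear_combination h / 2 - e1 / 2)
  refine ⟨u, hu, v, hv, fun c d => ⟨(c * S.η v - d * S.ξ v) / (S.ξ u * S.η v - S.η u * S.ξ v),
    (d * S.ξ u - c * S.η u) / (S.ξ u * S.η v - S.η u * S.ξ v), ?_, ?_⟩⟩
  · rw [div_mul_eq_mul_div, div_mul_eq_mul_div, ← add_div, div_eq_iff hD]
    ring
  · rw [div_mul_eq_mul_div, div_mul_eq_mul_div, ← add_div, div_eq_iff hD]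
    ring

/-- Over `K` the tensors of two vectors with prescribed coordinates `(c, d)` and `(c', d')` are
available. The second representation exchanges `c'` and `d'`, which is what makes the two
representations separable. -/
lemma exists_repHom_eq (hγ : γ.HasDim 2) (hγ' : γ'.HasDim 2) (k : Fin 3) (c d c' d' : K) :
    ∃ t, (repHom S S' hγ hγ' t).1
        = Matrix.single k (k + 1) (-(c * c')) + Matrix.single (k + 1) k (d * d') ∧
      (repHom S S'.swap hγ hγ' t).1
        = Matrix.single k (k + 1) (-(c * d')) + Matrix.single (k + 1) k (d * c') := by
  obtain ⟨x, hx, y, hy, h⟩ := S.exists_coords hγ k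
  obtain ⟨x', hx', y', hy', h'⟩ := S'.exists_coords hγ' (k + 1)
  obtain ⟨a, b, rfl, rfl⟩ := h c d
  obtain ⟨a', b', rfl, rfl⟩ := h' c' d'
  refine ⟨(a * a') ⊗ₜ PairAlgebra.tens γ γ' (x ⊗ₜ x') + (a * b') ⊗ₜ PairAlgebra.tens γ γ' (x ⊗ₜ y')
    + (b * a') ⊗ₜ PairAlgebra.tens γ γ' (y ⊗ₜ x') + (b * b') ⊗ₜ PairAlgebra.tens γ γ' (y ⊗ₜ y'),
    ?_, ?_⟩
  all_goals
    have e : ∀ a b a' b' : K, Matrix.single k (k + 1) a + Matrix.single (k + 1) k b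
        + (Matrix.single k (k + 1) a' + Matrix.single (k + 1) k b')
        = Matrix.single k (k + 1) (a + a') + Matrix.single (k + 1) k (b + b') := fun a b a' b' => by
      rw [add_add_add_comm, ← Matrix.single_add, ← Matrix.single_add]
    rw [coe_repHom]
    simp only [map_add, LinearMap.liftBaseChange_tmul, repMatrix_tens _ _ hx hx',
      repMatrix_tens _ _ hx hy', repMatrix_tens _ _ hy hx', repMatrix_tens _ _ hy hy', swap_ξ,
      swap_η, smul_add, Matrix.smul_single, smul_eq_mul, e]
    congr 2 <;> ring

/-- The two standard representations together. -/
def repPair {n n' : ℕ} (hγ : γ.HasDim n) (hγ' : γ'.HasDim n') :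
    K ⊗[F] γ.PairAlgebra γ' →ₗ⁅K⁆ sl (Fin 3) K × sl (Fin 3) K :=
  (repHom S S' hγ hγ').prod (repHom S S'.swap hγ hγ')

lemma repPair_surjective (hγ : γ.HasDim 2) (hγ' : γ'.HasDim 2) :
    Function.Surjective (repPair S S' hγ hγ') := by
  have key : ∀ (k : Fin 3) (c d c' d' : K) (A B : sl (Fin 3) K),
      A.1 = Matrix.single k (k + 1) (-(c * c')) + Matrix.single (k + 1) k (d * d') →
      B.1 = Matrix.single k (k + 1) (-(c * d')) + Matrix.single (k + 1) k (d * c') →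
      (A, B) ∈ (repPair S S' hγ hγ').range := fun k c d c' d' A B hA hB => by
    obtain ⟨t, h1, h2⟩ := exists_repHom_eq S S' hγ hγ' k c d c' d'
    exact ⟨t, Prod.ext (Subtype.ext (h1.trans hA.symm)) (Subtype.ext (h2.trans hB.symm))⟩
  have cases : ∀ i j : Fin 3, i ≠ j → j = i + 1 ∨ i = j + 1 := by decide
  have h1 : (repPair S S' hγ hγ').range.comap (LieHom.inl K _ _) = ⊤ := by
    refine eq_top_of_single_mem fun i j hij => ?_
    change (single i j hij (1 : K), (0 : sl (Fin 3) K)) ∈ (repPair S S' hγ hγ').range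
    rcases cases i j hij with rfl | rfl
    -- Each choice leaves only one of the products `cc'`, `dd'`, `cd'`, `dc'` non-zero: a single
    -- elementary matrix in one factor and zero in the other. The `-1` compensates the sign above
    -- the diagonal.
    · exact key i 1 0 (-1) 0 _ _ (by simp) (by simp)
    · exact key j 0 1 0 1 _ _ (by simp) (by simp)
  have h2 : (repPair S S' hγ hγ').range.comap (LieHom.inr K _ _) = ⊤ := by
    refine eq_top_of_single_mem fun i j hij => ?_
    change ((0 : sl (Fin 3) K), single i j hij (1 : K)) ∈ (repPair S S' hγ hγ').range
    rcases cases i j hij with rfl | rfl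
    · exact key i 1 0 0 (-1) _ _ (by simp) (by simp)
    · exact key j 0 1 1 0 _ _ (by simp) (by simp)
  rintro ⟨A, B⟩
  have hA : (A, (0 : sl (Fin 3) K)) ∈ (repPair S S' hγ hγ').range :=
    show A ∈ (repPair S S' hγ hγ').range.comap (LieHom.inl K _ _) from h1 ▸ LieSubalgebra.mem_top A
  have hB : ((0 : sl (Fin 3) K), B) ∈ (repPair S S' hγ hγ').range :=
    show B ∈ (repPair S S' hγ hγ').range.comap (LieHom.inr K _ _) from h2 ▸ LieSubalgebra.mem_top B
  have := LieSubalgebra.add_mem _ hA hB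
  rwa [Prod.mk_add_mk, add_zero, zero_add] at this

/-- A surjection from a space of dimension at most `16` onto one of dimension at least `8 + 8`. -/
lemma repPair_bijective (hγ : γ.HasDim 2) (hγ' : γ'.HasDim 2) :
    Function.Bijective (repPair S S' hγ hγ') := by
  have hs := repPair_surjective S S' hγ hγ'
  have h1 := LinearMap.finrank_le_finrank_of_surjective
    (f := (repPair S S' hγ hγ').toLinearMap) hs
  have h2 : Module.finrank K (K ⊗[F] γ.PairAlgebra γ') = Module.finrank F (γ.PairAlgebra γ') :=
    Module.finrank_baseChange
  have h3 := finrank_pairAlgebra_le γ γ' hγ hγ'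
  have h4 := le_finrank_sl K
  have h5 : Module.finrank K (sl (Fin 3) K × sl (Fin 3) K)
      = Module.finrank K (sl (Fin 3) K) + Module.finrank K (sl (Fin 3) K) := Module.finrank_prod
  have h6 : Module.finrank K (K ⊗[F] γ.PairAlgebra γ')
      = Module.finrank K (sl (Fin 3) K × sl (Fin 3) K) := by omega
  exact ⟨(LinearMap.injective_iff_surjective_of_finrank_eq_finrank h6
    (f := (repPair S S' hγ hγ').toLinearMap)).2 hs, hs⟩

end Splitting

theorem PairAlgebra.exists_lieEquiv_sl {γ : Triality F V} {γ' : Triality F V'} (hγ : γ.HasDim 2)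
    (hγ' : γ'.HasDim 2) (K : Type*) [Field K] [IsAlgClosed K] [Algebra F K] :
    ∃ e : K ⊗[F] γ.PairAlgebra γ' ≃ₗ⁅K⁆
        LieAlgebra.SpecialLinear.sl (Fin 3) K × LieAlgebra.SpecialLinear.sl (Fin 3) K,
      ∀ a b, killingForm K (K ⊗[F] γ.PairAlgebra γ') a b =
        killingForm K (LieAlgebra.SpecialLinear.sl (Fin 3) K) (e a).1 (e b).1 +
        killingForm K (LieAlgebra.SpecialLinear.sl (Fin 3) K) (e a).2 (e b).2 := by
  obtain ⟨S⟩ := γ.exists_splitting (K := K) hγ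
  obtain ⟨S'⟩ := γ'.exists_splitting (K := K) hγ'
  refine ⟨LieEquiv.ofBijective (Splitting.repPair S S' hγ hγ')
    (Splitting.repPair_bijective S S' hγ hγ'), fun a b => ?_⟩
  rw [← killingForm_prod, LieAlgebra.killingForm_of_equiv_apply]

end Triality

end Dimension
end

theorem mainTheorem5 {F V V' : Type*} [Field F] [CharZero F]
    [AddCommGroup V] [Module F V] [FiniteDimensional F V]
    [AddCommGroup V'] [Module F V'] [FiniteDimensional F V']
    (γ : Triality F V) (γ' : Triality F V') (n n' : ℕ)
    (hn : n = 1 ∨ n = 2 ∨ n = 4 ∨ n = 8) (hn' : n' = 1 ∨ n' = 2 ∨ n' = 4 ∨ n' = 8)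
    (hγ : γ.HasDim n) (hγ' : γ'.HasDim n') :
    -- the Killing form is non-degenerate
    (killingForm F (γ.PairAlgebra γ')).Nondegenerate ∧
    -- the algebra is simple, except for `(2, 2)`
    (¬ (n = 2 ∧ n' = 2) → LieAlgebra.IsSimple F (γ.PairAlgebra γ')) ∧
    -- for `(2, 2)` it is of type `A₂ ⊕ A₂`, with the sum of the two Killing forms
    (n = 2 ∧ n' = 2 → ∀ (K : Type*) [Field K] [IsAlgClosed K] [Algebra F K],
      ∃ e : K ⊗[F] γ.PairAlgebra γ' ≃ₗ⁅K⁆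
          LieAlgebra.SpecialLinear.sl (Fin 3) K × LieAlgebra.SpecialLinear.sl (Fin 3) K,
        ∀ a b, killingForm K (K ⊗[F] γ.PairAlgebra γ') a b =
          killingForm K (LieAlgebra.SpecialLinear.sl (Fin 3) K) (e a).1 (e b).1 +
          killingForm K (LieAlgebra.SpecialLinear.sl (Fin 3) K) (e a).2 (e b).2) ∧
    -- the restriction to each summand is non-degenerate
    ((killingForm F (γ.PairAlgebra γ')).restrict (Triality.PairAlgebra.upper γ γ')).Nondegenerate ∧
    ((killingForm F (γ.PairAlgebra γ')).restrict (Triality.PairAlgebra.lower γ γ')).Nondegenerate ∧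
    (∀ i, ((killingForm F (γ.PairAlgebra γ')).restrict
      (Triality.PairAlgebra.tensorSector γ γ' i)).Nondegenerate) ∧
    -- on the tensor sectors it is one non-zero multiple of the product metric
    ∃ c : F, c ≠ 0 ∧ ∀ i, ∀ a ∈ Triality.PairAlgebra.tensorSector γ γ' i,
      ∀ b ∈ Triality.PairAlgebra.tensorSector γ γ' i,
        killingForm F (γ.PairAlgebra γ') a b =
          c * (γ.g.tmul γ'.g) (Triality.PairAlgebra.ten a) (Triality.PairAlgebra.ten b) := by
  have h0 : n ≠ 0 := by omega
  have h0' : n' ≠ 0 := by omega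
  refine ⟨Triality.PairAlgebra.killingForm_nondegenerate hγ hγ' h0 h0',
    Triality.PairAlgebra.isSimple hγ hγ' h0 h0', ?_,
    Triality.PairAlgebra.killingForm_restrict_upper_nondegenerate hγ hγ' h0 h0',
    Triality.PairAlgebra.killingForm_restrict_lower_nondegenerate hγ hγ' h0 h0',
    Triality.PairAlgebra.killingForm_restrict_tensorSector_nondegenerate hγ hγ' h0 h0',
    Triality.PairAlgebra.killingFactor F n n', Triality.PairAlgebra.killingFactor_ne_zero h0 h0',
    fun i a ha b hb => Triality.PairAlgebra.killingForm_tensorSector hγ hγ' ha hb⟩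
  rintro ⟨rfl, rfl⟩ K _ _ _
  exact Triality.PairAlgebra.exists_lieEquiv_sl hγ hγ' K
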